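/- **Theorem (PRI Expansion).** Conventions: $\lambda$ is the security parameter. A quantum polynomial-time (QPT) algorithm is a family of quantum circuits $(C_\lambda)$ with polynomially many wires and gates; circuits consist of unitary gates on at most three qubits, may use ancillas initialized to $|0\rangle$ and may trace out wires, so each computes a quantum channel. A function is negligible if it decays faster than every inverse polynomial in $\lambda$. Let $n,m,t:\mathbb N\to\mathbb N$ be polynomially bounded in $\lambda$. A *secure $(n,n+m)$-pseudorandom isometry (PRI)* is a family of isometries $F_{\lambda,k}:\mathbb C^{2^{n}}\to\mathbb C^{2^{n+m}}$, $k\in\{0,1\}^\lambda$, such that (i) $(k,\rho)\mapsto F_{\lambda,k}\,\rho\,F_{\lambda,k}^\dagger$ is computed by a QPT algorithm, and (ii) for all polynomially bounded $q,\ell$ and every QPT distinguisher $D$ there is a negligible $\varepsilon$ such that for all $\lambda$ and all density matrices $\rho$ on $\ell+nq$ qubits, $$\Big|\Pr_{k\leftarrow\{0,1\}^\lambda}\big[D\big((I_\ell\otimes F_{\lambda,k}^{\otimes q})(\rho)\big)=1\big]-\Pr_{\mathcal I}\big[D\big((I_\ell\otimes\mathcal I^{\otimes q})(\rho)\big)=1\big]\Big|\le\varepsilon(\lambda),$$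 where isometries act on $\rho$ by conjugation and $\mathcal I|x\rangle=U|x\rangle|0^m\rangle$ with $U$ a Haar random unitary on $n+m$ qubits. For $N\in\mathbb N$ let $S_{N}:\mathbb C^{\binom{2^N+t-1}{t}}\to(\mathbb C^{2^N})^{\otimes t}$ be the inverse Schur transform restricted to its symmetric block: the basis vectors of its domain are labelled by the multisets $T$ of $t$ strings of $N$ bits (stored in $tN$ qubits as the lexicographically sorted tuple of $T$), and $S_N|T\rangle=U_{\mathsf{Sch}}^\dagger|\Lambda=0\rangle|p_\Lambda=0\rangle|T\rangle$ is the type state of $T$, i.e. the uniform superposition of all distinct tuples with multiset of entries $T$. Let $F$ be a secure $(n,n+m)$-PRI, let $d=d(\lambda)\le\binom{2^n+t-1}{t}$, and regard $\mathbb C^d$ as the span of any $d$ of the basis vectors $|T\rangle$ of the domain of $S_n$. Then $$\mathsf{Enc}_k(\rho)=K_k\,\rho\,K_k^\dagger,\qquad K_k=S_{n+m}^\dagger\,F_{\lambda,k}^{\otimes t}\,S_{n}\big|_{\mathbb C^d},$$ with a uniformly random key $k\in\{0,1\}^\lambda$, is a secure one-time quantum encryption scheme with messages of dimension $d$ and ciphertexts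 of dimension $\binom{2^{n+m}+t-1}{t}$. That is: 1. $(k,\rho)\mapsto\mathsf{Enc}_k(\rho)$ is computed by a QPT algorithm; 2. there is a QPT algorithm $\mathsf{Dec}$ with $\mathsf{Dec}_k(\mathsf{Enc}_k(\rho))=\rho$ for all $\lambda$, $k$ and $\rho$; 3. for every polynomially bounded $\ell$ and every QPT adversary $D$ there is a negligible $\varepsilon$ such that for all $\lambda$ and all density matrices $\rho_0,\rho_1$ on $\ell$ reference qubits and the message system that have the same reduced state on the reference qubits, $$\Big|\Pr_k\big[D((I_\ell\otimes\mathsf{Enc}_k)(\rho_0))=1\big]-\Pr_k\big[D((I_\ell\otimes\mathsf{Enc}_k)(\rho_1))=1\big]\Big|\le\varepsilon(\lambda).$$ Moreover the largest admissible message dimension, $\binom{2^n+t-1}{t}$ (the dimension of the symmetric subspace of $(\mathbb C^{2^n})^{\otimes t}$), is at least the ciphertext dimension divided by $2^{mt}$: $\binom{2^n+t-1}{t}\ge\binom{2^{n+m}+t-1}{t}/2^{mt}$. -/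

import Mathlib

open scoped Matrix ComplexOrder

noncomputable section

/-! ### Qubits, states and quantum systems stored in qubits -/

/-- Labels of the computational basis of `n` qubits. -/
abbrev Qubits (n : ℕ) : Type := Fin n → Bool

/-- Density matrices: positive semidefinite matrices of trace one. -/
def IsDensity {I : Type} [Fintype I] (ρ : Matrix I I ℂ) : Prop :=
  ρ.PosSemidef ∧ ρ.trace = 1

/-- A finite-dimensional quantum system with a fixed orthonormal basis (labelled by `Idx`),
physically stored in qubits (labelled by `Wire`): the basis vector `i` is stored as the
computational basis state `code i`. -/
structure QSystem where
  Idx : Type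
  Wire : Type
  [fintypeIdx : Fintype Idx]
  [decEqIdx : DecidableEq Idx]
  [fintypeWire : Fintype Wire]
  [decEqWire : DecidableEq Wire]
  code : Idx ↪ (Wire → Bool)

attribute [instance] QSystem.fintypeIdx QSystem.decEqIdx QSystem.fintypeWire QSystem.decEqWire

namespace QSystem

/-- The dimension of the Hilbert space of the system. -/
def dim (X : QSystem) : ℕ := Fintype.card X.Idx

/-- The isometry from the Hilbert space of the system to the space of the qubits storing it. -/
def storeIso (X : QSystem) : Matrix (X.Wire → Bool) X.Idx ℂ :=
  Matrix.of fun x i => if X.code i = x then 1 else 0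

/-- The state of the qubits that store an operator `ρ` of the system. -/
def store (X : QSystem) (ρ : Matrix X.Idx X.Idx ℂ) :
    Matrix (X.Wire → Bool) (X.Wire → Bool) ℂ :=
  X.storeIso * ρ * X.storeIsoᴴ

/-- `n` qubits. -/
def qubits (n : ℕ) : QSystem where
  Idx := Qubits n
  Wire := Fin n
  code := Function.Embedding.refl _

/-- `t` registers of `n` qubits each. -/
def copies (t n : ℕ) : QSystem where
  Idx := Fin t → Qubits n
  Wire := Fin t × Fin n
  code := ⟨fun v w => v w.1 w.2, fun _ _ h =>
    funext fun i => funext fun j => congrFun h (i, j)⟩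

/-- The system `X` together with `ℓ` further (reference) qubits. -/
def withRef (ℓ : ℕ) (X : QSystem) : QSystem where
  Idx := Qubits ℓ × X.Idx
  Wire := Fin ℓ ⊕ X.Wire
  code := ⟨fun p => Sum.elim p.1 (X.code p.2), fun p q h => by
    have h1 : p.1 = q.1 := funext fun i => congrFun h (Sum.inl i)
    have h2 : X.code p.2 = X.code q.2 := funext fun i => congrFun h (Sum.inr i)
    exact Prod.ext h1 (X.code.injective h2)⟩

/-- The coordinate subspace of dimension `d` of `X` given by a choice of `d` basis vectors. -/
def coordSubspace (X : QSystem) {d : ℕ} (e : Fin d ↪ X.Idx) : QSystem where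
  Idx := Fin d
  Wire := X.Wire
  code := e.trans X.code

end QSystem

/-- `idᵣ ⊗ Φ` for a (linear) map `Φ` on operators. -/
def ampliate {R I J : Type} (Φ : Matrix I I ℂ → Matrix J J ℂ)
    (ρ : Matrix (R × I) (R × I) ℂ) : Matrix (R × J) (R × J) ℂ :=
  Matrix.of fun x y => Φ (Matrix.of fun i i' => ρ (x.1, i) (y.1, i')) x.2 y.2

/-- The reduced state on the reference system. -/
def reducedRef {R I : Type} [Fintype I] (ρ : Matrix (R × I) (R × I) ℂ) : Matrix R R ℂ :=
  Matrix.of fun r r' => ∑ i, ρ (r, i) (r', i)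

/-- The map `ρ ↦ V ρ V†`. -/
def conjBy {I J : Type} [Fintype I] (V : Matrix J I ℂ) (ρ : Matrix I I ℂ) : Matrix J J ℂ :=
  V * ρ * Vᴴ

/-- The `t`-fold tensor power of a matrix. -/
def tensorPow {I J : Type} (t : ℕ) (V : Matrix J I ℂ) : Matrix (Fin t → J) (Fin t → I) ℂ :=
  Matrix.of fun y x => ∏ i, V (y i) (x i)

/-! ### Quantum circuits with ancillas and discarded wires -/

/-- An elementary gate on wires `W`: an arbitrary unitary on at most three distinct wires. -/
structure QGate (W : Type) where
  arity : ℕ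
  arity_le : arity ≤ 3
  wires : Fin arity ↪ W
  u : Matrix.unitaryGroup (Fin arity → Bool) ℂ

open Classical in
/-- The action of a gate on all the wires (identity on the wires it does not touch). -/
def QGate.toMatrix {W : Type} (g : QGate W) : Matrix (W → Bool) (W → Bool) ℂ :=
  Matrix.of fun x y =>
    if ∀ w, w ∉ Set.range g.wires → x w = y w then
      (g.u : Matrix _ _ ℂ) (fun i => x (g.wires i)) (fun i => y (g.wires i))
    else 0

/-- A circuit with input qubits `A` and output qubits `B`: the wires that are not input wires are
initialized to `|0⟩`, the gates are applied in the order of the list, and the wires that are not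
output wires are traced out. -/
structure QCircuit (A B : Type) where
  W : Type
  [fintypeW : Fintype W]
  [decEqW : DecidableEq W]
  inp : A ↪ W
  out : B ↪ W
  gates : List (QGate W)

attribute [instance] QCircuit.fintypeW QCircuit.decEqW

namespace QCircuit

variable {A B : Type}

/-- Number of wires plus number of gates. -/
def size (C : QCircuit A B) : ℕ := Fintype.card C.W + C.gates.length

/-- The unitary part of the circuit. -/
def unitary (C : QCircuit A B) : Matrix (C.W → Bool) (C.W → Bool) ℂ :=
  C.gates.foldl (fun U g => g.toMatrix * U) 1

open Classical in
/-- The isometry that adds ancilla wires in state `|0⟩`. -/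
def initIso (C : QCircuit A B) : Matrix (C.W → Bool) (A → Bool) ℂ :=
  Matrix.of fun w a =>
    if (∀ i, w (C.inp i) = a i) ∧ ∀ j, j ∉ Set.range C.inp → w j = false then 1 else 0

open Classical in
/-- Partial trace over the wires that are not output wires. -/
def traceOut (C : QCircuit A B) (σ : Matrix (C.W → Bool) (C.W → Bool) ℂ) :
    Matrix (B → Bool) (B → Bool) ℂ :=
  Matrix.of fun y y' => ∑ w, ∑ w',
    if (∀ i, w (C.out i) = y i) ∧ (∀ i, w' (C.out i) = y' i) ∧
        ∀ j, j ∉ Set.range C.out → w j = w' j then σ w w' else 0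

/-- The quantum channel computed by the circuit. -/
def run [Fintype A] [DecidableEq A] (C : QCircuit A B) (σ : Matrix (A → Bool) (A → Bool) ℂ) :
    Matrix (B → Bool) (B → Bool) ℂ :=
  C.traceOut (C.unitary * (C.initIso * σ * C.initIsoᴴ) * C.unitaryᴴ)

/-- The probability that a circuit with a single output qubit outputs `1`. -/
def acceptProb [Fintype A] [DecidableEq A] (C : QCircuit A Unit)
    (σ : Matrix (A → Bool) (A → Bool) ℂ) : ℝ :=
  (C.run σ (fun _ => true) (fun _ => true)).re

end QCircuit

/-- The operator `|k⟩⟨k| ⊗ σ`. -/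
def withKey {K A : Type} [Fintype K] [DecidableEq K] (k : K → Bool)
    (σ : Matrix (A → Bool) (A → Bool) ℂ) : Matrix (K ⊕ A → Bool) (K ⊕ A → Bool) ℂ :=
  Matrix.of fun x y =>
    if (fun i => x (Sum.inl i)) = k ∧ (fun i => y (Sum.inl i)) = k then
      σ (fun a => x (Sum.inr a)) (fun a => y (Sum.inr a))
    else 0

/-! ### Asymptotics -/

/-- Bounded by a polynomial in the security parameter. -/
def PolyBounded (f : ℕ → ℕ) : Prop := ∃ p : Polynomial ℕ, ∀ κ, f κ ≤ p.eval κ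

/-- Negligible functions: smaller than every inverse polynomial. -/
def Negligible (ε : ℕ → ℝ) : Prop :=
  Asymptotics.SuperpolynomialDecay Filter.atTop (fun κ : ℕ => (κ : ℝ)) ε

/-- A quantum polynomial-time algorithm: a family of circuits of polynomial size. -/
def IsQPT {A B : ℕ → Type} (C : ∀ κ, QCircuit (A κ) (B κ)) : Prop :=
  PolyBounded fun κ => (C κ).size

/-- The average over a uniformly random key of `κ` bits. -/
def keyAvg (κ : ℕ) (f : Qubits κ → ℝ) : ℝ := (∑ k, f k) / 2 ^ κ

/-! ### Haar isometries -/

instance unitaryGroupMeasurableSpace (I : Type) [Fintype I] [DecidableEq I] :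
    MeasurableSpace (Matrix.unitaryGroup I ℂ) := borel _

instance unitaryGroupBorelSpace (I : Type) [Fintype I] [DecidableEq I] :
    BorelSpace (Matrix.unitaryGroup I ℂ) := ⟨rfl⟩

instance unitaryGroupCompactSpace (I : Type) [Fintype I] [DecidableEq I] :
    CompactSpace (Matrix.unitaryGroup I ℂ) := by
  suffices h : IsCompact (((Matrix.unitaryGroup I ℂ : Submonoid _) : Set (Matrix I I ℂ))) from isCompact_iff_compactSpace.mp h
  have hK : IsCompact
      {M : Matrix I I ℂ | ∀ i j, M i j ∈ Metric.closedBall (0 : ℂ) 1} := by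
    have := isCompact_univ_pi (X := fun _ : I => I → ℂ) (s := fun _ : I =>
      Set.univ.pi fun _ : I => Metric.closedBall (0 : ℂ) 1)
      (fun _ => isCompact_univ_pi fun _ => isCompact_closedBall _ _)
    refine this.of_isClosed_subset ?_ ?_
    · have : {M : Matrix I I ℂ | ∀ i j, M i j ∈ Metric.closedBall (0 : ℂ) 1} =
          ⋂ i, ⋂ j, (fun M : Matrix I I ℂ => M i j) ⁻¹' Metric.closedBall (0 : ℂ) 1 := by
        ext M; simp
      rw [this]
      exact isClosed_iInter fun i => isClosed_iInter fun j =>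
        Metric.isClosed_closedBall.preimage (continuous_id.matrix_elem i j)
    · intro M hM
      have hM' : ∀ i j, M i j ∈ Metric.closedBall (0 : ℂ) 1 := hM
      simpa [Set.mem_pi] using hM'
  refine hK.of_isClosed_subset ?_ ?_
  · have : ((Matrix.unitaryGroup I ℂ : Submonoid _) : Set (Matrix I I ℂ)) =
        {M | star M * M = 1} ∩ {M | M * star M = 1} := by
      ext M; exact Unitary.mem_iff
    rw [this]
    exact (isClosed_eq (continuous_star.mul continuous_id) continuous_const).inter
      (isClosed_eq (continuous_id.mul continuous_star) continuous_const)
  · intro M hM i j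
    simpa using entry_norm_bound_of_unitary hM i j

/-- The Haar probability measure on the unitary group. -/
def haarUnitary (I : Type) [Fintype I] [DecidableEq I] :
    MeasureTheory.Measure (Matrix.unitaryGroup I ℂ) :=
  MeasureTheory.Measure.haarMeasure ⊤

/-- The isometry `|x⟩ ↦ U |x⟩|0^m⟩` from `n` to `n + m` qubits. -/
def truncate {n m : ℕ} (U : Matrix.unitaryGroup (Qubits (n + m)) ℂ) :
    Matrix (Qubits (n + m)) (Qubits n) ℂ :=
  Matrix.of fun y x => (U : Matrix (Qubits (n + m)) (Qubits (n + m)) ℂ) y (Fin.append x fun _ => false)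

/-! ### Pseudorandom isometries -/

/-- The state held by a distinguisher after `id_ℓ ⊗ V^{⊗q}` has been applied to the (arbitrary)
query `ρ` on `ℓ + q·a` qubits. -/
def queryState {a b : ℕ} (ℓ q : ℕ) (V : Matrix (Qubits b) (Qubits a) ℂ)
    (ρ : Matrix (Qubits ℓ × (Fin q → Qubits a)) (Qubits ℓ × (Fin q → Qubits a)) ℂ) :
    Matrix (Fin ℓ ⊕ Fin q × Fin b → Bool) (Fin ℓ ⊕ Fin q × Fin b → Bool) ℂ :=
  (QSystem.withRef ℓ (QSystem.copies q b)).store (ampliate (conjBy (tensorPow q V)) ρ)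

/-- `F` is a secure `(n, n+m)`-pseudorandom isometry with key length equal to the security
parameter: each `F κ k` is an isometry, `(k, ρ) ↦ F_k ρ F_k†` is computed by a quantum
polynomial-time algorithm, and no quantum polynomial-time distinguisher can tell `q` parallel
uses of `F_k`, for a random key `k`, from `q` parallel uses of a Haar random isometry, on any
input state (possibly entangled with `ℓ` qubits kept by the distinguisher). -/
structure IsSecurePRI (n m : ℕ → ℕ)
    (F : ∀ κ, Qubits κ → Matrix (Qubits (n κ + m κ)) (Qubits (n κ)) ℂ) : Prop where
  isometry : ∀ κ k, (F κ k)ᴴ * F κ k = 1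
  efficient : ∃ C : ∀ κ, QCircuit (Fin κ ⊕ Fin (n κ)) (Fin (n κ + m κ)), IsQPT C ∧
    ∀ κ (k : Qubits κ) (ρ : Matrix (Qubits (n κ)) (Qubits (n κ)) ℂ),
      (C κ).run (withKey k ρ) = conjBy (F κ k) ρ
  pseudorandom : ∀ q ℓ : ℕ → ℕ, PolyBounded q → PolyBounded ℓ →
    ∀ D : ∀ κ, QCircuit (Fin (ℓ κ) ⊕ Fin (q κ) × Fin (n κ + m κ)) Unit, IsQPT D →
      ∃ ε : ℕ → ℝ, Negligible ε ∧ ∀ κ ρ, IsDensity ρ →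
        |keyAvg κ (fun k => (D κ).acceptProb (queryState (ℓ κ) (q κ) (F κ k) ρ)) -
          ∫ U, (D κ).acceptProb (queryState (ℓ κ) (q κ) (truncate U) ρ)
            ∂(haarUnitary (Qubits (n κ + m κ)))| ≤ ε κ

/-! ### One-time encryption of quantum messages -/

/-- A keyed family of maps from operators on a message system to operators on a ciphertext
system; the key is a string of `κ` bits. -/
structure QEncScheme where
  Msg : ℕ → QSystem
  Ctx : ℕ → QSystem
  enc : ∀ κ, Qubits κ →
    Matrix (Msg κ).Idx (Msg κ).Idx ℂ → Matrix (Ctx κ).Idx (Ctx κ).Idx ℂ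

/-- A secure one-time quantum encryption scheme: encryption and decryption are quantum
polynomial-time, decryption recovers the message exactly, and, for a random key, the ciphertexts
(one per key) of any two message states, each possibly entangled with qubits held by the
adversary, are indistinguishable for quantum polynomial-time adversaries provided that the
adversary's qubits alone have the same state in both cases. -/
structure QEncScheme.IsSecureOneTime (E : QEncScheme) : Prop where
  enc_efficient : ∃ C : ∀ κ, QCircuit (Fin κ ⊕ (E.Msg κ).Wire) (E.Ctx κ).Wire, IsQPT C ∧
    ∀ κ k ρ, (C κ).run (withKey k ((E.Msg κ).store ρ)) = (E.Ctx κ).store (E.enc κ k ρ)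
  correct : ∃ C : ∀ κ, QCircuit (Fin κ ⊕ (E.Ctx κ).Wire) (E.Msg κ).Wire, IsQPT C ∧
    ∀ κ k ρ, (C κ).run (withKey k ((E.Ctx κ).store (E.enc κ k ρ))) = (E.Msg κ).store ρ
  secure : ∀ ℓ : ℕ → ℕ, PolyBounded ℓ →
    ∀ D : ∀ κ, QCircuit (Fin (ℓ κ) ⊕ (E.Ctx κ).Wire) Unit, IsQPT D →
      ∃ ε : ℕ → ℝ, Negligible ε ∧
        ∀ κ (ρ₀ ρ₁ : Matrix (Qubits (ℓ κ) × (E.Msg κ).Idx) (Qubits (ℓ κ) × (E.Msg κ).Idx) ℂ),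
          IsDensity ρ₀ → IsDensity ρ₁ → reducedRef ρ₀ = reducedRef ρ₁ →
          |keyAvg κ (fun k => (D κ).acceptProb
              ((QSystem.withRef (ℓ κ) (E.Ctx κ)).store (ampliate (E.enc κ k) ρ₀))) -
            keyAvg κ (fun k => (D κ).acceptProb
              ((QSystem.withRef (ℓ κ) (E.Ctx κ)).store (ampliate (E.enc κ k) ρ₁)))| ≤ ε κ

/-! ### The symmetric block of the Schur transform -/

/-- The type of a tuple: the multiset of its entries. -/
def typeOf {I : Type} {t : ℕ} (v : Fin t → I) : Sym I t :=
  ⟨Finset.univ.val.map v, by simp⟩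

/-- The inverse Schur transform `U_Sch† |Λ = 0⟩|p_Λ = 0⟩|T⟩ = |type_T⟩` of `(ℂ^I)^{⊗t}` on the
block of the trivial representation of the symmetric group. That block is the symmetric
subspace; its permutation register is one-dimensional, and its Schur basis consists of the type
states `|type_T⟩`, the uniform superpositions of all the tuples of type `T`. -/
def schurSym (I : Type) [Fintype I] [DecidableEq I] (t : ℕ) : Matrix (Fin t → I) (Sym I t) ℂ :=
  Matrix.of fun v T =>
    if typeOf v = T then
      ((1 / Real.sqrt ((Finset.univ.filter fun w : Fin t → I => typeOf w = T).card : ℝ) : ℝ) : ℂ)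
    else 0

/-- The list of the elements of a multiset of bit strings in increasing lexicographic order. -/
def sortedList {N t : ℕ} (T : Sym (Qubits N) t) : List (Lex (Qubits N)) :=
  ((T : Multiset (Qubits N)).map toLex).sort (· ≤ ·)

theorem sortedList_length {N t : ℕ} (T : Sym (Qubits N) t) : (sortedList T).length = t := by
  simp [sortedList]

/-- The elements of a multiset of bit strings in increasing lexicographic order. -/
def sortedTuple {N t : ℕ} (T : Sym (Qubits N) t) (i : Fin t) : Qubits N :=
  ofLex ((sortedList T).get (i.cast (sortedList_length T).symm))

theorem sortedTuple_injective {N t : ℕ} :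
    Function.Injective (sortedTuple : Sym (Qubits N) t → Fin t → Qubits N) := by
  intro S T h
  have hl : sortedList S = sortedList T := by
    refine List.ext_get (by rw [sortedList_length, sortedList_length]) fun i h1 h2 => ?_
    have := congrFun h ⟨i, by rwa [sortedList_length] at h1⟩
    exact ofLex.injective this
  have hm : (S : Multiset (Qubits N)).map toLex = (T : Multiset (Qubits N)).map toLex := by
    have := congrArg (fun l : List (Lex (Qubits N)) => (l : Multiset (Lex (Qubits N)))) hl
    simpa [sortedList] using this
  exact Subtype.ext (Multiset.map_injective toLex.injective hm)

/-- The register of the Schur transform of `(ℂ^(2^N))^{⊗t}` that carries the symmetric block: its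
basis is labelled by the types, and a type is stored as its sorted tuple of `N`-bit strings. -/
def typeSystem (N t : ℕ) : QSystem where
  Idx := Sym (Qubits N) t
  Wire := Fin t × Fin N
  code := Function.Embedding.trans ⟨sortedTuple, sortedTuple_injective⟩ (QSystem.copies t N).code

/-- The one-time encryption scheme obtained from an isometry family `F` and a number `t` of
copies: a message of dimension `d` (placed into the symmetric block via `e`) is mapped to
`(ℂ^(2^n))^{⊗t}` by the inverse Schur transform, then `F_k^{⊗t}` is applied, then the Schur
transform of `(ℂ^(2^(n+m)))^{⊗t}`, whose symmetric block is the ciphertext. -/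
def expand (n m t : ℕ → ℕ)
    (F : ∀ κ, Qubits κ → Matrix (Qubits (n κ + m κ)) (Qubits (n κ)) ℂ)
    (d : ℕ → ℕ) (e : ∀ κ, Fin (d κ) ↪ Sym (Qubits (n κ)) (t κ)) : QEncScheme where
  Msg κ := (typeSystem (n κ) (t κ)).coordSubspace (e κ)
  Ctx κ := typeSystem (n κ + m κ) (t κ)
  enc κ k ρ :=
    conjBy ((schurSym (Qubits (n κ + m κ)) (t κ))ᴴ * tensorPow (t κ) (F κ k) *
      (schurSym (Qubits (n κ)) (t κ)).submatrix id (e κ)) ρ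

end

/-! Security is Schur's lemma on the symmetric subspace. Let `symPow t V` be V^{⊗t} written in the
basis of type states. Since V^{⊗t} commutes with permutations of the tensor factors, it maps
symmetric tensors to symmetric tensors (`schurSym_mul_symPow`). Hence `symPow` is multiplicative and
preserves isometries, and K_k is the restriction of `symPow t F_k` to ℂ^d. If F_k is replaced by the
Haar isometry, the encryption becomes `symPow t U` after a fixed isometry G. Averaging over U
produces an operator that commutes with every `symPow t V`, and such an operator is scalar
(`eq_smul_one_of_commute`): diagonal unitaries with a phase of order t + 1 count the occurrences of
a symbol and so kill the off-diagonal entries, and a single unitary without zero entries forces the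
diagonal entries to agree. The average ciphertext is therefore the reduced reference state tensored
with the maximally mixed state (`integral_ampliate`), the same for both messages. Passing from F_k
to the Haar isometry costs ε for each message. The distinguisher used for this makes q = t queries,
with the message already turned into type states, and undoes the type state preparation before it
runs the adversary (`exists_schurCircuit`).

Efficiency needs a small circuit that turns a stored type into its type state. It is built by
recursion on t: the type state of a sorted (t+1)-tuple v is the sum, over the distinct values x in
v, of √(mult(x)/(t+1)) times the type state of v with one x removed, followed by x in the last
register (`schurSym_recursion`). The first position of x is prepared in a unary register by a
downward walk of controlled rotations (`prod_rotStep_ket`), the entry found there is swapped to the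
end, and the position is erased by comparing the other registers with the last one
(`exists_clean_erasePos`). Ancillas always return to zero, so the preparation can be inverted.

The circuit for F only promises the channel ρ ↦ FρF†. As this channel is an isometry, the unitary
part of the circuit must yield F|x⟩ times garbage γ that depends on the key but not on x
(`QCircuit.exists_garbage`). Encryption discards γ. Decryption has to run the circuit backwards and
needs γ: it runs fresh copies on input |0⟩, puts F|0⟩ aside, lets the ciphertext take the place of
the output wires, and applies the inverse gates (`decGates_mulVec`).

The bound on the rate compares rising factorials factor by factor. -/

open scoped Matrix ComplexOrder

noncomputable section

/-! ### Operators acting on some of the wires -/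

section OnWires

variable {A B W : Type}

open Classical in
/-- The operator `M` on the wires `ι`, acting as the identity on the other wires. -/
def onWires (ι : A ↪ W) (M : Matrix (A → Bool) (A → Bool) ℂ) :
    Matrix (W → Bool) (W → Bool) ℂ :=
  Matrix.of fun x y =>
    if ∀ w, w ∉ Set.range ι → x w = y w then M (fun i => x (ι i)) (fun i => y (ι i)) else 0

theorem QGate.toMatrix_eq (g : QGate W) : g.toMatrix = onWires g.wires g.u := rfl

theorem extend_apply_emb (ι : A ↪ W) (z : A → Bool) (x : W → Bool) (a : A) :
    Function.extend ι z x (ι a) = z a := ι.injective.extend_apply z x a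

theorem extend_apply_off (ι : A ↪ W) (z : A → Bool) (x : W → Bool) {w : W}
    (h : w ∉ Set.range ι) : Function.extend ι z x w = x w :=
  Function.extend_apply' z x w (by simpa using h)

theorem extend_injective_left (ι : A ↪ W) (x : W → Bool) :
    Function.Injective fun z : A → Bool => Function.extend ι z x := fun z z' h => by
  funext a
  simpa [extend_apply_emb] using congrFun h (ι a)

theorem extend_restrict (ι : A ↪ W) (x y : W → Bool) (h : ∀ w, w ∉ Set.range ι → x w = y w) :
    Function.extend ι (fun i => y (ι i)) x = y := by
  funext w
  by_cases hw : w ∈ Set.range ι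
  · obtain ⟨a, rfl⟩ := hw
    rw [extend_apply_emb]
  · rw [extend_apply_off _ _ _ hw, h w hw]

theorem extend_eq_iff (ι : A ↪ W) (z : A → Bool) (x y : W → Bool) :
    Function.extend ι z x = y ↔
      (∀ w, w ∉ Set.range ι → x w = y w) ∧ z = fun i => y (ι i) := by
  constructor
  · rintro rfl
    exact ⟨fun w hw => (extend_apply_off _ _ _ hw).symm,
      funext fun i => (extend_apply_emb _ _ _ _).symm⟩
  · rintro ⟨h, rfl⟩
    exact extend_restrict ι x y h

variable [Fintype A] [DecidableEq A] [Fintype B] [DecidableEq B] [Fintype W] [DecidableEq W]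

/-- Only the assignments that agree with `x` off the range of `ι` contribute, and `z ↦
Function.extend ι z x` parametrises them bijectively. -/
theorem onWires_mulVec (ι : A ↪ W) (M : Matrix (A → Bool) (A → Bool) ℂ)
    (ψ : (W → Bool) → ℂ) (x : W → Bool) :
    (onWires ι M *ᵥ ψ) x = (M *ᵥ fun z => ψ (Function.extend ι z x)) fun i => x (ι i) := by
  symm
  refine Fintype.sum_of_injective _ (extend_injective_left ι x) _ _ ?_ ?_
  · intro y hy
    have : ¬ ∀ w, w ∉ Set.range ι → x w = y w := fun h =>
      hy ⟨fun i => y (ι i), extend_restrict ι x y h⟩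
    simp only [onWires, Matrix.of_apply, if_neg this, zero_mul]
  · intro z
    have : ∀ w, w ∉ Set.range ι → x w = Function.extend ι z x w := fun w hw =>
      (extend_apply_off _ _ _ hw).symm
    simp only [onWires, Matrix.of_apply, if_pos this, extend_apply_emb]

/-- An operator on the wires `ι` acts on the first factor of a product of a function of these
wires and a function of the other wires. -/
theorem onWires_mulVec_mul (ι : A ↪ W) (M : Matrix (A → Bool) (A → Bool) ℂ)
    (φ : (A → Bool) → ℂ) (Γ : (W → Bool) → ℂ)
    (hΓ : ∀ z x, Γ (Function.extend ι z x) = Γ x) :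
    onWires ι M *ᵥ (fun x => φ (fun i => x (ι i)) * Γ x) =
      fun x => (M *ᵥ φ) (fun i => x (ι i)) * Γ x := by
  funext x
  rw [onWires_mulVec]
  simp only [extend_apply_emb, hΓ, Matrix.mulVec, dotProduct, Finset.sum_mul, mul_assoc]

theorem onWires_one (ι : A ↪ W) : onWires ι 1 = 1 := by
  refine Matrix.ext_of_mulVec_single fun x => funext fun y => ?_
  rw [onWires_mulVec, Matrix.one_mulVec, Matrix.one_mulVec]
  congr 1
  exact extend_restrict ι y y fun _ _ => rfl

omit [DecidableEq A] [Fintype A] [Fintype W] [DecidableEq W] in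
theorem extend_extend (ι : A ↪ W) (z z' : A → Bool) (x : W → Bool) :
    Function.extend ι z (Function.extend ι z' x) = Function.extend ι z x := by
  funext w
  by_cases hw : w ∈ Set.range ι
  · obtain ⟨a, rfl⟩ := hw
    simp only [extend_apply_emb]
  · simp only [extend_apply_off _ _ _ hw]

theorem onWires_mul (ι : A ↪ W) (M N : Matrix (A → Bool) (A → Bool) ℂ) :
    onWires ι (M * N) = onWires ι M * onWires ι N := by
  refine Matrix.ext_of_mulVec_single fun x => funext fun y => ?_
  rw [← Matrix.mulVec_mulVec, onWires_mulVec, onWires_mulVec, ← Matrix.mulVec_mulVec]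
  refine congrFun (congrArg _ (funext fun z => ?_)) _
  rw [onWires_mulVec]
  simp only [extend_extend, extend_apply_emb]

omit [Fintype A] [DecidableEq A] [Fintype W] [DecidableEq W] in
theorem onWires_conjTranspose (ι : A ↪ W) (M : Matrix (A → Bool) (A → Bool) ℂ) :
    onWires ι Mᴴ = (onWires ι M)ᴴ := by
  ext x y
  simp only [onWires, Matrix.of_apply, Matrix.conjTranspose_apply]
  by_cases h : ∀ w, w ∉ Set.range ι → x w = y w
  · rw [if_pos h, if_pos fun w hw => (h w hw).symm]
  · rw [if_neg h, if_neg fun h' => h fun w hw => (h' w hw).symm, star_zero]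

omit [Fintype A] [DecidableEq A] [Fintype B] [DecidableEq B] [Fintype W] [DecidableEq W] in
theorem onWires_trans (ι : A ↪ B) (ι' : B ↪ W) (M : Matrix (A → Bool) (A → Bool) ℂ) :
    onWires (ι.trans ι') M = onWires ι' (onWires ι M) := by
  classical
  ext x y
  simp only [onWires, Matrix.of_apply, Function.Embedding.trans_apply]
  rw [← ite_and]
  refine if_congr ⟨fun h => ⟨fun w hw => h w ?_, fun b hb => h _ ?_⟩, fun h w hw => ?_⟩ rfl rfl
  · rintro ⟨a, rfl⟩
    exact hw ⟨ι a, rfl⟩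
  · rintro ⟨a, ha⟩
    exact hb ⟨a, ι'.injective ha⟩
  · by_cases hw' : w ∈ Set.range ι'
    · obtain ⟨b, rfl⟩ := hw'
      refine h.2 b ?_
      rintro ⟨a, rfl⟩
      exact hw ⟨a, rfl⟩
    · exact h.1 w hw'

end OnWires

/-! ### Lists of gates -/

section GateLists

variable {V W : Type}

/-- A gate moved along an embedding of wires. -/
def QGate.map (ι : V ↪ W) (g : QGate V) : QGate W where
  arity := g.arity
  arity_le := g.arity_le
  wires := g.wires.trans ι
  u := g.u

/-- The inverse gate. -/
def QGate.inverse (g : QGate W) : QGate W where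
  arity := g.arity
  arity_le := g.arity_le
  wires := g.wires
  u := g.u⁻¹

variable [Fintype V] [DecidableEq V] [Fintype W] [DecidableEq W]

/-- The operator of a list of gates, applied in the order of the list. -/
def gatesMatrix (l : List (QGate W)) : Matrix (W → Bool) (W → Bool) ℂ :=
  l.foldl (fun U g => g.toMatrix * U) 1

theorem QCircuit.unitary_eq {A B : Type} (C : QCircuit A B) : C.unitary = gatesMatrix C.gates :=
  rfl

theorem foldl_gates (l : List (QGate W)) (U : Matrix (W → Bool) (W → Bool) ℂ) :
    l.foldl (fun U g => g.toMatrix * U) U = gatesMatrix l * U := by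
  induction l generalizing U with
  | nil => simp [gatesMatrix]
  | cons g l ih =>
    rw [gatesMatrix, List.foldl_cons, List.foldl_cons, ih, ih (g.toMatrix * 1), mul_one, mul_assoc]

@[simp] theorem gatesMatrix_nil : gatesMatrix ([] : List (QGate W)) = 1 := rfl

theorem gatesMatrix_append (l l' : List (QGate W)) :
    gatesMatrix (l ++ l') = gatesMatrix l' * gatesMatrix l := by
  rw [gatesMatrix, List.foldl_append, foldl_gates]
  rfl

theorem gatesMatrix_cons (g : QGate W) (l : List (QGate W)) :
    gatesMatrix (g :: l) = gatesMatrix l * g.toMatrix := by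
  rw [gatesMatrix, List.foldl_cons, foldl_gates, mul_one]

theorem gatesMatrix_singleton (g : QGate W) : gatesMatrix [g] = g.toMatrix := by
  rw [gatesMatrix_cons, gatesMatrix_nil, one_mul]

theorem gatesMatrix_map (ι : V ↪ W) (l : List (QGate V)) :
    gatesMatrix (l.map (QGate.map ι)) = onWires ι (gatesMatrix l) := by
  induction l with
  | nil => simp [onWires_one]
  | cons g l ih =>
    rw [List.map_cons, gatesMatrix_cons, gatesMatrix_cons, ih, onWires_mul]
    congr 1
    rw [QGate.toMatrix_eq, QGate.toMatrix_eq, ← onWires_trans]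
    rfl

/-- The list of gates that undoes `l`. -/
def inverseGates (l : List (QGate W)) : List (QGate W) := (l.map QGate.inverse).reverse

omit [Fintype W] [DecidableEq W] in
@[simp] theorem length_inverseGates (l : List (QGate W)) :
    (inverseGates l).length = l.length := by simp [inverseGates]

theorem gatesMatrix_inverse (l : List (QGate W)) :
    gatesMatrix (inverseGates l) = (gatesMatrix l)ᴴ := by
  induction l with
  | nil => simp [inverseGates]
  | cons g l ih =>
    have : inverseGates (g :: l) = inverseGates l ++ [g.inverse] := by simp [inverseGates]
    rw [this, gatesMatrix_append, gatesMatrix_singleton, gatesMatrix_cons, ih,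
      Matrix.conjTranspose_mul, QGate.toMatrix_eq, QGate.toMatrix_eq, ← onWires_conjTranspose]
    rfl

theorem QGate.conjTranspose_mul_self (g : QGate W) : g.toMatrixᴴ * g.toMatrix = 1 := by
  rw [QGate.toMatrix_eq, ← onWires_conjTranspose, ← onWires_mul]
  have := Matrix.UnitaryGroup.star_mul_self g.u
  rw [Matrix.star_eq_conjTranspose] at this
  rw [this, onWires_one]

theorem gatesMatrix_conjTranspose_mul_self (l : List (QGate W)) :
    (gatesMatrix l)ᴴ * gatesMatrix l = 1 := by
  induction l with
  | nil => simp
  | cons g l ih =>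
    rw [gatesMatrix_cons, Matrix.conjTranspose_mul, mul_assoc, ← mul_assoc _ (gatesMatrix l), ih,
      one_mul, g.conjTranspose_mul_self]

/-- The form in which uncomputation is used: knowing a circuit forwards on one vector suffices to
know its inverse on the image, even when the circuit is uncontrolled elsewhere. -/
theorem gatesMatrix_inverse_mulVec (l : List (QGate W)) {ψ φ : (W → Bool) → ℂ}
    (h : gatesMatrix l *ᵥ ψ = φ) : gatesMatrix (inverseGates l) *ᵥ φ = ψ := by
  rw [← h, gatesMatrix_inverse, Matrix.mulVec_mulVec, gatesMatrix_conjTranspose_mul_self,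
    Matrix.one_mulVec]

end GateLists

/-! ### Basis vectors and controlled gates -/

section Kets

variable {A W : Type} [Fintype A] [DecidableEq A] [Fintype W] [DecidableEq W]

/-- The computational basis vector `|x⟩`. -/
def ket {W : Type} [Fintype W] [DecidableEq W] (x : W → Bool) : (W → Bool) → ℂ := Pi.single x 1

theorem ket_apply (x y : W → Bool) : ket x y = if y = x then 1 else 0 := by
  simp [ket, Pi.single_apply]

theorem mulVec_ket {I : Type} (M : Matrix I (W → Bool) ℂ) (x : W → Bool) (y : I) :
    (M *ᵥ ket x) y = M y x := by
  simp [ket]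

theorem vec_eq_sum_ket (ψ : (W → Bool) → ℂ) : ψ = ∑ x, ψ x • ket x := by
  funext y
  simp [Finset.sum_apply, ket_apply]

theorem mulVec_sum_smul {I J K : Type} [Fintype I] (M : Matrix K I ℂ) (s : Finset J) (c : J → ℂ)
    (v : J → I → ℂ) : M *ᵥ (∑ j ∈ s, c j • v j) = ∑ j ∈ s, c j • (M *ᵥ v j) := by
  rw [Matrix.mulVec_sum]
  simp only [Matrix.mulVec_smul]

theorem matrix_ext_ket {I : Type} {M N : Matrix I (W → Bool) ℂ}
    (h : ∀ x, M *ᵥ ket x = N *ᵥ ket x) : M = N := by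
  ext y x
  have := congrFun (h x) y
  rwa [mulVec_ket, mulVec_ket] at this

theorem onWires_ket (ι : A ↪ W) (M : Matrix (A → Bool) (A → Bool) ℂ) (x : W → Bool) :
    onWires ι M *ᵥ ket x =
      ∑ z, (M *ᵥ ket fun i => x (ι i)) z • ket (Function.extend ι z x) := by
  classical
  funext y
  rw [mulVec_ket, Finset.sum_apply, onWires, Matrix.of_apply]
  simp only [Pi.smul_apply, ket_apply, smul_eq_mul, mul_ite, mul_one, mul_zero,
    eq_comm (a := y), extend_eq_iff, mulVec_ket]
  by_cases h : ∀ w, w ∉ Set.range ι → y w = x w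
  · have h' : ∀ w, w ∉ Set.range ι → x w = y w := fun w hw => (h w hw).symm
    rw [if_pos h, Finset.sum_eq_single fun i => y (ι i), if_pos ⟨h', rfl⟩]
    · exact fun z _ hz => if_neg fun h => hz h.2
    · simp
  · have h' : ¬ ∀ w, w ∉ Set.range ι → x w = y w := fun h' => h fun w hw => (h' w hw).symm
    rw [if_neg h]
    simp only [h', false_and, if_false, Finset.sum_const_zero]

theorem onWires_ket_of_sum (ι : A ↪ W) (M : Matrix (A → Bool) (A → Bool) ℂ) (x : W → Bool)
    {J : Type} (s : Finset J) (c : J → ℂ) (z : J → A → Bool)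
    (h : (M *ᵥ ket fun i => x (ι i)) = ∑ j ∈ s, c j • ket (z j)) :
    onWires ι M *ᵥ ket x = ∑ j ∈ s, c j • ket (Function.extend ι (z j) x) := by
  rw [onWires_ket, h]
  simp only [Finset.sum_apply, Pi.smul_apply, Finset.sum_smul, ket_apply, smul_eq_mul, mul_ite,
    mul_one, mul_zero, ite_smul, zero_smul]
  rw [Finset.sum_comm]
  simp

theorem onWires_ket_of_ket (ι : A ↪ W) (M : Matrix (A → Bool) (A → Bool) ℂ) (x : W → Bool)
    (z : A → Bool) (h : (M *ᵥ ket fun i => x (ι i)) = ket z) :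
    onWires ι M *ᵥ ket x = ket (Function.extend ι z x) := by
  have := onWires_ket_of_sum ι M x (Finset.univ : Finset Unit) (fun _ => 1) (fun _ => z)
    (by simpa using h)
  simpa using this

/-- The one-qubit gate `R`, if the condition holds, and the identity otherwise. -/
def condGate (P : Prop) [Decidable P] (R : Matrix.unitaryGroup Bool ℂ) : Matrix Bool Bool ℂ :=
  if P then R else 1

open Classical in
/-- The gate `R` on a target (wire `0`), controlled on a predicate of the `k` other wires. -/
def controlledUnitary (k : ℕ) (f : (Fin k → Bool) → Prop) (R : Matrix.unitaryGroup Bool ℂ) :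
    Matrix.unitaryGroup (Fin (k + 1) → Bool) ℂ :=
  ⟨(Matrix.blockDiagonal fun c => condGate (f c) R).submatrix
    (Fin.consEquiv fun _ => Bool).symm (Fin.consEquiv fun _ => Bool).symm, by
    rw [Matrix.mem_unitaryGroup_iff', Matrix.star_eq_conjTranspose, Matrix.conjTranspose_submatrix,
      Matrix.submatrix_mul_equiv, Matrix.blockDiagonal_conjTranspose, ← Matrix.blockDiagonal_mul]
    have : (fun c => (condGate (f c) R)ᴴ * condGate (f c) R) = 1 := by
      funext c
      unfold condGate
      split_ifs
      · have := Matrix.UnitaryGroup.star_mul_self R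
        rwa [Matrix.star_eq_conjTranspose] at this
      · simp
    rw [this, Matrix.blockDiagonal_one, Matrix.submatrix_one_equiv]⟩

/-- The controlled gate on given wires; wire `0` is the target. -/
def controlledGate (k : ℕ) (hk : k ≤ 2) (ι : Fin (k + 1) ↪ W) (f : (Fin k → Bool) → Prop)
    (R : Matrix.unitaryGroup Bool ℂ) : QGate W where
  arity := k + 1
  arity_le := by omega
  wires := ι
  u := controlledUnitary k f R

open Classical in
theorem controlledGate_ket (k : ℕ) (hk : k ≤ 2) (ι : Fin (k + 1) ↪ W) (f : (Fin k → Bool) → Prop)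
    (R : Matrix.unitaryGroup Bool ℂ) (x : W → Bool) :
    (controlledGate k hk ι f R).toMatrix *ᵥ ket x =
      ∑ b, condGate (f fun i => x (ι i.succ)) R b (x (ι 0)) •
        ket (Function.update x (ι 0) b) := by
  rw [QGate.toMatrix_eq]
  change onWires ι (controlledUnitary k f R : Matrix _ _ ℂ) *ᵥ ket x = _
  rw [onWires_ket_of_sum ι _ x Finset.univ
    (fun b => condGate (f fun i => x (ι i.succ)) R b (x (ι 0)))
    (fun b => Fin.cons (α := fun _ => Bool) b fun i => x (ι i.succ))]
  · refine Finset.sum_congr rfl fun b _ => ?_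
    congr 2
    rw [extend_eq_iff]
    constructor
    · intro w hw
      rw [Function.update_of_ne]
      rintro rfl
      exact hw ⟨0, rfl⟩
    · funext i
      refine Fin.cases ?_ (fun i => ?_) i
      · simp
      · rw [Function.update_of_ne (by simp), Fin.cons_succ]
  · funext y
    rw [mulVec_ket, Finset.sum_apply]
    simp only [Pi.smul_apply, ket_apply, smul_eq_mul, mul_ite, mul_one, mul_zero]
    refine Fin.consCases (fun b c => ?_) y
    simp only [controlledUnitary, Matrix.submatrix_apply, Matrix.blockDiagonal_apply,
      Fin.consEquiv_symm_apply, Fin.cons_zero, Fin.tail_cons, Fin.cons_inj]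
    by_cases hc : c = fun i => x (ι i.succ)
    · subst hc
      have : (fun i => x (ι i.succ)) = Fin.tail fun i => x (ι i) := rfl
      rw [← this]
      simp
    · have : c ≠ Fin.tail fun i => x (ι i) := hc
      simp [hc, this]

/-- The `NOT` gate. -/
def notGate : Matrix.unitaryGroup Bool ℂ :=
  ⟨Matrix.of fun a b => if a = !b then 1 else 0, by
    rw [Matrix.mem_unitaryGroup_iff']
    ext a b
    cases a <;> cases b <;> simp [Matrix.mul_apply]⟩

/-- The rotation with `|0⟩ ↦ α|0⟩ + β|1⟩`. -/
def rotGate (α β : ℝ) (h : α ^ 2 + β ^ 2 = 1) : Matrix.unitaryGroup Bool ℂ :=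
  ⟨Matrix.of fun a b => if a = b then (α : ℂ) else if a then (β : ℂ) else -(β : ℂ), by
    have h' : (α : ℂ) ^ 2 + (β : ℂ) ^ 2 = 1 := by exact_mod_cast h
    rw [Matrix.mem_unitaryGroup_iff']
    ext a b
    cases a <;> cases b <;> simp [Matrix.mul_apply] <;>
      first | linear_combination h' | ring⟩

/-- A controlled `NOT` keeps basis vectors basis vectors, so classical reversible steps can be
followed on kets alone. -/
theorem sum_condGate_not (P : Prop) [Decidable P] (x : W → Bool) (p : W) :
    ∑ b, condGate P notGate b (x p) • ket (Function.update x p b) =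
      ket (Function.update x p (xor (x p) (decide P))) := by
  by_cases hP : P <;> cases hx : x p <;> simp [condGate, hP, notGate, Matrix.one_apply]

end Kets

/-! ### Predicates decided by small circuits -/

section Decides

variable {W : Type} [Fintype W] [DecidableEq W]

/-- The assignment in which all wires are `0`. -/
abbrev zeros (A : Type) : A → Bool := fun _ => false

/-- The predicate `P` of the wires `W` is computed by at most `s` gates and ancillas (which are
left in some basis state) without using the wire `p`. -/
def Decides (p : W) (s : ℕ) (P : (W → Bool) → Prop) : Prop :=
  ∃ (A : Type) (_ : Fintype A) (_ : DecidableEq A) (l : List (QGate (W ⊕ A))) (r : A)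
    (a : (W → Bool) → A → Bool), Fintype.card A + l.length ≤ s ∧
      (∀ x, gatesMatrix l *ᵥ ket (Sum.elim x (zeros A)) = ket (Sum.elim x (a x))) ∧
      (∀ x, a x r = true ↔ P x) ∧ ∀ x b, a (Function.update x p b) = a x

theorem Decides.mono {p : W} {s s' : ℕ} {P : (W → Bool) → Prop} (h : Decides p s P)
    (hs : s ≤ s') : Decides p s' P := by
  obtain ⟨A, i1, i2, l, r, a, h1, h2⟩ := h
  exact ⟨A, i1, i2, l, r, a, h1.trans hs, h2⟩

theorem Decides.congr {p : W} {s : ℕ} {P Q : (W → Bool) → Prop} (h : Decides p s P)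
    (hPQ : ∀ x, P x ↔ Q x) : Decides p s Q := by
  have : P = Q := funext fun x => propext (hPQ x)
  rwa [← this]

/-- The bit is copied because the answer has to sit in an ancilla: the cost is one ancilla and one
gate. -/
theorem decides_wire {p w : W} (hw : w ≠ p) : Decides p 2 fun x => x w = true := by
  classical
  let ι : Fin 2 ↪ W ⊕ Unit := ⟨![Sum.inr (), Sum.inl w], by
    intro i j; fin_cases i <;> fin_cases j <;> simp⟩
  refine ⟨Unit, inferInstance, inferInstance,
    [controlledGate 1 (by omega) ι (fun c => c 0 = true) notGate], (),
    fun x _ => x w, by simp, fun x => ?_, fun x => Iff.rfl, fun x b => ?_⟩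
  · rw [gatesMatrix_singleton, controlledGate_ket, sum_condGate_not]
    have h0 : ι 0 = Sum.inr () := rfl
    have h1 : ι 1 = Sum.inl w := rfl
    congr 1
    funext v
    rcases v with v | v <;> simp [h0, h1]
  · funext _
    exact Function.update_of_ne hw _ _

theorem decides_const (p : W) (P : Prop) : Decides p 2 fun _ => P := by
  classical
  let ι : Fin 1 ↪ W ⊕ Unit := ⟨![Sum.inr ()], by
    intro i j; fin_cases i; fin_cases j; simp⟩
  refine ⟨Unit, inferInstance, inferInstance,
    [controlledGate 0 (by omega) ι (fun _ => P) notGate], (),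
    fun x _ => decide P, by simp, fun x => ?_, fun x => by simp, fun x b => rfl⟩
  rw [gatesMatrix_singleton, controlledGate_ket, sum_condGate_not]
  have h0 : ι 0 = Sum.inr () := rfl
  congr 1
  funext v
  rcases v with v | v <;> simp [h0]

/-- The two computations run on disjoint ancillas, and one three-wire gate writes the value of `g`
to a fresh ancilla; this gate and this ancilla are the `+ 2`. The intermediate results may remain as
garbage. -/
theorem Decides.binary {p : W} {s₁ s₂ : ℕ} {P₁ P₂ : (W → Bool) → Prop} (g : Prop → Prop → Prop)
    (h₁ : Decides p s₁ P₁) (h₂ : Decides p s₂ P₂) :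
    Decides p (s₁ + s₂ + 2) fun x => g (P₁ x) (P₂ x) := by
  classical
  obtain ⟨A₁, _, _, l₁, r₁, a₁, hs₁, hk₁, hr₁, hp₁⟩ := h₁
  obtain ⟨A₂, _, _, l₂, r₂, a₂, hs₂, hk₂, hr₂, hp₂⟩ := h₂
  let ι₁ : W ⊕ A₁ ↪ W ⊕ ((A₁ ⊕ A₂) ⊕ Unit) :=
    ⟨Sum.elim Sum.inl fun a => Sum.inr (Sum.inl (Sum.inl a)), by
      rintro (x | x) (y | y) <;> simp⟩
  let ι₂ : W ⊕ A₂ ↪ W ⊕ ((A₁ ⊕ A₂) ⊕ Unit) :=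
    ⟨Sum.elim Sum.inl fun a => Sum.inr (Sum.inl (Sum.inr a)), by
      rintro (x | x) (y | y) <;> simp⟩
  let ι : Fin 3 ↪ W ⊕ ((A₁ ⊕ A₂) ⊕ Unit) :=
    ⟨![Sum.inr (Sum.inr ()), Sum.inr (Sum.inl (Sum.inl r₁)), Sum.inr (Sum.inl (Sum.inr r₂))], by
      intro i j; fin_cases i <;> fin_cases j <;> simp⟩
  refine ⟨(A₁ ⊕ A₂) ⊕ Unit, inferInstance, inferInstance,
    l₁.map (QGate.map ι₁) ++ (l₂.map (QGate.map ι₂) ++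
      [controlledGate 2 le_rfl ι (fun c => g (c 0 = true) (c 1 = true)) notGate]), Sum.inr (),
    fun x => Sum.elim (Sum.elim (a₁ x) (a₂ x)) fun _ => decide (g (P₁ x) (P₂ x)),
    ?_, fun x => ?_, fun x => by simp, fun x b => ?_⟩
  · simp
    omega
  · rw [gatesMatrix_append, gatesMatrix_append, ← Matrix.mulVec_mulVec, ← Matrix.mulVec_mulVec,
      gatesMatrix_map, gatesMatrix_map, gatesMatrix_singleton]
    rw [onWires_ket_of_ket ι₁ _ _ (Sum.elim x (a₁ x))]
    · rw [onWires_ket_of_ket ι₂ _ _ (Sum.elim x (a₂ x))]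
      · have : Function.extend ι₂ (Sum.elim x (a₂ x)) (Function.extend ι₁ (Sum.elim x (a₁ x))
            (Sum.elim x (zeros _))) =
              Sum.elim x (Sum.elim (Sum.elim (a₁ x) (a₂ x)) (zeros Unit)) := by
          rw [extend_eq_iff]
          constructor
          · intro w hw
            rcases w with w | (w | w) | w
            · exact absurd ⟨Sum.inl w, rfl⟩ hw
            · exact extend_apply_emb ι₁ _ _ (Sum.inr w)
            · exact absurd ⟨Sum.inr w, rfl⟩ hw
            · rw [extend_apply_off]
              · rfl
              · rintro ⟨v | v, hv⟩ <;> cases hv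
          · funext i
            rcases i with i | i <;> rfl
        rw [this, controlledGate_ket, sum_condGate_not]
        have h0 : ι 0 = Sum.inr (Sum.inr ()) := rfl
        have h1 : ι 1 = Sum.inr (Sum.inl (Sum.inl r₁)) := rfl
        have h2 : ι 2 = Sum.inr (Sum.inl (Sum.inr r₂)) := rfl
        congr 1
        funext v
        rcases v with v | (v | v) | v <;> simp [h0, h1, h2, hr₁, hr₂]
      · rw [← hk₂ x]
        congr 2
        funext i
        rcases i with i | i
        · exact extend_apply_emb ι₁ _ _ (Sum.inl i)
        · rw [extend_apply_off]
          · rfl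
          · rintro ⟨v | v, hv⟩ <;> cases hv
    · rw [← hk₁ x]
      congr 2
      funext i
      rcases i with i | i <;> rfl
  · have hx : ∀ x, P₁ x ↔ a₁ x r₁ = true := fun x => (hr₁ x).symm
    have hx' : ∀ x, P₂ x ↔ a₂ x r₂ = true := fun x => (hr₂ x).symm
    simp only [hx, hx', hp₁, hp₂]

theorem Decides.and {p : W} {s₁ s₂ : ℕ} {P₁ P₂ : (W → Bool) → Prop}
    (h₁ : Decides p s₁ P₁) (h₂ : Decides p s₂ P₂) :
    Decides p (s₁ + s₂ + 2) fun x => P₁ x ∧ P₂ x := h₁.binary And h₂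

theorem Decides.or {p : W} {s₁ s₂ : ℕ} {P₁ P₂ : (W → Bool) → Prop}
    (h₁ : Decides p s₁ P₁) (h₂ : Decides p s₂ P₂) :
    Decides p (s₁ + s₂ + 2) fun x => P₁ x ∨ P₂ x := h₁.binary Or h₂

theorem Decides.not {p : W} {s : ℕ} {P : (W → Bool) → Prop} (h : Decides p s P) :
    Decides p (s + 4) fun x => ¬ P x :=
  -- The constant is a dummy second argument; it accounts for two of the four extra units.
  h.binary (fun a _ => ¬ a) (decides_const p True)

theorem Decides.forall_fin {p : W} {s : ℕ} (k : ℕ) {P : Fin k → (W → Bool) → Prop}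
    (h : ∀ i, Decides p s (P i)) : Decides p (k * (s + 2) + 2) fun x => ∀ i, P i x := by
  induction k with
  | zero => exact ((decides_const p True).congr fun x => by simp).mono (by omega)
  | succ k ih =>
    refine (((h 0).and (ih fun i => h i.succ)).congr fun x => ?_).mono (by ring_nf; omega)
    exact (Fin.forall_fin_succ (P := fun i => P i x)).symm

theorem Decides.exists_fin {p : W} {s : ℕ} (k : ℕ) {P : Fin k → (W → Bool) → Prop}
    (h : ∀ i, Decides p s (P i)) : Decides p (k * (s + 2) + 2) fun x => ∃ i, P i x := by
  induction k with
  | zero => exact ((decides_const p False).congr fun x => by simp).mono (by omega)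
  | succ k ih =>
    refine (((h 0).or (ih fun i => h i.succ)).congr fun x => ?_).mono (by ring_nf; omega)
    exact (Fin.exists_fin_succ (P := fun i => P i x)).symm

end Decides

/-! ### Operators implemented with clean ancillas -/

section Clean

variable {V W : Type} [Fintype V] [DecidableEq V] [Fintype W] [DecidableEq W]

/-- The isometry that adds ancillas `A` in the state `|0⟩`. -/
def addZeros (W A : Type) [Fintype W] [DecidableEq W] [Fintype A] [DecidableEq A] :
    Matrix (W ⊕ A → Bool) (W → Bool) ℂ :=
  Matrix.of fun y x => if y = Sum.elim x (zeros A) then 1 else 0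

theorem addZeros_ket (A : Type) [Fintype A] [DecidableEq A] (x : W → Bool) :
    addZeros W A *ᵥ ket x = ket (Sum.elim x (zeros A)) := by
  funext y
  rw [mulVec_ket, ket_apply, addZeros, Matrix.of_apply]

theorem addZeros_mulVec (A : Type) [Fintype A] [DecidableEq A] (ψ : (W → Bool) → ℂ)
    (y : W ⊕ A → Bool) :
    (addZeros W A *ᵥ ψ) y =
      ψ (fun w => y (Sum.inl w)) * ket (zeros A) (fun a => y (Sum.inr a)) := by
  have h : ∀ x, y = Sum.elim x (zeros A) ↔
      (fun a => y (Sum.inr a)) = zeros A ∧ x = fun w => y (Sum.inl w) := by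
    intro x
    constructor
    · rintro rfl
      exact ⟨rfl, rfl⟩
    · rintro ⟨h1, rfl⟩
      funext w
      rcases w with w | w
      · rfl
      · exact congrFun h1 w
  simp only [addZeros, Matrix.mulVec, dotProduct, Matrix.of_apply, h, ket_apply]
  by_cases h1 : (fun a => y (Sum.inr a)) = zeros A <;> simp [h1]

/-- The operator `M` is implemented by at most `s` gates and ancillas, the ancillas starting and
ending in the state `|0⟩`. -/
def Clean (s : ℕ) (M : Matrix (W → Bool) (W → Bool) ℂ) : Prop :=
  ∃ (A : Type) (_ : Fintype A) (_ : DecidableEq A) (l : List (QGate (W ⊕ A))),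
    Fintype.card A + l.length ≤ s ∧
      ∀ x, gatesMatrix l *ᵥ ket (Sum.elim x (zeros A)) = addZeros W A *ᵥ (M *ᵥ ket x)

theorem Clean.mono {s s' : ℕ} {M : Matrix (W → Bool) (W → Bool) ℂ} (h : Clean s M)
    (hs : s ≤ s') : Clean s' M := by
  obtain ⟨A, i1, i2, l, h1, h2⟩ := h
  exact ⟨A, i1, i2, l, h1.trans hs, h2⟩

theorem clean_one : Clean 0 (1 : Matrix (W → Bool) (W → Bool) ℂ) :=
  ⟨Empty, inferInstance, inferInstance, [], by simp, fun x => by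
    rw [Matrix.one_mulVec, addZeros_ket, gatesMatrix_nil, Matrix.one_mulVec]⟩

theorem Clean.onWires {s : ℕ} {M : Matrix (V → Bool) (V → Bool) ℂ} (h : Clean s M) (ι : V ↪ W) :
    Clean s (onWires ι M) := by
  obtain ⟨A, _, _, l, hs, hl⟩ := h
  let κ : V ⊕ A ↪ W ⊕ A := ι.sumMap (Function.Embedding.refl A)
  refine ⟨A, inferInstance, inferInstance, l.map (QGate.map κ), by simpa using hs, fun x => ?_⟩
  rw [gatesMatrix_map]
  have hx : (fun i => Sum.elim x (zeros A) (κ i)) = Sum.elim (fun i => x (ι i)) (zeros A) := by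
    funext i
    rcases i with i | i <;> rfl
  have h1 := onWires_ket_of_sum κ (gatesMatrix l) (Sum.elim x (zeros A)) Finset.univ
    (M *ᵥ ket fun i => x (ι i)) (fun z => Sum.elim z (zeros A)) (by
      rw [hx, hl, vec_eq_sum_ket (M *ᵥ ket fun i => x (ι i)), mulVec_sum_smul]
      rw [← vec_eq_sum_ket]
      simp only [addZeros_ket])
  rw [h1, onWires_ket, mulVec_sum_smul]
  refine Finset.sum_congr rfl fun z _ => ?_
  rw [addZeros_ket]
  congr 2
  rw [extend_eq_iff]
  constructor
  · intro w hw
    rcases w with w | w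
    · refine (extend_apply_off ι z x ?_).symm
      rintro ⟨v, rfl⟩
      exact hw ⟨Sum.inl v, rfl⟩
    · exact absurd ⟨Sum.inr w, rfl⟩ hw
  · funext i
    rcases i with i | i
    · exact (extend_apply_emb ι _ _ i).symm
    · rfl

theorem clean_gate (g : QGate W) : Clean 1 g.toMatrix := by
  refine ⟨Empty, inferInstance, inferInstance,
    [g.map ⟨Sum.inl, Sum.inl_injective⟩], by simp, fun x => ?_⟩
  have h := gatesMatrix_map (⟨Sum.inl, Sum.inl_injective⟩ : W ↪ W ⊕ Empty) [g]
  rw [List.map_singleton] at h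
  rw [h, gatesMatrix_singleton,
    onWires_ket_of_sum _ _ _ Finset.univ (g.toMatrix *ᵥ ket x) (fun z => z)
      (by simpa using vec_eq_sum_ket (g.toMatrix *ᵥ ket x))]
  conv_rhs => rw [vec_eq_sum_ket (g.toMatrix *ᵥ ket x), mulVec_sum_smul]
  refine Finset.sum_congr rfl fun z _ => ?_
  rw [addZeros_ket]
  congr 2
  rw [extend_eq_iff]
  exact ⟨fun w hw => by rcases w with w | w; exacts [absurd ⟨w, rfl⟩ hw, w.elim], rfl⟩

theorem Clean.mul {s₁ s₂ : ℕ} {M₁ M₂ : Matrix (W → Bool) (W → Bool) ℂ} (h₂ : Clean s₂ M₂)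
    (h₁ : Clean s₁ M₁) : Clean (s₁ + s₂) (M₂ * M₁) := by
  obtain ⟨A₁, _, _, l₁, hs₁, hl₁⟩ := h₁
  obtain ⟨A₂, _, _, l₂, hs₂, hl₂⟩ := h₂
  let ι₁ : W ⊕ A₁ ↪ W ⊕ (A₁ ⊕ A₂) :=
    (Function.Embedding.refl W).sumMap Function.Embedding.inl
  let ι₂ : W ⊕ A₂ ↪ W ⊕ (A₁ ⊕ A₂) :=
    (Function.Embedding.refl W).sumMap Function.Embedding.inr
  have h1 : ∀ x, gatesMatrix (l₁.map (QGate.map ι₁)) *ᵥ ket (Sum.elim x (zeros _)) =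
      addZeros W (A₁ ⊕ A₂) *ᵥ (M₁ *ᵥ ket x) := fun x => by
    rw [gatesMatrix_map, onWires_ket_of_sum ι₁ _ _ Finset.univ (M₁ *ᵥ ket x)
      fun z => Sum.elim z (zeros A₁)]
    · conv_rhs => rw [vec_eq_sum_ket (M₁ *ᵥ ket x), mulVec_sum_smul]
      refine Finset.sum_congr rfl fun z _ => ?_
      rw [addZeros_ket]
      congr 2
      rw [extend_eq_iff]
      refine ⟨fun w hw => ?_, funext fun i => by rcases i with i | i <;> rfl⟩
      rcases w with w | w
      · exact absurd ⟨Sum.inl w, rfl⟩ hw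
      · rfl
    · have : (fun i => Sum.elim x (zeros (A₁ ⊕ A₂)) (ι₁ i)) = Sum.elim x (zeros A₁) := by
        funext i
        rcases i with i | i <;> rfl
      rw [this, hl₁, vec_eq_sum_ket (M₁ *ᵥ ket x), mulVec_sum_smul, ← vec_eq_sum_ket]
      simp only [addZeros_ket]
  have h2 : ∀ x, gatesMatrix (l₂.map (QGate.map ι₂)) *ᵥ ket (Sum.elim x (zeros _)) =
      addZeros W (A₁ ⊕ A₂) *ᵥ (M₂ *ᵥ ket x) := fun x => by
    rw [gatesMatrix_map, onWires_ket_of_sum ι₂ _ _ Finset.univ (M₂ *ᵥ ket x)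
      fun z => Sum.elim z (zeros A₂)]
    · conv_rhs => rw [vec_eq_sum_ket (M₂ *ᵥ ket x), mulVec_sum_smul]
      refine Finset.sum_congr rfl fun z _ => ?_
      rw [addZeros_ket]
      congr 2
      rw [extend_eq_iff]
      refine ⟨fun w hw => ?_, funext fun i => by rcases i with i | i <;> rfl⟩
      rcases w with w | w
      · exact absurd ⟨Sum.inl w, rfl⟩ hw
      · rfl
    · have : (fun i => Sum.elim x (zeros (A₁ ⊕ A₂)) (ι₂ i)) = Sum.elim x (zeros A₂) := by
        funext i
        rcases i with i | i <;> rfl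
      rw [this, hl₂, vec_eq_sum_ket (M₂ *ᵥ ket x), mulVec_sum_smul, ← vec_eq_sum_ket]
      simp only [addZeros_ket]
  refine ⟨A₁ ⊕ A₂, inferInstance, inferInstance,
    l₁.map (QGate.map ι₁) ++ l₂.map (QGate.map ι₂), ?_, fun x => ?_⟩
  · simp
    omega
  · rw [gatesMatrix_append, ← Matrix.mulVec_mulVec, h1, ← Matrix.mulVec_mulVec _ M₂,
      vec_eq_sum_ket (M₁ *ᵥ ket x)]
    simp only [mulVec_sum_smul, addZeros_ket, h2]

theorem Clean.list_prod {s : ℕ} (L : List (Matrix (W → Bool) (W → Bool) ℂ))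
    (h : ∀ M ∈ L, Clean s M) : Clean (L.length * s) L.prod := by
  induction L with
  | nil => simpa using clean_one
  | cons M L ih =>
    rw [List.prod_cons]
    refine ((h M (by simp)).mul (ih fun N hN => h N (by simp [hN]))).mono ?_
    rw [List.length_cons, add_mul, one_mul]

open Classical in
/-- The one-qubit gate `R` on the wire `p`, controlled on the predicate `P`. -/
def controlledOn (p : W) (P : (W → Bool) → Prop) (R : Matrix.unitaryGroup Bool ℂ) :
    Matrix (W → Bool) (W → Bool) ℂ :=
  Matrix.of fun y x => ∑ b, condGate (P x) R b (x p) * ket (Function.update x p b) y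

open Classical in
theorem controlledOn_ket (p : W) (P : (W → Bool) → Prop) (R : Matrix.unitaryGroup Bool ℂ)
    (x : W → Bool) : controlledOn p P R *ᵥ ket x =
      ∑ b, condGate (P x) R b (x p) • ket (Function.update x p b) := by
  funext y
  rw [mulVec_ket, controlledOn, Matrix.of_apply, Finset.sum_apply]
  rfl

/-- Compute, use, uncompute. The rotation changes only `p`, which the predicate computation does not
read, so the inverse gates still restore the ancillas: two runs and one gate. -/
theorem Decides.clean {p : W} {s : ℕ} {P : (W → Bool) → Prop} (h : Decides p s P)
    (R : Matrix.unitaryGroup Bool ℂ) : Clean (2 * s + 1) (controlledOn p P R) := by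
  classical
  obtain ⟨A, _, _, l, r, a, hs, hk, hr, hp⟩ := h
  let ι : Fin 2 ↪ W ⊕ A := ⟨![Sum.inl p, Sum.inr r], by
    intro i j; fin_cases i <;> fin_cases j <;> simp⟩
  refine ⟨A, inferInstance, inferInstance,
    l ++ (controlledGate 1 (by omega) ι (fun c => c 0 = true) R :: inverseGates l), ?_,
    fun x => ?_⟩
  · simp
    omega
  · rw [gatesMatrix_append, gatesMatrix_cons, ← Matrix.mulVec_mulVec, ← Matrix.mulVec_mulVec,
      hk, controlledGate_ket, mulVec_sum_smul, controlledOn_ket, mulVec_sum_smul]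
    refine Finset.sum_congr rfl fun b _ => ?_
    rw [addZeros_ket]
    have h0 : ι 0 = Sum.inl p := rfl
    have h2 : ι 1 = Sum.inr r := rfl
    have h1 : Function.update (Sum.elim x (a x)) (ι 0) b =
        Sum.elim (Function.update x p b) (a (Function.update x p b)) := by
      rw [hp]
      funext v
      rcases v with v | v <;> simp [h0, Function.update_apply]
    rw [h1, gatesMatrix_inverse_mulVec l (hk _)]
    simp only [Fin.succ_zero_eq_one, h0, h2, Sum.elim_inl, Sum.elim_inr, hr]

end Clean

/-! ### Types of tuples -/

section Types

variable {I : Type}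

theorem typeOf_insertNth {t : ℕ} (l : Fin (t + 1)) (x : I) (w : Fin t → I) :
    typeOf (Fin.insertNth (α := fun _ => I) l x w) = x ::ₛ typeOf w := by
  refine Subtype.ext ?_
  change Multiset.map _ (Finset.univ : Finset (Fin (t + 1))).val =
    x ::ₘ Multiset.map w (Finset.univ : Finset (Fin t)).val
  rw [Fin.univ_succAbove t l, Finset.cons_val, Multiset.map_cons, Fin.insertNth_apply_same,
    Finset.map_val, Multiset.map_map]
  congr 1
  refine Multiset.map_congr rfl fun i _ => ?_
  simp

theorem typeOf_eq_cons {t : ℕ} (v : Fin (t + 1) → I) (k : Fin (t + 1)) :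
    typeOf v = v k ::ₛ typeOf fun i => v (k.succAbove i) := by
  rw [← typeOf_insertNth k]
  congr 1
  exact (Fin.insertNth_self_removeNth k v).symm

theorem typeOf_snoc {t : ℕ} (w : Fin t → I) (x : I) :
    typeOf (Fin.snoc (α := fun _ => I) w x) = x ::ₛ typeOf w := by
  rw [← Fin.insertNth_last', typeOf_insertNth]

variable [DecidableEq I]

theorem count_typeOf {t : ℕ} (v : Fin t → I) (x : I) :
    ((typeOf v : Sym I t) : Multiset I).count x = (Finset.univ.filter fun l => v l = x).card := by
  change Multiset.count x (Multiset.map v Finset.univ.val) = _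
  rw [Multiset.count_map]
  simp only [eq_comm (a := x)]
  rfl

theorem card_filter_eq_of_typeOf_eq {t : ℕ} {v w : Fin t → I} (h : typeOf w = typeOf v) (x : I) :
    (Finset.univ.filter fun l => w l = x).card = (Finset.univ.filter fun l => v l = x).card := by
  rw [← count_typeOf, h, count_typeOf]

variable [Fintype I]

/-- The number of tuples of a given type. -/
def typeCard {t : ℕ} (T : Sym I t) : ℕ := (Finset.univ.filter fun w : Fin t → I => typeOf w = T).card

theorem typeCard_pos {t : ℕ} (v : Fin t → I) : 0 < typeCard (typeOf v) :=
  Finset.card_pos.2 ⟨v, by simp⟩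

/-- Double counting of the pairs of a tuple and a position of a given entry. -/
theorem mul_typeCard {t : ℕ} (v : Fin (t + 1) → I) (k : Fin (t + 1)) :
    (Finset.univ.filter fun l => v l = v k).card * typeCard (typeOf v) =
      (t + 1) * typeCard (typeOf fun i => v (k.succAbove i)) := by
  -- For a fixed position, deleting the entry there is a bijection onto the tuples of the smaller
  -- type.
  have h1 : ∀ l : Fin (t + 1),
      (Finset.univ.filter fun w : Fin (t + 1) → I => typeOf w = typeOf v ∧ w l = v k).card =
        typeCard (typeOf fun i => v (k.succAbove i)) := fun l => by
    symm
    refine Finset.card_bij (fun w _ => Fin.insertNth (α := fun _ => I) l (v k) w) ?_ ?_ ?_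
    · intro w hw
      rw [Finset.mem_filter] at hw ⊢
      refine ⟨Finset.mem_univ _, ?_, by simp⟩
      rw [typeOf_insertNth, hw.2, ← typeOf_eq_cons]
    · intro w _ w' _ h
      exact (Fin.insertNth_injective2 h).2
    · intro w hw
      rw [Finset.mem_filter] at hw
      refine ⟨fun i => w (l.succAbove i), ?_, ?_⟩
      · rw [Finset.mem_filter]
        refine ⟨Finset.mem_univ _, ?_⟩
        have := hw.2.1
        rwa [typeOf_eq_cons w l, typeOf_eq_cons v k, hw.2.2, Sym.cons_inj_right] at this
      · rw [← hw.2.2]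
        exact Fin.insertNth_self_removeNth l w
  have h2 : ∑ l : Fin (t + 1), (Finset.univ.filter fun w : Fin (t + 1) → I =>
      typeOf w = typeOf v ∧ w l = v k).card =
        ∑ w ∈ Finset.univ.filter (fun w : Fin (t + 1) → I => typeOf w = typeOf v),
          (Finset.univ.filter fun l => w l = v k).card := by
    simp only [Finset.card_eq_sum_ones, Finset.sum_filter]
    rw [Finset.sum_comm]
    refine Finset.sum_congr rfl fun w _ => ?_
    by_cases h : typeOf w = typeOf v <;> simp [h]
  simp only [h1, Finset.sum_const, Finset.card_univ, Fintype.card_fin, smul_eq_mul] at h2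
  rw [h2, Finset.sum_congr rfl fun w hw =>
    card_filter_eq_of_typeOf_eq (Finset.mem_filter.1 hw).2 (v k), Finset.sum_const, smul_eq_mul,
    mul_comm]
  rfl

theorem schurSym_apply {t : ℕ} (v : Fin t → I) (T : Sym I t) :
    schurSym I t v T = if typeOf v = T then ((1 / Real.sqrt (typeCard T : ℝ) : ℝ) : ℂ) else 0 := rfl

end Types

/-! ### Blocks of equal entries of a sorted tuple -/

section Blocks

variable {α : Type} [LinearOrder α] {t : ℕ}

/-- The number of entries that are at most the entry number `k`. -/
def rankOf (u : Fin (t + 1) → α) (k : Fin (t + 1)) : ℕ :=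
  (Finset.univ.filter fun l => u l ≤ u k).card

/-- The position `k` is the first of its block of equal entries. -/
def IsBlockStart {α : Type} (u : Fin (t + 1) → α) (k : Fin (t + 1)) : Prop :=
  ∀ i : Fin t, i.succ = k → u i.castSucc ≠ u k

/-- The position `l` is the last of the block of the position `k`. -/
def IsBlockEnd {α : Type} (u : Fin (t + 1) → α) (k l : Fin (t + 1)) : Prop :=
  u l = u k ∧ ∀ j : Fin t, j.castSucc = l → u j.succ ≠ u k

variable {u : Fin (t + 1) → α} (hu : Monotone u)
include hu

/-- In a sorted tuple, the positions whose entries are at most `u k` form the initial segment that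
ends with the block of `k`. -/
theorem IsBlockEnd.rankOf_eq {k l : Fin (t + 1)} (h : IsBlockEnd u k l) :
    rankOf u k = l + 1 := by
  have : (Finset.univ.filter fun j => u j ≤ u k) = Finset.Iic l := by
    ext j
    simp only [Finset.mem_filter, Finset.mem_univ, true_and, Finset.mem_Iic]
    constructor
    · intro hj
      by_contra hlj
      rw [not_le] at hlj
      have hl : (l : ℕ) < t := by have := j.isLt; have : (l : ℕ) < j := hlj; omega
      have h1 := h.2 ⟨l, hl⟩ rfl
      have h2 : u l ≤ u (Fin.succ ⟨l, hl⟩) := hu (by simp [Fin.le_def])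
      have h3 : u (Fin.succ ⟨l, hl⟩) ≤ u j := hu (by
        have : (l : ℕ) < j := hlj
        simp [Fin.le_def]; omega)
      rw [h.1] at h2
      exact h1 (le_antisymm (h3.trans hj) h2)
    · intro hj
      rw [← h.1]
      exact hu hj
  rw [rankOf, this, Fin.card_Iic]

omit hu in
theorem exists_isBlockEnd (k : Fin (t + 1)) : ∃ l, k ≤ l ∧ IsBlockEnd u k l := by
  classical
  let s := Finset.univ.filter fun l => u l = u k
  have hs : s.Nonempty := ⟨k, by simp [s]⟩
  have hl := Finset.max'_mem s hs
  refine ⟨s.max' hs, Finset.le_max' s k (by simp [s]), (Finset.mem_filter.1 hl).2, ?_⟩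
  intro j hj h
  have : j.succ ≤ s.max' hs := Finset.le_max' s _ (by simp [s, h])
  rw [← hj] at this
  simp [Fin.le_def] at this

theorem isBlockEnd_iff {k l l' : Fin (t + 1)} (h : IsBlockEnd u k l) :
    IsBlockEnd u k l' ↔ l' = l := by
  constructor
  · intro h'
    have := h.rankOf_eq hu
    rw [h'.rankOf_eq hu] at this
    exact Fin.ext (by omega)
  · rintro rfl
    exact h

theorem rankOf_castSucc_of_ne (i : Fin t) (h : u i.castSucc ≠ u i.succ) :
    rankOf u i.castSucc = i + 1 := by
  have : IsBlockEnd u i.castSucc i.castSucc :=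
    ⟨rfl, fun j hj => by
      rw [Fin.castSucc_inj] at hj
      subst hj
      exact h.symm⟩
  simpa using this.rankOf_eq hu

theorem rankOf_last : rankOf u (Fin.last t) = t + 1 := by
  have : IsBlockEnd u (Fin.last t) (Fin.last t) :=
    ⟨rfl, fun j hj => absurd hj (Fin.castSucc_lt_last j).ne⟩
  simpa using this.rankOf_eq hu

/-- The predecessor of a block start is strictly smaller, and everything before it is at most that.
This equivalence later allows the position to be recovered from the entries. -/
theorem IsBlockStart.lt_iff {k j : Fin (t + 1)} (h : IsBlockStart u k) : u j < u k ↔ j < k := by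
  constructor
  · intro hj
    by_contra hkj
    exact absurd (hu (not_lt.1 hkj)) (not_le.2 hj)
  · intro hj
    have hk : (k : ℕ) - 1 < t := by
      have h1 := k.isLt
      have h2 : (j : ℕ) < k := hj
      omega
    have hk' : Fin.succ ⟨(k : ℕ) - 1, hk⟩ = k := by
      have h2 : (j : ℕ) < k := hj
      exact Fin.ext (by simp; omega)
    have h1 := h _ hk'
    have h2 : u (Fin.castSucc ⟨(k : ℕ) - 1, hk⟩) ≤ u k := hu (by simp [Fin.le_def])
    have h3 : u j ≤ u (Fin.castSucc ⟨(k : ℕ) - 1, hk⟩) := hu (by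
      have h2 : (j : ℕ) < k := hj
      simp [Fin.le_def]; omega)
    exact h3.trans_lt (lt_of_le_of_ne h2 h1)

/-- Exactly `k` entries are strictly smaller, so rank minus position is the multiplicity at a block
start. -/
theorem IsBlockStart.rankOf_eq {k : Fin (t + 1)} [DecidablePred fun l => u l = u k]
    (h : IsBlockStart u k) :
    rankOf u k = k + (Finset.univ.filter fun l => u l = u k).card := by
  have h1 : (Finset.univ.filter fun l => u l ≤ u k) =
      Finset.Iio k ∪ Finset.univ.filter fun l => u l = u k := by
    ext j
    simp only [Finset.mem_filter, Finset.mem_univ, true_and, Finset.mem_union, Finset.mem_Iio,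
      le_iff_lt_or_eq, h.lt_iff hu]
  rw [rankOf, h1, Finset.card_union_of_disjoint, Fin.card_Iio]
  rw [Finset.disjoint_left]
  intro j hj hj'
  rw [Finset.mem_Iio, ← h.lt_iff hu] at hj
  exact hj.ne (Finset.mem_filter.1 hj').2

/-- Block starts represent the distinct values, once each; sums over block starts are thus sums over
values. -/
theorem exists_isBlockStart (k : Fin (t + 1)) :
    ∃ k₀, IsBlockStart u k₀ ∧ u k₀ = u k ∧ ∀ k', IsBlockStart u k' → u k' = u k → k' = k₀ := by
  classical
  let s := Finset.univ.filter fun l => u l = u k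
  have hs : s.Nonempty := ⟨k, by simp [s]⟩
  have hl := (Finset.mem_filter.1 (Finset.min'_mem s hs)).2
  have hst : IsBlockStart u (s.min' hs) := by
    intro j hj h
    have : s.min' hs ≤ j.castSucc := Finset.min'_le s _ (by simp [s, h, hl])
    rw [← hj] at this
    simp [Fin.le_def] at this
  refine ⟨s.min' hs, hst, hl, fun k' hk' h => ?_⟩
  refine le_antisymm (not_lt.1 fun hlt => ?_) (not_lt.1 fun hlt => ?_)
  · rw [← hk'.lt_iff hu, hl, h] at hlt
    exact hlt.false
  · rw [← hst.lt_iff hu, hl, h] at hlt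
    exact hlt.false

end Blocks

/-! ### Moving one entry to the end of a tuple -/

section MoveToEnd

variable {I : Type} {t : ℕ}

/-- The tuple `v` with its entry number `k` moved to the last position. -/
def moveToEnd (k : Fin (t + 1)) (v : Fin (t + 1) → I) : Fin (t + 1) → I :=
  Fin.snoc (α := fun _ => I) (fun i => v (k.succAbove i)) (v k)

theorem moveToEnd_castSucc (k : Fin (t + 1)) (v : Fin (t + 1) → I) (i : Fin t) :
    moveToEnd k v i.castSucc = v (k.succAbove i) := by simp [moveToEnd]

theorem moveToEnd_last (k : Fin (t + 1)) (v : Fin (t + 1) → I) :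
    moveToEnd k v (Fin.last t) = v k := by simp [moveToEnd]

theorem moveToEnd_eq_self (v : Fin (t + 1) → I) : moveToEnd (Fin.last t) v = v := by
  funext l
  refine Fin.lastCases ?_ (fun i => ?_) l
  · rw [moveToEnd_last]
  · rw [moveToEnd_castSucc, Fin.succAbove_last]

/-- With the entry `i + 1` already at the end, one swap puts it back at place `i` and takes out the
entry `i` instead. Successive swaps thus keep the remaining entries in their original order. -/
theorem moveToEnd_succ_swap (i : Fin t) (v : Fin (t + 1) → I) (l : Fin (t + 1)) :
    moveToEnd i.succ v (Equiv.swap i.castSucc (Fin.last t) l) = moveToEnd i.castSucc v l := by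
  refine Fin.lastCases ?_ (fun j => ?_) l
  · rw [Equiv.swap_apply_right, moveToEnd_castSucc, moveToEnd_last, Fin.succAbove_succ_self]
  · by_cases hj : j = i
    · subst hj
      rw [Equiv.swap_apply_left, moveToEnd_last, moveToEnd_castSucc, Fin.succAbove_castSucc_self]
    · have h1 : j.castSucc ≠ i.castSucc := fun h => hj (Fin.castSucc_injective t h)
      rw [Equiv.swap_apply_of_ne_of_ne h1 (Fin.castSucc_lt_last j).ne, moveToEnd_castSucc,
        moveToEnd_castSucc]
      congr 1
      rcases lt_or_gt_of_ne hj with h | h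
      · rw [Fin.succAbove_of_castSucc_lt _ _ (Fin.castSucc_lt_succ_iff.2 h.le),
          Fin.succAbove_of_castSucc_lt _ _ (by simpa using h)]
      · rw [Fin.succAbove_of_le_castSucc _ _ (Fin.succ_le_castSucc_iff.2 h),
          Fin.succAbove_of_le_castSucc _ _ (by simpa using h.le)]

end MoveToEnd

/-! ### Sequences of operators -/

section Chains

variable {W : Type} [Fintype W] [DecidableEq W]

/-- The last factor of a product acts first, so the intermediate states `Φ c` are traversed
downwards, from `Fin.last n` to `0`. Loops over wires are analysed through such a family of states.
-/
theorem prod_ofFn_mulVec {n : ℕ} (M : Fin n → Matrix (W → Bool) (W → Bool) ℂ)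
    (Φ : Fin (n + 1) → (W → Bool) → ℂ) (h : ∀ i, M i *ᵥ Φ i.succ = Φ i.castSucc) :
    (List.ofFn M).prod *ᵥ Φ (Fin.last n) = Φ 0 := by
  induction n with
  | zero => simp
  | succ n ih =>
    rw [List.ofFn_succ, List.prod_cons, ← Matrix.mulVec_mulVec]
    have := ih (fun i => M i.succ) (fun i => Φ i.succ) fun i => by
      rw [h i.succ, Fin.succ_castSucc]
    rw [Fin.succ_last] at this
    rw [this]
    exact h 0

theorem clean_prod_ofFn {n s : ℕ} (M : Fin n → Matrix (W → Bool) (W → Bool) ℂ)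
    (h : ∀ i, Clean s (M i)) : Clean (n * s) (List.ofFn M).prod := by
  have := Clean.list_prod (List.ofFn M) (s := s) fun N hN => by
    obtain ⟨i, rfl⟩ := (List.mem_ofFn' M N).1 hN
    exact h i
  rwa [List.length_ofFn] at this

theorem controlledOn_ket_of_not {p : W} {P : (W → Bool) → Prop} {R : Matrix.unitaryGroup Bool ℂ}
    {x : W → Bool} (h : ¬ P x) : controlledOn p P R *ᵥ ket x = ket x := by
  rw [controlledOn_ket]
  cases hx : x p <;> simp [condGate, h, Matrix.one_apply, ← hx]

theorem controlledOn_ket_of_pos {p : W} {P : (W → Bool) → Prop} {R : Matrix.unitaryGroup Bool ℂ}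
    {x : W → Bool} (h : P x) : controlledOn p P R *ᵥ ket x =
      ∑ b, (R : Matrix Bool Bool ℂ) b (x p) • ket (Function.update x p b) := by
  rw [controlledOn_ket]
  simp [condGate, h]

theorem prod_controlledOn_ket_of_not {p : W} {n : ℕ} (P : Fin n → (W → Bool) → Prop)
    (R : Fin n → Matrix.unitaryGroup Bool ℂ) {x : W → Bool} (h : ∀ l, ¬ P l x) :
    (List.ofFn fun l => controlledOn p (P l) (R l)).prod *ᵥ ket x = ket x := by
  have := prod_ofFn_mulVec (fun l => controlledOn p (P l) (R l)) (fun _ => ket x)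
    fun i => controlledOn_ket_of_not (h i)
  exact this

/-- When exactly one condition holds, a product of controlled gates is a case distinction. By `hP`
the conditions do not read the target, so the selection is still valid after the one rotation that
acts. -/
theorem prod_controlledOn_ket {p : W} {n : ℕ} (P : Fin n → (W → Bool) → Prop)
    (R : Fin n → Matrix.unitaryGroup Bool ℂ) {x : W → Bool}
    (hP : ∀ l b, P l (Function.update x p b) ↔ P l x) (l₀ : Fin n) (h : ∀ l, P l x ↔ l = l₀) :
    (List.ofFn fun l => controlledOn p (P l) (R l)).prod *ᵥ ket x =
      ∑ b, (R l₀ : Matrix Bool Bool ℂ) b (x p) • ket (Function.update x p b) := by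
  let ψ := ∑ b, (R l₀ : Matrix Bool Bool ℂ) b (x p) • ket (Function.update x p b)
  have := prod_ofFn_mulVec (fun l => controlledOn p (P l) (R l))
    (fun c => if l₀.castSucc < c then ket x else ψ) fun i => by
      rcases lt_trichotomy i l₀ with hi | rfl | hi
      · have h1 : ¬ l₀.castSucc < i.succ := by
          rw [Fin.castSucc_lt_succ_iff]; exact not_le.2 hi
        have h2 : ¬ l₀.castSucc < i.castSucc := not_lt.2 (Fin.castSucc_le_castSucc_iff.2 hi.le)
        simp only [if_neg h1, if_neg h2, ψ, mulVec_sum_smul]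
        refine Finset.sum_congr rfl fun b _ => ?_
        rw [controlledOn_ket_of_not]
        rw [hP, h]
        exact hi.ne
      · have h1 : i.castSucc < i.succ := Fin.castSucc_lt_succ
        simp only [if_pos h1, lt_irrefl, if_false, ψ]
        exact controlledOn_ket_of_pos ((h i).2 rfl)
      · have h1 : l₀.castSucc < i.succ := Fin.castSucc_lt_succ_iff.2 hi.le
        have h2 : l₀.castSucc < i.castSucc := Fin.castSucc_lt_castSucc_iff.2 hi
        simp only [if_pos h1, if_pos h2]
        refine controlledOn_ket_of_not ?_
        rw [h]
        exact hi.ne'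
  rw [if_pos (Fin.castSucc_lt_last l₀), if_neg (by simp)] at this
  exact this

theorem controlledOn_not_ket {p : W} {P : (W → Bool) → Prop} [DecidablePred P] {x : W → Bool} :
    controlledOn p P notGate *ᵥ ket x = ket (Function.update x p (xor (x p) (decide (P x)))) := by
  classical
  rw [controlledOn_ket, sum_condGate_not]
  congr

end Chains

/-! ### Controlled swaps -/

section Swaps

variable {W : Type} [Fintype W] [DecidableEq W]

/-- The swap by three exclusive-ors, each of them controlled on `p`. -/
theorem exists_clean_controlledSwap (p a b : W) (hpa : p ≠ a) (hpb : p ≠ b) (hab : a ≠ b) :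
    ∃ M : Matrix (W → Bool) (W → Bool) ℂ, Clean 3 M ∧
      ∀ x, M *ᵥ ket x = ket fun w => if x p then x (Equiv.swap a b w) else x w := by
  classical
  have key : ∀ c d : W, p ≠ c → p ≠ d → c ≠ d → ∃ M : Matrix (W → Bool) (W → Bool) ℂ, Clean 1 M ∧
      ∀ x, M *ᵥ ket x = ket (Function.update x d (xor (x d) (x p && x c))) := by
    intro c d hc hd hcd
    let ι : Fin 3 ↪ W := ⟨![d, p, c], by
      intro i j; fin_cases i <;> fin_cases j <;> simp [hc, hd, hcd, hc.symm, hd.symm, hcd.symm]⟩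
    refine ⟨_, clean_gate (controlledGate 2 le_rfl ι (fun z => z 0 = true ∧ z 1 = true) notGate),
      fun x => ?_⟩
    have h0 : ι 0 = d := rfl
    have h1 : ι 1 = p := rfl
    have h2 : ι 2 = c := rfl
    rw [controlledGate_ket, sum_condGate_not]
    simp [h0, h1, h2]
  obtain ⟨M₁, hc₁, hM₁⟩ := key b a hpb hpa hab.symm
  obtain ⟨M₂, hc₂, hM₂⟩ := key a b hpa hpb hab
  refine ⟨M₁ * (M₂ * M₁), (hc₁.mul (hc₂.mul hc₁)).mono (by omega), fun x => ?_⟩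
  rw [← Matrix.mulVec_mulVec, ← Matrix.mulVec_mulVec, hM₁, hM₂, hM₁]
  congr 1
  funext w
  by_cases ha : w = a
  · subst ha
    cases hp : x p <;> simp [hp, hpa, hpb, hab, hab.symm]
  · by_cases hb : w = b
    · subst hb
      cases hp : x p <;> cases hw : x w <;> simp [hp, hw, hpa, hpb, hab, hab.symm]
    · simp [ha, hb, Equiv.swap_apply_of_ne_of_ne ha hb]

end Swaps

/-! ### Registers -/

section Registers

variable {T N : ℕ} {B : Type}

/-- The contents of a sequence of registers and of further wires. -/
def regs (v : Fin T → Qubits N) (p : B → Bool) : (Fin T × Fin N) ⊕ B → Bool :=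
  Sum.elim (fun w => v w.1 w.2) p

@[simp] theorem regs_inl (v : Fin T → Qubits N) (p : B → Bool) (a : Fin T) (j : Fin N) :
    regs v p (Sum.inl (a, j)) = v a j := rfl

@[simp] theorem regs_inr (v : Fin T → Qubits N) (p : B → Bool) (b : B) :
    regs v p (Sum.inr b) = p b := rfl

theorem update_regs [DecidableEq B] (v : Fin T → Qubits N) (p : B → Bool) (b : B) (c : Bool) :
    Function.update (regs v p) (Sum.inr b) c = regs v (Function.update p b c) := by
  funext w
  rcases w with w | w
  · rw [Function.update_of_ne (by simp)]
    rfl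
  · by_cases h : w = b
    · subst h
      simp
    · rw [Function.update_of_ne (by simpa using h)]
      simp [h]

/-- The contents of the register `a`. -/
def regAt (x : (Fin T × Fin N) ⊕ B → Bool) (a : Fin T) : Qubits N := fun j => x (Sum.inl (a, j))

@[simp] theorem regAt_regs (v : Fin T → Qubits N) (p : B → Bool) (a : Fin T) :
    regAt (regs v p) a = v a := rfl

variable [Fintype B] [DecidableEq B]

theorem decides_eq (b : B) (a a' : Fin T) :
    Decides (W := (Fin T × Fin N) ⊕ B) (Sum.inr b) (8 * N + 2) fun x => regAt x a = regAt x a' := by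
  refine ((Decides.forall_fin N fun j => (decides_wire (p := (Sum.inr b : (Fin T × Fin N) ⊕ B))
    (w := Sum.inl (a, j)) (by simp)).binary Iff
      (decides_wire (w := Sum.inl (a', j)) (by simp))).congr fun x => ?_).mono (by omega)
  rw [funext_iff]
  simp only [regAt, ← Bool.eq_iff_iff]

theorem decides_lt (b : B) (a a' : Fin T) :
    Decides (W := (Fin T × Fin N) ⊕ B) (Sum.inr b) (12 * N ^ 2 + 16 * N + 2)
      fun x => toLex (regAt x a) < toLex (regAt x a') := by
  have hw : ∀ (r : Fin T) (j : Fin N), Decides (W := (Fin T × Fin N) ⊕ B) (Sum.inr b) 2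
      fun x => x (Sum.inl (r, j)) = true := fun r j => decides_wire (by simp)
  have h1 : ∀ j j' : Fin N, Decides (W := (Fin T × Fin N) ⊕ B) (Sum.inr b) 10
      fun x => j' < j → (x (Sum.inl (a, j')) = true ↔ x (Sum.inl (a', j')) = true) := fun j j' =>
    ((decides_const _ (j' < j)).binary (fun P Q => P → Q) ((hw a j').binary Iff (hw a' j')))
  refine ((Decides.exists_fin N fun j => (Decides.forall_fin N fun j' => h1 j j').and
    ((hw a j).not.and (hw a' j))).congr fun x => ?_).mono (by ring_nf; omega)
  change _ ↔ ∃ i, (∀ j, j < i → regAt x a j = regAt x a' j) ∧ regAt x a i < regAt x a' i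
  simp only [regAt, Bool.lt_iff, Bool.not_eq_true, ← Bool.eq_iff_iff]

/-- A controlled swap of two registers. -/
theorem exists_clean_swapRegs (b : B) (a a' : Fin T) (h : a ≠ a') :
    ∃ M : Matrix ((Fin T × Fin N) ⊕ B → Bool) ((Fin T × Fin N) ⊕ B → Bool) ℂ,
      Clean (N * 3) M ∧ ∀ v p, M *ᵥ ket (regs v p) =
        ket (regs (fun r => if p b then v (Equiv.swap a a' r) else v r) p) := by
  have := fun j : Fin N => exists_clean_controlledSwap (Sum.inr b : (Fin T × Fin N) ⊕ B)
    (Sum.inl (a, j)) (Sum.inl (a', j)) (by simp) (by simp) (by simpa using h)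
  choose M hc hM using this
  refine ⟨_, clean_prod_ofFn M hc, fun v p => ?_⟩
  -- Intermediate state: the bits with index at least `c` have already been exchanged.
  have := prod_ofFn_mulVec M
    (fun c => ket (regs (fun r j => if c ≤ j.castSucc then (if p b then v (Equiv.swap a a' r) else v r) j
      else v r j) p)) fun i => by
    rw [hM]
    congr 1
    funext w
    rcases w with ⟨r, j⟩ | w
    · by_cases hp : p b = true
      · simp only [regs_inr, hp, if_true]
        by_cases hj : j = i
        · subst hj
          simp only [regs_inl, le_refl, if_true]
          by_cases hr : r = a
          · subst hr
            simp
          · by_cases hr' : r = a'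
            · subst hr'
              simp
            · rw [Equiv.swap_apply_of_ne_of_ne (by simpa using hr) (by simpa using hr')]
              simp [Equiv.swap_apply_of_ne_of_ne hr hr']
        · rw [Equiv.swap_apply_of_ne_of_ne (by simp [hj]) (by simp [hj])]
          have : i.succ ≤ j.castSucc ↔ i.castSucc ≤ j.castSucc := by
            rw [Fin.succ_le_castSucc_iff, Fin.castSucc_le_castSucc_iff]
            exact ⟨le_of_lt, fun h => lt_of_le_of_ne h (Ne.symm hj)⟩
          simp only [regs_inl, this]
      · simp [hp]
    · rw [Equiv.swap_apply_of_ne_of_ne (by simp) (by simp)]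
      simp
  rw [show (fun r (j : Fin N) => if Fin.last N ≤ j.castSucc then
      (if p b then v (Equiv.swap a a' r) else v r) j else v r j) = v by
    funext r j
    rw [if_neg (not_le.2 (Fin.castSucc_lt_last j))]] at this
  rw [this]
  simp

end Registers

/-! ### Splitting off the last register of a type state -/

/-- The rotation that turns `|0⟩` into `|1⟩` with probability `q` (cut off to `[0, 1]`). -/
def probGate (q : ℝ) : Matrix.unitaryGroup Bool ℂ :=
  rotGate (Real.sqrt (1 - max 0 (min 1 q))) (Real.sqrt (max 0 (min 1 q))) (by
    rw [Real.sq_sqrt (sub_nonneg.2 (max_le zero_le_one (min_le_left 1 q))),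
      Real.sq_sqrt (le_max_left _ _), sub_add_cancel])

theorem sum_probGate {W : Type} [Fintype W] [DecidableEq W] {q : ℝ} (h0 : 0 ≤ q) (h1 : q ≤ 1)
    (f : Bool → (W → Bool) → ℂ) :
    ∑ b, (probGate q : Matrix Bool Bool ℂ) b false • f b =
      ((Real.sqrt (1 - q) : ℝ) : ℂ) • f false + ((Real.sqrt q : ℝ) : ℂ) • f true := by
  rw [Fintype.sum_bool, add_comm]
  simp [probGate, rotGate, min_eq_right h1, max_eq_right h0]

section Level

variable {t N : ℕ}

/-- The wires of `t + 1` registers and `t` further wires. -/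
abbrev LevelWires (t N : ℕ) : Type := (Fin (t + 1) × Fin N) ⊕ Fin t

/-- The positions from `k` on. -/
def fromPos (k : Fin (t + 1)) : Fin t → Bool := fun i => decide (k ≤ i.castSucc)

/-- The condition for the use of the `l`-th rotation on the wire `i`. -/
def rotCond (i : Fin t) (l : Fin (t + 1)) (x : LevelWires t N → Bool) : Prop :=
  (∀ j : Fin t, (j : ℕ) = i + 1 → x (Sum.inr j) = true) ∧
    ((regAt x i.castSucc = regAt x i.succ ∧ l = i.castSucc) ∨
      (¬ regAt x i.castSucc = regAt x i.succ ∧ IsBlockEnd (regAt x) i.succ l))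

theorem decides_rotCond (i : Fin t) (l : Fin (t + 1)) :
    Decides (W := LevelWires t N) (Sum.inr i) (100 * (t + 1) * (N + 1)) (rotCond i l) := by
  have h1 : ∀ j : Fin t, Decides (W := LevelWires t N) (Sum.inr i) 2
      fun x => (j : ℕ) = i + 1 → x (Sum.inr j) = true := by
    intro j
    by_cases hj : (j : ℕ) = i + 1
    · refine (decides_wire (w := Sum.inr j) fun h => ?_).congr fun x => by simp [hj]
      have : j = i := Sum.inr_injective h
      rw [this] at hj
      omega
    · exact (decides_const _ True).congr fun x => by simp [hj]
  have h2 : Decides (W := LevelWires t N) (Sum.inr i) _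
      fun x => IsBlockEnd (regAt x) i.succ l :=
    (decides_eq i l i.succ).and (Decides.forall_fin t fun j =>
      (decides_const _ (j.castSucc = l)).binary (fun P Q => P → Q) (decides_eq i j.succ i.succ).not)
  refine ((Decides.forall_fin t h1).and (((decides_eq i i.castSucc i.succ).and
    (decides_const _ (l = i.castSucc))).or ((decides_eq i i.castSucc i.succ).not.and h2))).mono ?_
  -- The factor 100 is only slack over the sum of the costs of the subformulas.
  ring_nf
  nlinarith [Nat.zero_le (t * N)]

/-- The operator on the wire `i` of the preparation of the position register. -/
def rotStep (t N : ℕ) (i : Fin t) : Matrix (LevelWires t N → Bool) (LevelWires t N → Bool) ℂ :=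
  (List.ofFn fun l : Fin (t + 1) => controlledOn (Sum.inr i) (rotCond i l)
    (probGate ((i + 1 : ℝ) / (l + 1 : ℝ)))).prod

theorem clean_rotStep (i : Fin t) :
    Clean ((t + 1) * (2 * (100 * (t + 1) * (N + 1)) + 1)) (rotStep t N i) :=
  clean_prod_ofFn _ fun l => (decides_rotCond i l).clean _

open Classical in
/-- The amplitudes of the positions in the preparation of the position register, once the wires
from `c` on have been treated. -/
def posAmp (v : Fin (t + 1) → Qubits N) (c k : Fin (t + 1)) : ℂ :=
  if c < k ∧ IsBlockStart v k then
    ((Real.sqrt ((rankOf (fun l => toLex (v l)) k - k : ℝ) / (t + 1)) : ℝ) : ℂ)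
  else if k = c then ((Real.sqrt (rankOf (fun l => toLex (v l)) c / (t + 1) : ℝ) : ℝ) : ℂ)
  else 0

/-- The condition reads the registers and the wire `i + 1`, never its target `i`. -/
theorem rotCond_update (i : Fin t) (l : Fin (t + 1)) (x : LevelWires t N → Bool) (b : Bool) :
    rotCond i l (Function.update x (Sum.inr i) b) ↔ rotCond i l x := by
  have h1 : ∀ a, regAt (Function.update x (Sum.inr i) b) a = regAt x a := fun a => by
    funext j
    exact Function.update_of_ne (by simp) _ _
  have h2 : ∀ j : Fin t, ((j : ℕ) = i + 1 →
      Function.update x (Sum.inr i) b (Sum.inr j) = true) ↔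
        ((j : ℕ) = i + 1 → x (Sum.inr j) = true) := fun j => by
    refine forall_congr' fun hj => ?_
    rw [Function.update_of_ne]
    intro h
    have : j = i := Sum.inr_injective h
    rw [this] at hj
    omega
  have h3 : regAt (Function.update x (Sum.inr i) b) = regAt x := funext h1
  simp only [rotCond, h2, h3]

variable {v : Fin (t + 1) → Qubits N} (hv : Monotone fun l => toLex (v l))
include hv

-- The unary code of `k` has a zero on the wire `i + 1` when `i + 1 < k`: the walk has already
-- stopped at `k`, and no rotation condition holds.
omit hv in
theorem rotStep_ket_of_lt {i : Fin t} {k : Fin (t + 1)} (h : i.succ < k) :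
    rotStep t N i *ᵥ ket (regs v (fromPos k)) = ket (regs v (fromPos k)) := by
  refine prod_controlledOn_ket_of_not _ _ fun l hl => ?_
  have hi : (i : ℕ) + 1 < t := by
    have := k.isLt
    have h' : (i : ℕ) + 1 < k := h
    omega
  have := hl.1 ⟨i + 1, hi⟩ rfl
  rw [regs_inr, fromPos, decide_eq_true_iff] at this
  exact absurd h (not_lt.2 this)

omit hv in
theorem update_fromPos (i : Fin t) (b : Bool) :
    Function.update (fromPos i.succ) i b = if b then fromPos i.castSucc else fromPos i.succ := by
  funext j
  by_cases hj : j = i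
  · subst hj
    cases b <;> simp [fromPos]
  · have : i.succ ≤ j.castSucc ↔ i.castSucc ≤ j.castSucc := by
      rw [Fin.succ_le_castSucc_iff, Fin.castSucc_le_castSucc_iff]
      exact ⟨le_of_lt, fun h => lt_of_le_of_ne h (Ne.symm hj)⟩
    rw [Function.update_of_ne hj]
    cases b
    · rfl
    · simp only [fromPos, this, if_true]

/-- One step of the walk from position `i + 1` to `i`. Inside a block it always moves on. At the
first position of a block ending at `l`, it moves on with probability `(i + 1) / (l + 1)`, where `l
+ 1` is the rank of `i + 1` and `i + 1` is the rank of `i`. The weight left behind is rank minus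
position, that is, the multiplicity, over `t + 1`. -/
theorem rotStep_ket (i : Fin t) :
    ((Real.sqrt (rankOf (fun l => toLex (v l)) i.succ / (t + 1) : ℝ) : ℝ) : ℂ) •
      (rotStep t N i *ᵥ ket (regs v (fromPos i.succ))) =
        posAmp v i.castSucc i.succ • ket (regs v (fromPos i.succ)) +
          posAmp v i.castSucc i.castSucc • ket (regs v (fromPos i.castSucc)) := by
  have hp : ∀ j : Fin t, (j : ℕ) = i + 1 → fromPos i.succ j = true := by
    intro j hj
    simp [fromPos, Fin.le_def, hj]
  have hk : ∀ b, ket (Function.update (regs v (fromPos i.succ)) (Sum.inr i) b) =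
      ket (regs v (if b then fromPos i.castSucc else fromPos i.succ)) := fun b => by
    rw [update_regs, update_fromPos]
  have hf : regs v (fromPos i.succ) (Sum.inr i) = false := by simp [fromPos]
  have hsc : posAmp v i.castSucc i.castSucc =
      ((Real.sqrt (rankOf (fun l => toLex (v l)) i.castSucc / (t + 1) : ℝ) : ℝ) : ℂ) := by
    rw [posAmp, if_neg (by simp), if_pos rfl]
  by_cases h : v i.castSucc = v i.succ
  · have hc : ∀ l, rotCond i l (regs v (fromPos i.succ)) ↔ l = i.castSucc := fun l => by
      simp only [rotCond, regs_inr, regAt_regs, h, true_and, not_true, false_and, or_false]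
      exact ⟨fun h => h.2, fun h => ⟨hp, h⟩⟩
    -- Inside a block the selected index is `l = i`, chosen to make the probability equal to one.
    have hq : ((i : ℝ) + 1) / ((i.castSucc : ℕ) + 1 : ℝ) = 1 := by
      rw [Fin.val_castSucc]
      exact div_self (by positivity)
    rw [rotStep, prod_controlledOn_ket _ _ (fun l b => rotCond_update i l _ b) _ hc, hf, hq,
      sum_probGate zero_le_one le_rfl, hk, hk]
    have h1 : posAmp v i.castSucc i.succ = 0 := by
      rw [posAmp, if_neg, if_neg Fin.castSucc_lt_succ.ne']
      rintro ⟨-, h'⟩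
      exact h' i rfl h
    rw [h1, hsc]
    simp [rankOf, h]
  · obtain ⟨l₀, hl₀, hend⟩ := exists_isBlockEnd (u := fun l => toLex (v l)) i.succ
    have hc : ∀ l, rotCond i l (regs v (fromPos i.succ)) ↔ l = l₀ := fun l => by
      rw [← isBlockEnd_iff hv hend]
      simp only [rotCond, regs_inr, regAt_regs, h, not_false_iff, false_and, true_and, false_or]
      exact ⟨fun h => h.2, fun h => ⟨hp, h⟩⟩
    have hr := hend.rankOf_eq hv
    have hil : ((i : ℕ) : ℝ) + 1 ≤ (l₀ : ℕ) + 1 := by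
      have : (i : ℕ) + 1 ≤ l₀ := hl₀
      have : (((i : ℕ) + 1 : ℕ) : ℝ) ≤ ((l₀ : ℕ) : ℝ) := by exact_mod_cast this
      push_cast at this
      linarith
    have hss : posAmp v i.castSucc i.succ = ((Real.sqrt
        ((rankOf (fun l => toLex (v l)) i.succ - (i.succ : ℕ) : ℝ) / (t + 1)) : ℝ) : ℂ) := by
      rw [posAmp, if_pos]
      refine ⟨Fin.castSucc_lt_succ, fun j hj => ?_⟩
      rw [Fin.succ_inj] at hj
      subst hj
      exact h
    have hpos : (0 : ℝ) < (l₀ : ℕ) + 1 := by positivity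
    rw [rotStep, prod_controlledOn_ket _ _ (fun l b => rotCond_update i l _ b) _ hc, hf,
      sum_probGate (by positivity) ((div_le_one hpos).2 hil), hk, hk, smul_add, smul_smul,
      smul_smul, hsc, rankOf_castSucc_of_ne hv i h, hss, hr]
    simp only [if_true, Bool.false_eq_true, if_false]
    -- The factor `l₀ + 1` cancels between the weight of the walk and the rotation probability.
    rw [← Complex.ofReal_mul, ← Complex.ofReal_mul, ← Real.sqrt_mul (by positivity),
      ← Real.sqrt_mul (by positivity)]
    congr 4
    · push_cast
      rw [Fin.val_succ]
      push_cast
      field_simp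
    · push_cast
      field_simp

theorem prod_rotStep_ket :
    (List.ofFn (rotStep t N)).prod *ᵥ ket (regs v (zeros (Fin t))) =
      ∑ k, posAmp v 0 k • ket (regs v (fromPos k)) := by
  have key := prod_ofFn_mulVec (rotStep t N) (fun c => ∑ k, posAmp v c k • ket (regs v (fromPos k)))
    fun i => by
      have hne : i.castSucc ≠ i.succ := Fin.castSucc_lt_succ.ne
      have hmem : i.castSucc ∈ Finset.univ.erase i.succ :=
        Finset.mem_erase.2 ⟨hne, Finset.mem_univ _⟩
      have h0 : posAmp v i.succ i.castSucc = 0 := by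
        rw [posAmp, if_neg fun h => absurd h.1 (not_lt.2 Fin.castSucc_lt_succ.le), if_neg hne]
      rw [mulVec_sum_smul, ← Finset.add_sum_erase _ _ (Finset.mem_univ i.succ),
        ← Finset.add_sum_erase _ _ hmem, h0, zero_smul, zero_add,
        ← Finset.add_sum_erase (a := i.succ) _ (fun k => posAmp v i.castSucc k • _)
          (Finset.mem_univ i.succ),
        ← Finset.add_sum_erase (a := i.castSucc) _ (fun k => posAmp v i.castSucc k • _) hmem,
        ← add_assoc, ← rotStep_ket hv]
      have h1 : posAmp v i.succ i.succ =
          ((Real.sqrt (rankOf (fun l => toLex (v l)) i.succ / (t + 1) : ℝ) : ℝ) : ℂ) := by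
        rw [posAmp, if_neg (by simp), if_pos rfl]
      rw [h1]
      congr 1
      -- Positions above `i + 1` are final, and positions below `i` have not been reached.
      refine Finset.sum_congr rfl fun k hk => ?_
      rw [Finset.mem_erase, Finset.mem_erase] at hk
      rcases lt_or_ge i.succ k with h | h
      · rw [rotStep_ket_of_lt h]
        have h' := Fin.castSucc_lt_succ.trans h
        congr 1
        rw [posAmp, posAmp]
        by_cases hs : IsBlockStart v k
        · rw [if_pos ⟨h, hs⟩, if_pos ⟨h', hs⟩]
        · rw [if_neg fun h => hs h.2, if_neg hk.2.1, if_neg fun h => hs h.2, if_neg hk.1]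
      · have h2 : k < i.castSucc := by
          refine lt_of_le_of_ne ?_ hk.1
          have := lt_of_le_of_ne h hk.2.1
          rwa [← Fin.le_castSucc_iff] at this
        rw [posAmp, posAmp, if_neg fun h' => absurd h'.1 (not_lt.2 h), if_neg hk.2.1,
          if_neg fun h' => absurd h'.1 (not_lt.2 h2.le), if_neg hk.1, zero_smul, zero_smul]
  rw [← key]
  congr 1
  -- The walk starts with full weight at the last position: its unary code is all zeros, and its
  -- rank is `t + 1`.
  rw [Finset.sum_eq_single (Fin.last t)]
  · rw [posAmp, if_neg (by simp), if_pos rfl, rankOf_last hv]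
    have : fromPos (Fin.last t) = zeros (Fin t) := by
      funext i
      simp [fromPos]
    rw [this]
    push_cast
    rw [div_self (by positivity)]
    simp
  · intro k _ hk
    rw [posAmp, if_neg fun h => absurd h.1 (not_lt.2 (Fin.le_last k)), if_neg hk, zero_smul]
  · simp

theorem posAmp_zero (k : Fin (t + 1)) (h : IsBlockStart v k) : posAmp v 0 k =
    ((Real.sqrt ((Finset.univ.filter fun l => v l = v k).card / (t + 1) : ℝ) : ℝ) : ℂ) := by
  have h' : IsBlockStart (fun l => toLex (v l)) k := h
  have h1 : rankOf (fun l => toLex (v l)) k =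
      k + (Finset.univ.filter fun l => v l = v k).card :=
    @IsBlockStart.rankOf_eq _ _ _ _ hv k (fun l => decEq (v l) (v k)) h'
  rw [posAmp]
  by_cases hk : k = 0
  · subst hk
    rw [if_neg (by simp), if_pos rfl, h1]
    simp
  · rw [if_pos ⟨Fin.pos_of_ne_zero hk, h⟩, h1]
    push_cast
    rw [add_sub_cancel_left]

-- The exceptional branch `k = 0` of `posAmp` does no harm, since position `0` is always a block
-- start.
omit hv in
theorem posAmp_zero_of_not (k : Fin (t + 1)) (h : ¬ IsBlockStart v k) : posAmp v 0 k = 0 := by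
  rw [posAmp, if_neg fun h' => h h'.2, if_neg]
  rintro rfl
  exact h fun i hi => absurd hi (Fin.succ_ne_zero i)

end Level

section Level

variable {t N : ℕ}

/-- The swaps that move the chosen entry to the last register. -/
theorem exists_clean_moveToEnd (t N : ℕ) :
    ∃ M : Matrix (LevelWires t N → Bool) (LevelWires t N → Bool) ℂ, Clean (t * (N * 3)) M ∧
      ∀ (v : Fin (t + 1) → Qubits N) (k : Fin (t + 1)), M *ᵥ ket (regs v (fromPos k)) =
        ket (regs (moveToEnd k v) (fromPos k)) := by
  choose M hc hM using fun i : Fin t => exists_clean_swapRegs (N := N) i i.castSucc (Fin.last t)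
    (Fin.castSucc_lt_last i).ne
  refine ⟨_, clean_prod_ofFn M hc, fun v k => ?_⟩
  -- The swaps are triggered exactly for `i ≥ k`; after the wires from `c` on, the entry taken out
  -- is number `max c k`.
  have := prod_ofFn_mulVec M (fun c => ket (regs (moveToEnd (max c k) v) (fromPos k))) fun i => by
    rw [hM]
    congr 2
    funext r
    by_cases h : k ≤ i.castSucc
    · rw [fromPos, if_pos (decide_eq_true h), max_eq_left h,
        max_eq_left (h.trans Fin.castSucc_lt_succ.le), moveToEnd_succ_swap]
    · have h' : i.succ ≤ k := by rwa [← Fin.castSucc_lt_iff_succ_le, ← not_le]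
      rw [fromPos, if_neg (by simpa using h), max_eq_right h',
        max_eq_right (Fin.castSucc_lt_succ.le.trans h')]
  rw [max_eq_left (Fin.le_last k), moveToEnd_eq_self, max_eq_right (Fin.zero_le k)] at this
  exact this

/-- The computation that resets the position register. -/
theorem exists_clean_erasePos (t N : ℕ) :
    ∃ M : Matrix (LevelWires t N → Bool) (LevelWires t N → Bool) ℂ,
      Clean (t * (2 * (12 * N ^ 2 + 16 * N + 2 + 4) + 1)) M ∧
      ∀ (v : Fin (t + 1) → Qubits N), Monotone (fun l => toLex (v l)) →
        ∀ k, IsBlockStart v k → M *ᵥ ket (regs (moveToEnd k v) (fromPos k)) =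
          ket (regs (moveToEnd k v) (zeros (Fin t))) := by
  classical
  let P : Fin t → (LevelWires t N → Bool) → Prop := fun i x =>
    ¬ toLex (regAt x i.castSucc) < toLex (regAt x (Fin.last t))
  refine ⟨_, clean_prod_ofFn (fun i : Fin t => controlledOn (Sum.inr i) (P i) notGate)
    fun i => (decides_lt i i.castSucc (Fin.last t)).not.clean notGate, fun v hv k hk => ?_⟩
  have hk' : IsBlockStart (fun l => toLex (v l)) k := hk
  have hlt : ∀ j, toLex (v j) < toLex (v k) ↔ j < k := fun j => hk'.lt_iff hv
  -- Intermediate state: the position wires with index at least `c` are already zero.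
  have := prod_ofFn_mulVec (fun i : Fin t => controlledOn (Sum.inr i) (P i) notGate)
    (fun c => ket (regs (moveToEnd k v) fun i => if c ≤ i.castSucc then false else fromPos k i))
    fun i => by
      rw [controlledOn_not_ket, update_regs]
      congr 2
      funext j
      by_cases hj : j = i
      · subst hj
        have h1 : ¬ j.succ ≤ j.castSucc := not_le.2 Fin.castSucc_lt_succ
        -- The position bit can be read off the registers: before `k` the entries are smaller than
        -- the last register. From `k` on, the shifted entries are not smaller, because the rest of
        -- the tuple is still sorted.
        have h2 : P j (regs (moveToEnd k v) fun i => if j.succ ≤ i.castSucc then false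
            else fromPos k i) ↔ k ≤ j.castSucc := by
          simp only [P, regAt_regs, moveToEnd_last, moveToEnd_castSucc]
          rw [hlt, not_lt]
          rcases lt_or_ge j.castSucc k with h | h
          · rw [Fin.succAbove_of_castSucc_lt _ _ h]
          · rw [Fin.succAbove_of_le_castSucc _ _ h]
            exact ⟨fun _ => h, fun _ => h.trans Fin.castSucc_lt_succ.le⟩
        simp only [regs_inr, Function.update_self, if_neg h1, le_refl, if_true]
        rw [decide_eq_decide.2 h2]
        exact Bool.xor_self _
      · have : i.succ ≤ j.castSucc ↔ i.castSucc ≤ j.castSucc := by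
          rw [Fin.succ_le_castSucc_iff, Fin.castSucc_le_castSucc_iff]
          exact ⟨le_of_lt, fun h => lt_of_le_of_ne h (Ne.symm hj)⟩
        rw [Function.update_of_ne hj]
        simp only [this]
  have h1 : (fun i : Fin t => if Fin.last t ≤ i.castSucc then false else fromPos k i) =
      fromPos k := by
    funext i
    rw [if_neg (not_le.2 (Fin.castSucc_lt_last i))]
  have h2 : (fun i : Fin t => if (0 : Fin (t + 1)) ≤ i.castSucc then false else fromPos k i) =
      zeros (Fin t) := by
    funext i
    rw [if_pos (Fin.zero_le _)]
  rw [h1, h2] at this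
  exact this

/-- One level of the recursion: choose a block start in superposition, move its entry to the end,
erase the choice. Positions that are not block starts have amplitude zero, so the erasure need not
work for them. -/
theorem exists_clean_splitLast (t N : ℕ) :
    ∃ M : Matrix (LevelWires t N → Bool) (LevelWires t N → Bool) ℂ,
      Clean (1000 * (t + 1) ^ 3 * (N + 1) ^ 2) M ∧
      ∀ (v : Fin (t + 1) → Qubits N), Monotone (fun l => toLex (v l)) →
        M *ᵥ ket (regs v (zeros (Fin t))) =
          ∑ k, posAmp v 0 k • ket (regs (moveToEnd k v) (zeros (Fin t))) := by
  obtain ⟨M₂, hc₂, hM₂⟩ := exists_clean_moveToEnd t N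
  obtain ⟨M₃, hc₃, hM₃⟩ := exists_clean_erasePos t N
  refine ⟨M₃ * (M₂ * (List.ofFn (rotStep t N)).prod), (hc₃.mul (hc₂.mul
    (clean_prod_ofFn (rotStep t N) clean_rotStep))).mono ?_, fun v hv => ?_⟩
  · have h1 : t * ((t + 1) * (2 * (100 * (t + 1) * (N + 1)) + 1)) ≤
        (t + 1) * ((t + 1) * (201 * (t + 1) * (N + 1) ^ 2)) := by
      gcongr
      · omega
      · nlinarith [Nat.zero_le (t * N), Nat.zero_le (t * N ^ 2)]
    have hX : (N + 1) ^ 2 ≤ (t + 1) ^ 2 * (N + 1) ^ 2 :=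
      Nat.le_mul_of_pos_left _ (by positivity)
    have h2 : t * (N * 3) ≤ (t + 1) * (3 * ((t + 1) ^ 2 * (N + 1) ^ 2)) :=
      Nat.mul_le_mul (by omega) (by nlinarith)
    have h3 : t * (2 * (12 * N ^ 2 + 16 * N + 2 + 4) + 1) ≤
        (t + 1) * (100 * ((t + 1) ^ 2 * (N + 1) ^ 2)) :=
      Nat.mul_le_mul (by omega) (by nlinarith)
    calc _ ≤ (t + 1) * ((t + 1) * (201 * (t + 1) * (N + 1) ^ 2)) +
          (t + 1) * (3 * ((t + 1) ^ 2 * (N + 1) ^ 2)) +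
          (t + 1) * (100 * ((t + 1) ^ 2 * (N + 1) ^ 2)) := by gcongr
      _ = 304 * (t + 1) ^ 3 * (N + 1) ^ 2 := by ring
      _ ≤ _ := by gcongr; omega
  · rw [← Matrix.mulVec_mulVec, ← Matrix.mulVec_mulVec, prod_rotStep_ket hv, mulVec_sum_smul,
      mulVec_sum_smul]
    refine Finset.sum_congr rfl fun k _ => ?_
    by_cases hk : IsBlockStart v k
    · rw [hM₂, hM₃ v hv k hk]
    · rw [posAmp_zero_of_not k hk, zero_smul, zero_smul]

end Level

/-! ### Preparation of type states -/

section TypeStates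

variable {t N : ℕ}

theorem sqrt_count_div_mul (m t a b : ℕ) (ha : 0 < a) (hb : 0 < b) (h : m * a = (t + 1) * b) :
    Real.sqrt ((m : ℝ) / (t + 1)) * (1 / Real.sqrt b) = 1 / Real.sqrt a := by
  have ha' : (0 : ℝ) < a := by exact_mod_cast ha
  have hb' : (0 : ℝ) < b := by exact_mod_cast hb
  have h' : (m : ℝ) * a = (t + 1) * b := by exact_mod_cast h
  have h1 : (m : ℝ) / (t + 1) = b / a := by
    rw [div_eq_div_iff (by positivity) ha'.ne', h', mul_comm]
  rw [h1, Real.sqrt_div hb'.le]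
  have := Real.sqrt_pos.2 hb'
  field_simp

/-- The component of a type state with `x` in the last register. At most one block start carries the
value `x`, and the normalisations match because `mult(x)` times the number of tuples of type `v` is
`t + 1` times the number of tuples with one `x` removed (`mul_typeCard`). -/
theorem schurSym_recursion (v : Fin (t + 1) → Qubits N) (hv : Monotone fun l => toLex (v l))
    (w : Fin t → Qubits N) (x : Qubits N) :
    ∑ k, (if v k = x then posAmp v 0 k * schurSym (Qubits N) t w
      (typeOf fun i => v (k.succAbove i)) else 0) =
        schurSym (Qubits N) (t + 1) (Fin.snoc (α := fun _ => Qubits N) w x) (typeOf v) := by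
  by_cases hx : ∃ k, v k = x
  · obtain ⟨k, rfl⟩ := hx
    obtain ⟨k₀, hs, hk₀, hu⟩ := exists_isBlockStart hv k
    have hk₀' : v k₀ = v k := hk₀
    rw [Finset.sum_eq_single k₀]
    · rw [if_pos hk₀', posAmp_zero hv k₀ hs, schurSym_apply, schurSym_apply, typeOf_snoc]
      have h1 : v k ::ₛ typeOf w = typeOf v ↔ typeOf w = typeOf fun i => v (k₀.succAbove i) := by
        rw [typeOf_eq_cons v k₀, hk₀', Sym.cons_inj_right]
      by_cases h : typeOf w = typeOf fun i => v (k₀.succAbove i)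
      · rw [if_pos h, if_pos (h1.2 h), ← Complex.ofReal_mul,
          sqrt_count_div_mul _ t _ _ (typeCard_pos v) (typeCard_pos _) (mul_typeCard v k₀)]
      · rw [if_neg h, if_neg fun h' => h (h1.1 h'), mul_zero]
    · intro k' _ hk'
      split_ifs with h
      · rw [posAmp_zero_of_not (v := v) k' fun h' => hk' (hu k' h' (by rw [h])), zero_mul]
      · rfl
    · simp
  · rw [Finset.sum_eq_zero, schurSym_apply, if_neg]
    · intro h
      have : x ∈ typeOf v := by
        rw [← h, typeOf_snoc]
        exact Sym.mem_cons_self _ _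
      obtain ⟨k, -, hk⟩ := Multiset.mem_map.1 (show x ∈ Multiset.map v Finset.univ.val from this)
      exact hx ⟨k, hk⟩
    · exact fun k _ => if_neg fun h => hx ⟨k, h⟩

/-- The bound on the number of gates and ancillas used for type states. -/
def typeStateSize (t N : ℕ) : ℕ := t * (1000 * (t + 1) ^ 3 * (N + 1) ^ 2)

/-- Recursion on the number of registers: split off the last entry, then prepare the type state of
the others. The position wires end in zero and are reused by the smaller instance. -/
theorem exists_clean_typeState (t N : ℕ) :
    ∃ M : Matrix ((Fin t × Fin N) ⊕ Fin t → Bool) ((Fin t × Fin N) ⊕ Fin t → Bool) ℂ,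
      Clean (typeStateSize t N) M ∧
      ∀ v : Fin t → Qubits N, Monotone (fun l => toLex (v l)) →
        M *ᵥ ket (regs v (zeros (Fin t))) =
          ∑ w, schurSym (Qubits N) t w (typeOf v) • ket (regs w (zeros (Fin t))) := by
  induction t with
  | zero =>
    refine ⟨1, clean_one.mono (Nat.zero_le _), fun v _ => ?_⟩
    rw [Matrix.one_mulVec, Finset.sum_eq_single v
      (fun w _ hw => absurd (Subsingleton.elim w v) hw)
      (fun h => absurd (Finset.mem_univ v) h), schurSym_apply]
    have h2 : typeCard (typeOf v) = 1 := by
      rw [typeCard, Finset.card_eq_one]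
      exact ⟨v, Finset.ext fun w => by
        rw [Subsingleton.elim w v, Finset.mem_filter, Finset.mem_singleton]
        exact ⟨fun _ => rfl, fun _ => ⟨Finset.mem_univ _, rfl⟩⟩⟩
    rw [h2]
    simp
  | succ t ih =>
    obtain ⟨M, hc, hM⟩ := ih
    obtain ⟨L, hcL, hL⟩ := exists_clean_splitLast t N
    -- `ι` leaves out the last register and serves the induction hypothesis; `κ` keeps every
    -- register and serves the splitting, which needs only `t` position wires.
    let ι : (Fin t × Fin N) ⊕ Fin t ↪ (Fin (t + 1) × Fin N) ⊕ Fin (t + 1) :=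
      (Fin.castSuccEmb.prodMap (Function.Embedding.refl _)).sumMap
        Fin.castSuccEmb
    let κ : LevelWires t N ↪ (Fin (t + 1) × Fin N) ⊕ Fin (t + 1) :=
      (Function.Embedding.refl _).sumMap Fin.castSuccEmb
    have hκ : ∀ v v' : Fin (t + 1) → Qubits N,
        Function.extend κ (regs v' (zeros (Fin t))) (regs v (zeros (Fin (t + 1)))) =
          regs v' (zeros (Fin (t + 1))) := fun v v' => by
      rw [extend_eq_iff]
      refine ⟨fun w hw => ?_, funext fun w => by rcases w with w | w <;> rfl⟩
      rcases w with w | w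
      · exact absurd ⟨Sum.inl w, rfl⟩ hw
      · rfl
    have hι : ∀ (v : Fin (t + 1) → Qubits N) (w : Fin t → Qubits N),
        Function.extend ι (regs w (zeros (Fin t))) (regs v (zeros (Fin (t + 1)))) =
          regs (Fin.snoc (α := fun _ => Qubits N) w (v (Fin.last t))) (zeros (Fin (t + 1))) :=
      fun v w => by
        rw [extend_eq_iff]
        refine ⟨fun z hz => ?_, funext fun z => ?_⟩
        · rcases z with ⟨a, j⟩ | z
          · induction a using Fin.lastCases with
            | last => simp
            | cast a => exact absurd ⟨Sum.inl (a, j), rfl⟩ hz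
          · rfl
        · rcases z with ⟨a, j⟩ | z
          · have : ι (Sum.inl (a, j)) = Sum.inl (a.castSucc, j) := rfl
            rw [this, regs_inl, regs_inl, Fin.snoc_castSucc]
          · rfl
    refine ⟨onWires ι M * onWires κ L, ((hc.onWires ι).mul (hcL.onWires κ)).mono ?_,
      fun v hv => ?_⟩
    · have h : typeStateSize t N ≤ t * (1000 * (t + 1 + 1) ^ 3 * (N + 1) ^ 2) := by
        unfold typeStateSize
        gcongr
        omega
      have h' : 1000 * (t + 1) ^ 3 * (N + 1) ^ 2 ≤ 1000 * (t + 1 + 1) ^ 3 * (N + 1) ^ 2 := by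
        gcongr
        omega
      calc _ ≤ 1000 * (t + 1 + 1) ^ 3 * (N + 1) ^ 2 +
            t * (1000 * (t + 1 + 1) ^ 3 * (N + 1) ^ 2) := by gcongr
        _ = typeStateSize (t + 1) N := by unfold typeStateSize; ring
    · rw [← Matrix.mulVec_mulVec, onWires_ket_of_sum κ L _ Finset.univ _ _
        (by rw [← hL v hv]; congr 2; funext w; rcases w with w | w <;> rfl), mulVec_sum_smul]
      simp only [hκ]
      have h1 : ∀ k : Fin (t + 1),
          onWires ι M *ᵥ ket (regs (moveToEnd k v) (zeros (Fin (t + 1)))) =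
            ∑ w, schurSym (Qubits N) t w (typeOf fun i => v (k.succAbove i)) •
              ket (regs (Fin.snoc (α := fun _ => Qubits N) w (v k)) (zeros (Fin (t + 1)))) := by
        intro k
        rw [onWires_ket_of_sum ι M _ Finset.univ _ _ (by
          -- Deleting an entry of a sorted tuple leaves it sorted, so the induction hypothesis
          -- applies.
          rw [← hM (fun i => v (k.succAbove i))
            (hv.comp (Fin.strictMono_succAbove k).monotone)]
          congr 2
          funext z
          rcases z with ⟨a, j⟩ | z
          · exact congrFun (moveToEnd_castSucc k v a) j
          · rfl)]
        simp only [hι, moveToEnd_last]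
      simp only [h1]
      rw [← (Fin.snocEquiv fun _ : Fin (t + 1) => Qubits N).sum_comp, Fintype.sum_prod_type_right]
      simp only [Finset.smul_sum, smul_smul]
      rw [Finset.sum_comm]
      refine Finset.sum_congr rfl fun w _ => ?_
      have h2 : ∀ x, schurSym (Qubits N) (t + 1) (Fin.snoc (α := fun _ => Qubits N) w x)
          (typeOf v) • ket (regs (Fin.snoc (α := fun _ => Qubits N) w x) (zeros (Fin (t + 1)))) =
            ∑ k, if v k = x then (posAmp v 0 k * schurSym (Qubits N) t w
              (typeOf fun i => v (k.succAbove i))) •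
                ket (regs (Fin.snoc (α := fun _ => Qubits N) w (v k)) (zeros (Fin (t + 1))))
              else 0 := by
        intro x
        rw [← schurSym_recursion v hv w x, Finset.sum_smul]
        refine Finset.sum_congr rfl fun k _ => ?_
        split_ifs with h
        · rw [h]
        · rw [zero_smul]
      refine Eq.trans ?_ (Finset.sum_congr rfl fun x _ => h2 x).symm
      rw [Finset.sum_comm]
      refine Finset.sum_congr rfl fun k _ => ?_
      rw [Finset.sum_ite_eq]
      simp

theorem monotone_sortedTuple (T : Sym (Qubits N) t) :
    Monotone fun l => toLex (sortedTuple T l) := by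
  intro a b hab
  have h : (sortedList T).Pairwise (· ≤ ·) := Multiset.pairwise_sort _ _
  exact List.Pairwise.rel_get_of_le h (by simpa using hab)

theorem typeOf_sortedTuple (T : Sym (Qubits N) t) : typeOf (sortedTuple T) = T := by
  refine Subtype.ext (Multiset.map_injective toLex.injective ?_)
  change Multiset.map toLex (Multiset.map (sortedTuple T) Finset.univ.val) =
    Multiset.map toLex (T : Multiset (Qubits N))
  have h1 : ((sortedList T : List _) : Multiset (Lex (Qubits N))) =
    Multiset.map toLex (T : Multiset (Qubits N)) := Multiset.sort_eq _ _
  rw [← h1, Multiset.map_map]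
  have h2 : (Finset.univ : Finset (Fin t)).val = (List.finRange t : Multiset (Fin t)) := rfl
  rw [h2, Multiset.map_coe]
  congr 1
  refine List.ext_getElem (by simp [sortedList_length]) fun i h h' => ?_
  simp [sortedTuple]

/-- The type state of `T` as a vector of the qubits that store the registers. -/
def typeVec (T : Sym (Qubits N) t) : (Fin t × Fin N → Bool) → ℂ :=
  fun x => schurSym (Qubits N) t (fun i j => x (i, j)) T

/-- The assignment of the wires that stores the type `T`. -/
def typeAssign (T : Sym (Qubits N) t) : Fin t × Fin N → Bool := fun w => sortedTuple T w.1 w.2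

/-- The position wires are counted among the ancillas, which gives the extra `t`, and sorted tuples
are identified with types. -/
theorem exists_typeState_gates (t N : ℕ) :
    ∃ (A : Type) (_ : Fintype A) (_ : DecidableEq A) (l : List (QGate ((Fin t × Fin N) ⊕ A))),
      Fintype.card A + l.length ≤ t + typeStateSize t N ∧
        ∀ T : Sym (Qubits N) t,
          gatesMatrix l *ᵥ ket (Sum.elim (typeAssign T) (zeros A)) =
            addZeros (Fin t × Fin N) A *ᵥ typeVec T := by
  obtain ⟨M, ⟨A, _, _, l, hs, hl⟩, hM⟩ := exists_clean_typeState t N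
  let ι := (Equiv.sumAssoc (Fin t × Fin N) (Fin t) A).toEmbedding
  refine ⟨Fin t ⊕ A, inferInstance, inferInstance, l.map (QGate.map ι), ?_, fun T => ?_⟩
  · simp
    omega
  · rw [gatesMatrix_map, onWires_ket_of_sum ι _ _ Finset.univ
      (fun w => schurSym (Qubits N) t w T)
      (fun w => Sum.elim (regs w (zeros (Fin t))) (zeros A))]
    · rw [vec_eq_sum_ket (typeVec T), mulVec_sum_smul,
        ← (Equiv.curry (Fin t) (Fin N) Bool).symm.sum_comp]
      refine Finset.sum_congr rfl fun w _ => ?_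
      rw [addZeros_ket]
      congr 2
      rw [extend_eq_iff]
      refine ⟨fun z hz => absurd (Equiv.surjective _ z) hz, funext fun z => ?_⟩
      rcases z with (z | z) | z <;> rfl
    · have h1 : (fun i => Sum.elim (typeAssign T) (zeros (Fin t ⊕ A)) (ι i)) =
          Sum.elim (regs (sortedTuple T) (zeros (Fin t))) (zeros A) := by
        funext z
        rcases z with (z | z) | z <;> rfl
      rw [h1, hl, hM _ (monotone_sortedTuple T), typeOf_sortedTuple, mulVec_sum_smul]
      simp only [addZeros_ket]

end TypeStates

/-! ### Assignments of some wires and of the remaining wires -/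

section Glue

variable {A W : Type} (ι : A ↪ W)

/-- The wires outside an embedded set of wires. -/
abbrev RestWires (ι : A ↪ W) : Type := {w : W // w ∉ Set.range ι}

open Classical in
/-- The assignment that is `y` on the wires `ι` and `g` on the other wires. -/
def glue (y : A → Bool) (g : RestWires ι → Bool) : W → Bool :=
  Function.extend ι y fun w => if h : w ∉ Set.range ι then g ⟨w, h⟩ else false

@[simp] theorem glue_emb (y : A → Bool) (g : RestWires ι → Bool) (a : A) : glue ι y g (ι a) = y a :=
  extend_apply_emb ι _ _ a

theorem glue_off (y : A → Bool) (g : RestWires ι → Bool) {w : W} (h : w ∉ Set.range ι) :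
    glue ι y g w = g ⟨w, h⟩ := by
  rw [glue, extend_apply_off ι _ _ h, dif_pos h]

theorem glue_bijective : Function.Bijective
    fun p : (A → Bool) × (RestWires ι → Bool) => glue ι p.1 p.2 := by
  constructor
  · rintro ⟨y, g⟩ ⟨y', g'⟩ h
    have h1 : y = y' := funext fun a => by
      have := congrFun h (ι a)
      simpa using this
    have h2 : g = g' := funext fun w => by
      have := congrFun h w.1
      simpa [glue_off ι _ _ w.2] using this
    rw [h1, h2]
  · intro x
    refine ⟨(fun a => x (ι a), fun w => x w.1), funext fun w => ?_⟩
    by_cases h : w ∈ Set.range ι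
    · obtain ⟨a, rfl⟩ := h
      simp
    · simp [glue_off ι _ _ h]

/-- The function depends only on the wires outside the range of `ι`. -/
def DependsOff (ι : A ↪ W) {M : Type} (Γ : (W → Bool) → M) : Prop :=
  ∀ x y, (∀ w, w ∉ Set.range ι → x w = y w) → Γ x = Γ y

theorem DependsOff.extend {ι : A ↪ W} {M : Type} {Γ : (W → Bool) → M} (h : DependsOff ι Γ)
    (z : A → Bool) (x : W → Bool) : Γ (Function.extend ι z x) = Γ x :=
  h _ _ fun _ hw => extend_apply_off ι z x hw

theorem DependsOff.mul {ι : A ↪ W} {Γ Δ : (W → Bool) → ℂ} (h : DependsOff ι Γ)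
    (h' : DependsOff ι Δ) : DependsOff ι fun w => Γ w * Δ w :=
  fun x y hxy => congrArg₂ (· * ·) (h x y hxy) (h' x y hxy)

theorem DependsOff.prod {ι : A ↪ W} {J : Type} (s : Finset J) {Γ : J → (W → Bool) → ℂ}
    (h : ∀ j ∈ s, DependsOff ι (Γ j)) : DependsOff ι fun w => ∏ j ∈ s, Γ j w :=
  fun x y hxy => Finset.prod_congr rfl fun j hj => h j hj x y hxy

theorem dependsOff_comp {ι : A ↪ W} {V M : Type} (f : V → W) (hf : ∀ v, f v ∉ Set.range ι)
    (Γ : (V → Bool) → M) : DependsOff ι fun w => Γ fun v => w (f v) :=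
  fun _ _ hxy => congrArg Γ (funext fun v => hxy _ (hf v))

variable [Fintype A] [DecidableEq A] [Fintype W] [DecidableEq W]

instance : Fintype (RestWires ι) := Fintype.ofFinite _

theorem sum_glue (f : (W → Bool) → ℂ) :
    ∑ w, f w = ∑ y, ∑ g, f (glue ι y g) := by
  rw [← Fintype.sum_prod_type (f := fun p : (A → Bool) × (RestWires ι → Bool) =>
    f (glue ι p.1 p.2))]
  exact (Fintype.sum_bijective _ (glue_bijective ι) _ _ fun _ => rfl).symm

/-- The value of a product state after an operator on one of the factors. -/
theorem onWires_mulVec_of_dependsOff (M : Matrix (A → Bool) (A → Bool) ℂ)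
    (φ : (A → Bool) → ℂ) {Γ : (W → Bool) → ℂ} (h : DependsOff ι Γ) :
    onWires ι M *ᵥ (fun x => φ (fun i => x (ι i)) * Γ x) =
      fun x => (M *ᵥ φ) (fun i => x (ι i)) * Γ x :=
  onWires_mulVec_mul ι M φ Γ fun z x => h.extend z x

end Glue

/-! ### The channel of a circuit -/

section Channels

variable {A B I J : Type} [Fintype A] [DecidableEq A] [Fintype B] [DecidableEq B] [Fintype I]
  [Fintype J]

omit [Fintype B] [DecidableEq B] in
theorem QCircuit.initIso_ket (C : QCircuit A B) (a : A → Bool) :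
    C.initIso *ᵥ ket a = ket (Function.extend C.inp a (zeros C.W)) := by
  classical
  funext w
  have hiff : ((∀ i, w (C.inp i) = a i) ∧ ∀ j, j ∉ Set.range C.inp → w j = false) ↔
      w = Function.extend C.inp a (zeros C.W) := by
    rw [eq_comm (a := w), extend_eq_iff]
    exact ⟨fun h => ⟨fun w hw => (h.2 w hw).symm, funext fun i => (h.1 i).symm⟩,
      fun h => ⟨fun i => (congrFun h.2 i).symm, fun w hw => (h.1 w hw).symm⟩⟩
  rw [mulVec_ket, ket_apply, initIso, Matrix.of_apply]
  by_cases h : w = Function.extend C.inp a (zeros C.W)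
  · rw [if_pos h]
    exact if_pos (hiff.2 h)
  · rw [if_neg h]
    exact if_neg fun h' => h (hiff.1 h')

-- The two assignments that enter the partial trace share their part `g` on the discarded wires.
omit [Fintype A] [DecidableEq A] in
theorem QCircuit.traceOut_apply (C : QCircuit A B) (σ : Matrix (C.W → Bool) (C.W → Bool) ℂ)
    (y y' : B → Bool) :
    C.traceOut σ y y' = ∑ g : RestWires C.out → Bool, σ (glue C.out y g) (glue C.out y' g) := by
  classical
  have h : ∀ (z z' : B → Bool) (g g' : RestWires C.out → Bool),
      ((∀ i, glue C.out z g (C.out i) = y i) ∧ (∀ i, glue C.out z' g' (C.out i) = y' i) ∧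
        ∀ j, j ∉ Set.range C.out → glue C.out z g j = glue C.out z' g' j) ↔
          y = z ∧ y' = z' ∧ g = g' := by
    intro z z' g g'
    simp only [glue_emb]
    refine and_congr ⟨fun h => (funext h).symm, fun h i => congrFun h.symm i⟩
      (and_congr ⟨fun h => (funext h).symm, fun h i => congrFun h.symm i⟩ ⟨fun h => ?_, fun h => ?_⟩)
    · funext w
      simpa [glue_off C.out _ _ w.2] using h w.1 w.2
    · subst h
      intro j hj
      rw [glue_off C.out _ _ hj, glue_off C.out _ _ hj]
  rw [traceOut, Matrix.of_apply, sum_glue C.out, Finset.sum_congr rfl fun z _ =>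
    Finset.sum_congr rfl fun g _ => sum_glue C.out _]
  simp only [h]
  rw [Finset.sum_eq_single y]
  · refine Finset.sum_congr rfl fun g _ => ?_
    rw [Finset.sum_eq_single y']
    · simp
    · intro z _ hz
      simp [hz.symm]
    · simp
  · intro z _ hz
    simp [hz.symm]
  · simp

/-- The vectors produced by the unitary part of a circuit from given input vectors. -/
def QCircuit.outVec (C : QCircuit A B) (X : Matrix (A → Bool) I ℂ) : Matrix (C.W → Bool) I ℂ :=
  C.unitary * C.initIso * X

omit [Fintype B] [DecidableEq B] in
theorem QCircuit.run_conj (C : QCircuit A B) (X : Matrix (A → Bool) I ℂ) (ρ : Matrix I I ℂ) :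
    C.run (X * ρ * Xᴴ) = C.traceOut (C.outVec X * ρ * (C.outVec X)ᴴ) := by
  simp only [run, outVec, Matrix.conjTranspose_mul, Matrix.mul_assoc]

omit [Fintype J] in
theorem conj_apply (Y : Matrix J I ℂ) (ρ : Matrix I I ℂ) (a b : J) :
    (Y * ρ * Yᴴ) a b = ∑ i, ∑ i', Y a i * ρ i i' * star (Y b i') := by
  simp only [Matrix.mul_apply, Matrix.conjTranspose_apply, Finset.sum_mul]
  exact Finset.sum_comm

omit [Fintype B] [DecidableEq B] in
theorem QCircuit.initIso_isometry (C : QCircuit A B) : C.initIsoᴴ * C.initIso = 1 := by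
  classical
  refine matrix_ext_ket fun x => ?_
  rw [← Matrix.mulVec_mulVec, initIso_ket, Matrix.one_mulVec]
  funext y
  have : (C.initIsoᴴ *ᵥ ket (Function.extend C.inp x (zeros C.W))) y =
      star ((C.initIso *ᵥ ket y) (Function.extend C.inp x (zeros C.W))) := by
    rw [mulVec_ket, mulVec_ket, Matrix.conjTranspose_apply]
  rw [this, initIso_ket, ket_apply, ket_apply]
  by_cases h : y = x
  · simp [h]
  · rw [if_neg h, if_neg, star_zero]
    exact fun h' => h (extend_injective_left C.inp _ h').symm

omit [Fintype B] [DecidableEq B] [Fintype I] in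
theorem QCircuit.outVec_isometry [DecidableEq I] (C : QCircuit A B) (X : Matrix (A → Bool) I ℂ)
    (hX : Xᴴ * X = 1) : (C.outVec X)ᴴ * C.outVec X = 1 := by
  rw [outVec, unitary_eq]
  calc _ = Xᴴ * (C.initIsoᴴ * ((gatesMatrix C.gates)ᴴ * gatesMatrix C.gates) * C.initIso) * X := by
        simp only [Matrix.conjTranspose_mul, Matrix.mul_assoc]
    _ = 1 := by
        rw [gatesMatrix_conjTranspose_mul_self, Matrix.mul_one, initIso_isometry, Matrix.mul_one,
          hX]

/-- A circuit whose output vectors are products of vectors of the output wires and a fixed vector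
of the other wires. -/
theorem QCircuit.run_of_outVec_eq_mul [DecidableEq I] (C : QCircuit A B)
    {X : Matrix (A → Bool) I ℂ} {Y : Matrix (B → Bool) I ℂ} (hX : Xᴴ * X = 1) (hY : Yᴴ * Y = 1)
    (Γ : (C.W → Bool) → ℂ) (hΓ : DependsOff C.out Γ)
    (h : ∀ w i, C.outVec X w i = Y (fun b => w (C.out b)) i * Γ w) (ρ : Matrix I I ℂ) :
    C.run (X * ρ * Xᴴ) = Y * ρ * Yᴴ := by
  have hg : ∀ y y' g, Γ (glue C.out y g) = Γ (glue C.out y' g) := fun y y' g =>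
    hΓ _ _ fun w hw => by rw [glue_off _ _ _ hw, glue_off _ _ _ hw]
  -- The squared norm of the discarded vector; it turns out to be one on comparing the norm of one
  -- column before and after the partial trace.
  let c := ∑ g : RestWires C.out → Bool, Γ (glue C.out (zeros B) g) *
    star (Γ (glue C.out (zeros B) g))
  have key : ∀ ρ : Matrix I I ℂ, C.run (X * ρ * Xᴴ) = c • (Y * ρ * Yᴴ) := by
    intro ρ
    ext y y'
    rw [run_conj, traceOut_apply, Matrix.smul_apply, smul_eq_mul, Finset.sum_mul]
    refine Finset.sum_congr rfl fun g _ => ?_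
    rw [conj_apply, conj_apply, Finset.mul_sum]
    refine Finset.sum_congr rfl fun i _ => ?_
    rw [Finset.mul_sum]
    refine Finset.sum_congr rfl fun i' _ => ?_
    rw [h, h, hg y (zeros B), hg y' (zeros B)]
    simp only [glue_emb, star_mul']
    ring
  rw [key]
  -- Without any column nothing determines `c`, but then there is only the zero operator.
  rcases isEmpty_or_nonempty I with hI | ⟨⟨i⟩⟩
  · have : ρ = 0 := Subsingleton.elim _ _
    rw [this]
    simp
  · have h1 := congrFun (congrFun (C.outVec_isometry X hX) i) i
    have h2 := congrFun (congrFun hY i) i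
    rw [Matrix.mul_apply, Matrix.one_apply_eq] at h1 h2
    simp only [Matrix.conjTranspose_apply] at h1 h2
    rw [sum_glue C.out] at h1
    have h3 : ∀ y, ∑ g : RestWires C.out → Bool, star (C.outVec X (glue C.out y g) i) *
        C.outVec X (glue C.out y g) i = c * (star (Y y i) * Y y i) := by
      intro y
      rw [Finset.sum_mul]
      refine Finset.sum_congr rfl fun g _ => ?_
      rw [h, hg y (zeros B)]
      simp only [glue_emb, star_mul']
      ring
    simp only [h3] at h1
    rw [← Finset.mul_sum, h2, mul_one] at h1
    rw [h1, one_smul]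

end Channels

/-! ### Dilation of a circuit that implements an isometry -/

section Dilation

variable {K : Type} [Fintype K] [DecidableEq K] {a b : ℕ}

/-- The isometry `|x⟩ ↦ |k⟩|x⟩`. -/
def keyIso (A : Type) [Fintype A] [DecidableEq A] (k : K → Bool) :
    Matrix (K ⊕ A → Bool) (A → Bool) ℂ :=
  Matrix.of fun z x => if z = Sum.elim k x then 1 else 0

omit [Fintype K] [DecidableEq K] in
theorem sum_elim_eq_iff {A : Type} (k : K → Bool) (x : A → Bool) (z : K ⊕ A → Bool) :
    z = Sum.elim k x ↔ (fun i => z (Sum.inl i)) = k ∧ (fun i => z (Sum.inr i)) = x := by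
  constructor
  · rintro rfl
    exact ⟨rfl, rfl⟩
  · rintro ⟨rfl, rfl⟩
    funext w
    rcases w with w | w <;> rfl

theorem keyIso_ket {A : Type} [Fintype A] [DecidableEq A] (k : K → Bool) (x : A → Bool) :
    keyIso A k *ᵥ ket x = ket (Sum.elim k x) := by
  funext z
  rw [mulVec_ket, ket_apply, keyIso, Matrix.of_apply]

theorem withKey_eq {A : Type} [Fintype A] [DecidableEq A] (k : K → Bool)
    (σ : Matrix (A → Bool) (A → Bool) ℂ) : withKey k σ = keyIso A k * σ * (keyIso A k)ᴴ := by
  classical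
  ext z z'
  rw [conj_apply, withKey, Matrix.of_apply]
  have h0 : ∀ (z : K ⊕ A → Bool) x, keyIso A k z x =
      if (fun i => z (Sum.inl i)) = k ∧ (fun i => z (Sum.inr i)) = x then 1 else 0 := fun z x => by
    rw [keyIso, Matrix.of_apply]
    exact if_congr (sum_elim_eq_iff k x z) rfl rfl
  simp only [h0]
  by_cases h : (fun i => z (Sum.inl i)) = k
  · by_cases h' : (fun i => z' (Sum.inl i)) = k
    · simp [h, h']
    · simp [h']
  · simp [h]

theorem keyIso_isometry {A : Type} [Fintype A] [DecidableEq A] (k : K → Bool) :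
    (keyIso A k)ᴴ * keyIso A k = 1 := by
  refine matrix_ext_ket fun x => ?_
  rw [← Matrix.mulVec_mulVec, keyIso_ket, Matrix.one_mulVec]
  funext y
  rw [mulVec_ket, Matrix.conjTranspose_apply, keyIso, Matrix.of_apply, ket_apply]
  by_cases h : y = x
  · simp [h]
  · rw [if_neg h, if_neg, star_zero]
    exact fun h' => h (funext fun a => (congrFun h' (Sum.inr a)).symm)

/-- If a circuit implements the isometry `F`, its unitary part maps `|k⟩|x⟩|0⟩` to the product of
`F|x⟩` and a vector of the discarded wires that does not depend on `x`. -/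
theorem QCircuit.exists_garbage (C : QCircuit (K ⊕ Fin a) (Fin b)) (k : K → Bool)
    (F : Matrix (Qubits b) (Qubits a) ℂ) (hF : Fᴴ * F = 1)
    (hC : ∀ ρ : Matrix (Qubits a) (Qubits a) ℂ, C.run (withKey k ρ) = conjBy F ρ) :
    ∃ γ : (C.W → Bool) → ℂ, DependsOff C.out γ ∧ ∀ x,
      gatesMatrix C.gates *ᵥ ket (Function.extend C.inp (Sum.elim k x) (zeros C.W)) =
        fun w => F (fun i => w (C.out i)) x * γ w := by
  set V := C.outVec (keyIso (Fin a) k) with hV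
  have hVx : ∀ x, gatesMatrix C.gates *ᵥ ket (Function.extend C.inp (Sum.elim k x) (zeros C.W)) =
      fun w => V w x := fun x => by
    funext w
    rw [← mulVec_ket V, hV, outVec, unitary_eq, ← Matrix.mulVec_mulVec, ← Matrix.mulVec_mulVec,
      keyIso_ket, initIso_ket]
  -- The channel identity applied to the matrix unit |x⟩⟨x'|: all inner products between the garbage
  -- parts are known.
  have gram : ∀ y y' x x', ∑ g : RestWires C.out → Bool,
      V (glue C.out y g) x * star (V (glue C.out y' g) x') = F y x * star (F y' x') := by
    intro y y' x x'
    have h1 := congrFun (congrFun (hC (Matrix.single x x' 1)) y) y'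
    rw [withKey_eq, run_conj, traceOut_apply, conjBy, conj_apply] at h1
    simp only [conj_apply, Matrix.single_apply] at h1
    rw [← hV] at h1
    have h2 : ∀ (f g : Qubits a → ℂ), ∑ i, ∑ i', f i * (if x = i ∧ x' = i' then 1 else 0) * g i' =
        f x * g x' := fun f g => by
      rw [Finset.sum_eq_single x, Finset.sum_eq_single x']
      · simp
      · intro i _ hi
        simp [hi.symm]
      · simp
      · intro i _ hi
        simp [hi.symm]
      · simp
    simp only [h2 (fun i => V _ i) (fun i' => star (V _ i')),
      h2 (fun i => F y i) (fun i' => star (F y' i'))] at h1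
    exact h1
  -- A column of an isometry has a nonzero entry; the garbage is normalised by it.
  obtain ⟨y₀, hy₀⟩ : ∃ y, F y (zeros _) ≠ 0 := by
    by_contra! h
    have := congrFun (congrFun hF (zeros _)) (zeros _)
    rw [Matrix.mul_apply, Matrix.one_apply_eq] at this
    simp [h] at this
  set f₀ := F y₀ (zeros _)
  have hs₀ : star f₀ ≠ 0 := star_ne_zero.2 hy₀
  let γ : (RestWires C.out → Bool) → ℂ := fun g => V (glue C.out y₀ g) (zeros _) / f₀
  refine ⟨fun w => γ fun g => w g.1, dependsOff_comp _ (fun v => v.2) γ, fun x => ?_⟩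
  rw [hVx]
  funext w
  obtain ⟨⟨y, g⟩, rfl⟩ := (glue_bijective C.out).2 w
  have h0 : ∀ g : RestWires C.out → Bool, (fun v : RestWires C.out => glue C.out y g v.1) = g :=
    fun g => funext fun v => glue_off C.out y g v.2
  simp only [glue_emb, h0]
  -- The squared distance from the desired product expands into four inner products given by `gram`,
  -- and these cancel; a vanishing sum of squares vanishes term by term.
  have h1 : ∑ g, (V (glue C.out y g) x - F y x * γ g) *
      star (V (glue C.out y g) x - F y x * γ g) = 0 := by
    have e : ∀ g, (V (glue C.out y g) x - F y x * γ g) *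
        star (V (glue C.out y g) x - F y x * γ g) =
          V (glue C.out y g) x * star (V (glue C.out y g) x) -
          (star (F y x) / star f₀) * (V (glue C.out y g) x * star (V (glue C.out y₀ g) (zeros _))) -
          (F y x / f₀) * (V (glue C.out y₀ g) (zeros _) * star (V (glue C.out y g) x)) +
          (F y x * star (F y x) / (f₀ * star f₀)) *
            (V (glue C.out y₀ g) (zeros _) * star (V (glue C.out y₀ g) (zeros _))) := fun g => by
      simp only [γ, star_sub, star_mul', star_div₀]
      field_simp
      ring
    simp only [e, Finset.sum_add_distrib, Finset.sum_sub_distrib, ← Finset.mul_sum, gram]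
    change _ - _ * (_ * star f₀) - _ * (f₀ * _) + _ * (f₀ * star f₀) = 0
    field_simp
    ring
  have h2 : ∀ g ∈ Finset.univ, 0 ≤ (V (glue C.out y g) x - F y x * γ g) *
      star (V (glue C.out y g) x - F y x * γ g) := fun g _ => mul_star_self_nonneg _
  have h3 := (Finset.sum_eq_zero_iff_of_nonneg h2).1 h1 g (Finset.mem_univ g)
  rw [mul_eq_zero, star_eq_zero, or_self, sub_eq_zero] at h3
  exact h3

end Dilation

/-! ### Gates on many disjoint blocks of wires -/

section Blocks

variable {W : Type} [Fintype W] [DecidableEq W]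

/-- States are indexed by the set of blocks already treated, so the order of the blocks plays no
role. -/
theorem gatesMatrix_flatMap {J : Type} [DecidableEq J] (L : List J) (hL : L.Nodup)
    (gs : J → List (QGate W)) (Φ : Finset J → (W → Bool) → ℂ)
    (h : ∀ M j, j ∉ M → gatesMatrix (gs j) *ᵥ Φ M = Φ (insert j M)) (M : Finset J)
    (hM : ∀ j ∈ L, j ∉ M) :
    gatesMatrix (L.flatMap gs) *ᵥ Φ M = Φ (L.toFinset ∪ M) := by
  induction L generalizing M with
  | nil => simp
  | cons j L ih =>
    rw [List.nodup_cons] at hL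
    rw [List.flatMap_cons, gatesMatrix_append, ← Matrix.mulVec_mulVec, h M j (hM j (by simp)),
      ih hL.2]
    · congr 1
      ext x
      simp only [List.toFinset_cons, Finset.mem_union, Finset.mem_insert]
      tauto
    · intro i hi
      rw [Finset.mem_insert, not_or]
      exact ⟨fun h => hL.1 (h ▸ hi), hM i (by simp [hi])⟩

/-- The gates `gs j` for all `j` of a finite type. -/
def allGates {J : Type} [Fintype J] (gs : J → List (QGate W)) : List (QGate W) :=
  (Finset.univ : Finset J).toList.flatMap gs

omit [Fintype W] [DecidableEq W] in
theorem length_allGates {J : Type} [Fintype J] (gs : J → List (QGate W)) (s : ℕ)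
    (h : ∀ j, (gs j).length = s) : (allGates gs).length = Fintype.card J * s := by
  simp [allGates, List.length_flatMap, h]

theorem gatesMatrix_allGates {J : Type} [Fintype J] [DecidableEq J] (gs : J → List (QGate W))
    (Φ : Finset J → (W → Bool) → ℂ)
    (h : ∀ M j, j ∉ M → gatesMatrix (gs j) *ᵥ Φ M = Φ (insert j M)) :
    gatesMatrix (allGates gs) *ᵥ Φ ∅ = Φ Finset.univ := by
  have := gatesMatrix_flatMap Finset.univ.toList (Finset.nodup_toList _) gs Φ h ∅ (by simp)
  simpa [allGates] using this

/-- The block number `i` of an embedded family of blocks of wires. -/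
def blockEmb {J A : Type} (β : J × A ↪ W) (i : J) : A ↪ W :=
  ⟨fun a => β (i, a), fun _ _ h => (Prod.ext_iff.1 (β.injective h)).2⟩

/-- The same gates on each of the blocks act on the factors of a product state. -/
theorem gatesMatrix_blocks {J A : Type} [Fintype J] [DecidableEq J] [Fintype A] [DecidableEq A]
    (β : J × A ↪ W) (l : List (QGate A)) (φ φ' : J → (A → Bool) → ℂ)
    (hφ : ∀ j, gatesMatrix l *ᵥ φ j = φ' j) (Γ : (W → Bool) → ℂ) (hΓ : DependsOff β Γ) :
    gatesMatrix (allGates fun j => l.map (QGate.map (blockEmb β j))) *ᵥ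
        (fun w => (∏ j, φ j fun a => w (β (j, a))) * Γ w) =
      fun w => (∏ j, φ' j fun a => w (β (j, a))) * Γ w := by
  have := gatesMatrix_allGates (fun j => l.map (QGate.map (blockEmb β j)))
    (fun M w => (∏ j, (if j ∈ M then φ' j else φ j) fun a => w (β (j, a))) * Γ w) (by
      intro M j hj
      have hoff : ∀ i, i ≠ j → ∀ a, β (i, a) ∉ Set.range (blockEmb β j) := by
        rintro i hi a ⟨a', ha'⟩
        exact hi (Prod.ext_iff.1 (β.injective ha')).1.symm
      have hdep : DependsOff (blockEmb β j) fun w =>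
          (∏ i ∈ Finset.univ.erase j, (if i ∈ M then φ' i else φ i) fun a => w (β (i, a))) * Γ w := by
        refine DependsOff.mul (DependsOff.prod _ fun i hi => ?_) fun x y hxy => hΓ x y fun w hw => ?_
        · exact dependsOff_comp _ (hoff i (Finset.ne_of_mem_erase hi)) _
        · refine hxy w ?_
          rintro ⟨a, rfl⟩
          exact hw ⟨(j, a), rfl⟩
      have e1 : (fun w => (∏ i, (if i ∈ M then φ' i else φ i) fun a => w (β (i, a))) * Γ w) =
          fun w => φ j (fun a => w (blockEmb β j a)) *
            ((∏ i ∈ Finset.univ.erase j, (if i ∈ M then φ' i else φ i) fun a => w (β (i, a))) *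
              Γ w) := by
        funext w
        rw [← Finset.mul_prod_erase _ _ (Finset.mem_univ j), if_neg hj, mul_assoc]
        rfl
      rw [gatesMatrix_map, e1, onWires_mulVec_of_dependsOff _ _ _ hdep, hφ]
      funext w
      rw [← Finset.mul_prod_erase (a := j) _ _ (Finset.mem_univ j), if_pos (by simp), mul_assoc]
      congr 2
      refine Finset.prod_congr rfl fun i hi => ?_
      have : i ≠ j := Finset.ne_of_mem_erase hi
      simp [this])
  simpa using this

/-- Copying classical bits to wires in the state `|0⟩`. -/
theorem exists_copy_gates {J : Type} [Fintype J] [DecidableEq J] (c : J → W) (d : J ↪ W)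
    (hcd : ∀ j, c j ∉ Set.range d) :
    ∃ l : List (QGate W), l.length = Fintype.card J ∧
      ∀ x : W → Bool, (∀ j, x (d j) = false) →
        gatesMatrix l *ᵥ ket x = ket (Function.extend d (fun j => x (c j)) x) := by
  let ι : J → (Fin 2 ↪ W) := fun j => ⟨![d j, c j], by
    have : d j ≠ c j := fun h => hcd j ⟨j, h⟩
    intro i i'; fin_cases i <;> fin_cases i' <;> simp [this, this.symm]⟩
  have h0 : ∀ j, ι j 0 = d j := fun j => rfl
  have h1 : ∀ j, ι j 1 = c j := fun j => rfl
  refine ⟨allGates fun j => [controlledGate 1 (by omega) (ι j) (fun z => z 0 = true) notGate], ?_,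
    fun x hx => ?_⟩
  · rw [length_allGates _ 1 (fun j => rfl), mul_one]
  · have := gatesMatrix_allGates
      (fun j => [controlledGate 1 (by omega) (ι j) (fun z => z 0 = true) notGate])
      (fun M => ket (Function.extend d (fun j => if j ∈ M then x (c j) else false) x)) (by
        intro M j hj
        classical
        rw [gatesMatrix_singleton, controlledGate_ket, sum_condGate_not]
        congr 1
        funext w
        by_cases hw : w = d j
        · subst hw
          simp only [h0, h1, Fin.succ_zero_eq_one, Function.update_self, extend_apply_emb, hj,
            if_false, extend_apply_off d _ _ (hcd j), Finset.mem_insert_self, if_true]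
          simp
        · rw [h0, Function.update_of_ne hw]
          by_cases hw' : w ∈ Set.range d
          · obtain ⟨i, rfl⟩ := hw'
            have : i ≠ j := fun h => hw (by rw [h])
            simp [extend_apply_emb, this]
          · rw [extend_apply_off d _ _ hw', extend_apply_off d _ _ hw'])
    have e : Function.extend d (fun j => if j ∈ (∅ : Finset J) then x (c j) else false) x = x := by
      rw [extend_eq_iff]
      exact ⟨fun _ _ => rfl, funext fun j => by simp [hx]⟩
    rw [e] at this
    simpa using this

end Blocks

/-! ### Symmetric powers of matrices -/

section SymPow

variable {I J L : Type} [Fintype I] [DecidableEq I] [Fintype J] [DecidableEq J] [Fintype L]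
  [DecidableEq L] {t : ℕ}

omit [Fintype I] [DecidableEq I] in
theorem typeOf_comp_perm (v : Fin t → I) (σ : Equiv.Perm (Fin t)) : typeOf (v ∘ σ) = typeOf v := by
  refine Subtype.ext ?_
  change Multiset.map (v ∘ σ) Finset.univ.val = Multiset.map v Finset.univ.val
  rw [← Multiset.map_map]
  congr 1
  exact Multiset.map_univ_val_equiv σ

omit [Fintype I] in
theorem exists_perm_of_typeOf_eq {v w : Fin t → I} (h : typeOf v = typeOf w) :
    ∃ σ : Equiv.Perm (Fin t), v = w ∘ σ := by
  have e : ∀ x, Nonempty ({a // v a = x} ≃ {a // w a = x}) := fun x => by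
    refine ⟨Fintype.equivOfCardEq ?_⟩
    rw [Fintype.card_subtype, Fintype.card_subtype]
    exact card_filter_eq_of_typeOf_eq h x
  exact ⟨Equiv.ofFiberEquiv fun x => (e x).some, funext fun a => (Equiv.ofFiberEquiv_map _ a).symm⟩

omit [Fintype I] [DecidableEq I] in
theorem typeOf_surjective : Function.Surjective (typeOf : (Fin t → I) → Sym I t) := by
  intro T
  obtain ⟨l, hl⟩ := Quot.exists_rep T.1
  have hlen : l.length = t := by
    have := T.2
    rw [← hl] at this
    exact this
  subst hlen
  refine ⟨l.get, Subtype.ext ?_⟩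
  rw [← hl]
  change Multiset.map l.get Finset.univ.val = (l : Multiset I)
  simp [Fin.univ_def]

theorem typeCard_ne_zero (T : Sym I t) : typeCard T ≠ 0 := by
  obtain ⟨v, rfl⟩ := typeOf_surjective T
  exact (typeCard_pos v).ne'

theorem schurSym_isometry : (schurSym I t)ᴴ * schurSym I t = 1 := by
  ext T T'
  rw [Matrix.mul_apply, Matrix.one_apply]
  simp only [Matrix.conjTranspose_apply, schurSym_apply]
  by_cases h : T = T'
  · subst h
    rw [if_pos rfl]
    have h1 : ∀ v : Fin t → I, star (if typeOf v = T then ((1 / √(typeCard T : ℝ) : ℝ) : ℂ) else 0) *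
        (if typeOf v = T then ((1 / √(typeCard T : ℝ) : ℝ) : ℂ) else 0) =
        if typeOf v = T then ((1 / (typeCard T : ℝ) : ℝ) : ℂ) else 0 := by
      intro v
      split_ifs
      · rw [Complex.star_def, Complex.conj_ofReal, ← Complex.ofReal_mul, div_mul_div_comm, one_mul,
          Real.mul_self_sqrt (Nat.cast_nonneg _)]
      · simp
    simp only [h1, ← Finset.sum_filter, Finset.sum_const, nsmul_eq_mul]
    change ((typeCard T : ℕ) : ℂ) * _ = 1
    have := typeCard_ne_zero T
    push_cast
    field_simp
  · rw [if_neg h]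
    refine Finset.sum_eq_zero fun v _ => ?_
    by_cases h1 : typeOf v = T
    · rw [if_neg (c := typeOf v = T') (fun h2 => h (h1.symm.trans h2)), mul_zero]
    · rw [if_neg h1, star_zero, zero_mul]

theorem schurSym_mul_conjTranspose_apply (v w : Fin t → I) :
    (schurSym I t * (schurSym I t)ᴴ) v w =
      if typeOf w = typeOf v then ((1 / (typeCard (typeOf v) : ℝ) : ℝ) : ℂ) else 0 := by
  rw [Matrix.mul_apply]
  simp only [Matrix.conjTranspose_apply, schurSym_apply]
  rw [Finset.sum_eq_single (typeOf v)]
  · rw [if_pos rfl]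
    split_ifs
    · rw [Complex.star_def, Complex.conj_ofReal, ← Complex.ofReal_mul, div_mul_div_comm, one_mul,
          Real.mul_self_sqrt (Nat.cast_nonneg _)]
    · simp
  · intro T _ hT
    rw [if_neg hT.symm, zero_mul]
  · simp

/-- Matrices whose columns are symmetric tensors are fixed by the projection onto the symmetric
subspace. -/
theorem schurSym_mul_conjTranspose_mul {K : Type} (X : Matrix (Fin t → I) K ℂ)
    (hX : ∀ v w k, typeOf v = typeOf w → X v k = X w k) :
    schurSym I t * ((schurSym I t)ᴴ * X) = X := by
  ext v k
  rw [← Matrix.mul_assoc, Matrix.mul_apply]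
  simp only [schurSym_mul_conjTranspose_apply, ite_mul, zero_mul, ← Finset.sum_filter]
  rw [Finset.sum_congr rfl fun w hw => by rw [hX w v k (Finset.mem_filter.1 hw).2], Finset.sum_const,
    nsmul_eq_mul]
  change ((typeCard (typeOf v) : ℕ) : ℂ) * _ = _
  have := typeCard_ne_zero (typeOf v)
  push_cast
  field_simp

omit [DecidableEq I] [Fintype J] [DecidableEq J] [Fintype L] [DecidableEq L] in
theorem tensorPow_mul (A : Matrix J I ℂ) (B : Matrix I L ℂ) :
    tensorPow t (A * B) = tensorPow t A * tensorPow t B := by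
  ext y x
  simp only [tensorPow, Matrix.mul_apply, Matrix.of_apply, Finset.prod_univ_sum,
    Fintype.piFinset_univ, Finset.prod_mul_distrib]

omit [Fintype I] in
theorem tensorPow_one : tensorPow t (1 : Matrix I I ℂ) = 1 := by
  ext y x
  rw [tensorPow, Matrix.of_apply, Matrix.one_apply]
  by_cases h : y = x
  · simp [h, Matrix.one_apply]
  · rw [if_neg h]
    obtain ⟨i, hi⟩ := Function.ne_iff.1 h
    exact Finset.prod_eq_zero (Finset.mem_univ i) (Matrix.one_apply_ne hi)

omit [Fintype I] [DecidableEq I] [Fintype J] [DecidableEq J] in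
theorem tensorPow_conjTranspose (A : Matrix J I ℂ) : (tensorPow t A)ᴴ = tensorPow t Aᴴ := by
  ext y x
  simp [tensorPow, Matrix.conjTranspose_apply]

/-- The action of `V^{⊗t}` on the symmetric subspace, in the basis of the type states. -/
def symPow (t : ℕ) (V : Matrix J I ℂ) : Matrix (Sym J t) (Sym I t) ℂ :=
  (schurSym J t)ᴴ * tensorPow t V * schurSym I t

/-- V^{⊗t} commutes with permuting the tensor factors, so the image of a type state is again
symmetric and the projection onto the symmetric subspace does nothing. The algebra of `symPow` and
the reversibility of the last encryption step depend on this. -/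
theorem schurSym_mul_symPow (V : Matrix J I ℂ) :
    schurSym J t * symPow t V = tensorPow t V * schurSym I t := by
  rw [symPow, Matrix.mul_assoc]
  refine schurSym_mul_conjTranspose_mul _ fun y y' T h => ?_
  obtain ⟨σ, rfl⟩ := exists_perm_of_typeOf_eq h
  rw [Matrix.mul_apply, Matrix.mul_apply]
  refine Fintype.sum_equiv (Equiv.arrowCongr σ (Equiv.refl I)) _ _ fun v => ?_
  have e : (Equiv.arrowCongr σ (Equiv.refl I)) v = v ∘ σ.symm := rfl
  rw [e, schurSym_apply, schurSym_apply, typeOf_comp_perm v σ.symm, tensorPow, Matrix.of_apply,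
    Matrix.of_apply]
  congr 1
  exact Fintype.prod_equiv σ _ _ fun i => by simp

theorem symPow_mul (A : Matrix J I ℂ) (B : Matrix I L ℂ) :
    symPow t (A * B) = symPow t A * symPow t B := by
  rw [symPow, tensorPow_mul, Matrix.mul_assoc, Matrix.mul_assoc, ← schurSym_mul_symPow,
    ← Matrix.mul_assoc, ← Matrix.mul_assoc]
  rfl

theorem symPow_one : symPow t (1 : Matrix I I ℂ) = 1 := by
  rw [symPow, tensorPow_one, Matrix.mul_one, schurSym_isometry]

theorem symPow_conjTranspose (A : Matrix J I ℂ) : (symPow t A)ᴴ = symPow t Aᴴ := by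
  rw [symPow, symPow, Matrix.conjTranspose_mul, Matrix.conjTranspose_mul,
    Matrix.conjTranspose_conjTranspose, tensorPow_conjTranspose, Matrix.mul_assoc]

theorem symPow_isometry (V : Matrix J I ℂ) (hV : Vᴴ * V = 1) :
    (symPow t V)ᴴ * symPow t V = 1 := by
  rw [symPow_conjTranspose, ← symPow_mul, hV, symPow_one]

/-- The isometry onto the span of some of the basis vectors. -/
def selectIso {d : Type} [Fintype d] [DecidableEq d] (e : d ↪ J) : Matrix J d ℂ :=
  (1 : Matrix J J ℂ).submatrix id e

theorem selectIso_isometry {d : Type} [Fintype d] [DecidableEq d] (e : d ↪ J) :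
    (selectIso e)ᴴ * selectIso e = 1 := by
  ext i j
  simp [selectIso, Matrix.mul_apply, Matrix.one_apply, e.injective.eq_iff, eq_comm]

omit [Fintype I] [DecidableEq I] in
theorem mul_selectIso {d : Type} [Fintype d] [DecidableEq d] (e : d ↪ J) (M : Matrix I J ℂ) :
    M * selectIso e = M.submatrix id e := by
  ext i j
  simp [selectIso, Matrix.mul_apply, Matrix.one_apply]

omit [DecidableEq J] in
theorem mul_isometry {K : Type} [Fintype K] [DecidableEq K] {A : Matrix J I ℂ} {B : Matrix I K ℂ}
    (hA : Aᴴ * A = 1) (hB : Bᴴ * B = 1) : (A * B)ᴴ * (A * B) = 1 := by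
  rw [Matrix.conjTranspose_mul, Matrix.mul_assoc, ← Matrix.mul_assoc Aᴴ, hA, Matrix.one_mul, hB]

end SymPow

/-! ### Stored states -/

theorem QSystem.storeIso_isometry (X : QSystem) : X.storeIsoᴴ * X.storeIso = 1 := by
  ext i j
  simp [storeIso, Matrix.mul_apply, Matrix.one_apply, Matrix.conjTranspose_apply,
    X.code.injective.eq_iff, eq_comm]

theorem QSystem.storeIso_apply (X : QSystem) (x : X.Wire → Bool) (i : X.Idx) :
    X.storeIso x i = ket (X.code i) x := by
  rw [storeIso, Matrix.of_apply, ket_apply]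
  exact if_congr eq_comm rfl rfl

section Registers

variable {A W : Type}

open Classical in
/-- The indicator function of agreement with `x` outside the wires `ι`. -/
def offKet (ι : A ↪ W) (x : W → Bool) : (W → Bool) → ℂ :=
  fun w => if ∀ v, v ∉ Set.range ι → x v = w v then 1 else 0

theorem dependsOff_offKet (ι : A ↪ W) (x : W → Bool) : DependsOff ι (offKet ι x) := by
  intro y y' h
  classical
  exact if_congr (forall_congr' fun v => forall_congr' fun hv => by rw [h v hv]) rfl rfl

variable [Fintype A] [DecidableEq A] [Fintype W] [DecidableEq W]

/-- Kets factor into a part on the chosen wires and an indicator on the others, which is the shape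
required by `onWires_mulVec_of_dependsOff`. -/
theorem ket_extend (ι : A ↪ W) (y : A → Bool) (x w : W → Bool) :
    ket (Function.extend ι y x) w = ket y (fun a => w (ι a)) * offKet ι x w := by
  classical
  rw [ket_apply, ket_apply, if_congr (eq_comm.trans (extend_eq_iff ι y x w)) rfl rfl, offKet]
  by_cases h : y = fun a => w (ι a) <;> by_cases h' : ∀ v, v ∉ Set.range ι → x v = w v
  · rw [if_pos ⟨h', h⟩, if_pos h.symm, if_pos h', one_mul]
  · rw [if_neg fun h1 => h' h1.1, if_neg h', mul_zero]
  · rw [if_neg fun h1 => h h1.2, if_neg fun h1 => h h1.symm, zero_mul]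
  · rw [if_neg fun h1 => h h1.2, if_neg fun h1 => h h1.symm, zero_mul]

/-- The isometry that stores a superposition of types in qubits. -/
def typeIso (N t : ℕ) : Matrix (Fin t × Fin N → Bool) (Sym (Qubits N) t) ℂ :=
  (typeSystem N t).storeIso

theorem typeIso_isometry (N t : ℕ) : (typeIso N t)ᴴ * typeIso N t = 1 :=
  (typeSystem N t).storeIso_isometry

theorem typeIso_apply {N t : ℕ} (x : Fin t × Fin N → Bool) (T : Sym (Qubits N) t) :
    typeIso N t x T = ket (typeAssign T) x :=
  (typeSystem N t).storeIso_apply x T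

theorem store_typeSystem_conjBy {N t : ℕ} {I : Type} [Fintype I]
    (M : Matrix (Sym (Qubits N) t) I ℂ) (ρ : Matrix I I ℂ) :
    (typeSystem N t).store (conjBy M ρ) = (typeIso N t * M) * ρ * (typeIso N t * M)ᴴ := by
  have h : (typeSystem N t).store (conjBy M ρ) = typeIso N t * (M * ρ * Mᴴ) * (typeIso N t)ᴴ := rfl
  rw [h, Matrix.conjTranspose_mul]
  simp only [Matrix.mul_assoc]
  rfl

theorem store_coordSubspace {N t d : ℕ} (e : Fin d ↪ Sym (Qubits N) t)
    (ρ : Matrix (Fin d) (Fin d) ℂ) : ((typeSystem N t).coordSubspace e).store ρ =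
      (typeIso N t * selectIso e) * ρ * (typeIso N t * selectIso e)ᴴ := by
  rw [mul_selectIso]
  rfl

/-- A stored superposition of types turns into a superposition of type states. -/
theorem gatesMatrix_schur {t N : ℕ} {R : Type} [Fintype R] [DecidableEq R]
    (l : List (QGate ((Fin t × Fin N) ⊕ R)))
    (hl : ∀ T, gatesMatrix l *ᵥ ket (Sum.elim (typeAssign T) (zeros R)) =
      addZeros (Fin t × Fin N) R *ᵥ typeVec T)
    (ι : (Fin t × Fin N) ⊕ R ↪ W) (c : Sym (Qubits N) t → ℂ) (Γ : (W → Bool) → ℂ)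
    (hΓ : DependsOff ι Γ) :
    gatesMatrix (l.map (QGate.map ι)) *ᵥ (fun w =>
        (typeIso N t *ᵥ c) (fun p => w (ι (Sum.inl p))) *
          ket (zeros R) (fun r => w (ι (Sum.inr r))) * Γ w) =
      fun w => (schurSym (Qubits N) t *ᵥ c) (fun i j => w (ι (Sum.inl (i, j)))) *
          ket (zeros R) (fun r => w (ι (Sum.inr r))) * Γ w := by
  rw [gatesMatrix_map]
  refine (onWires_mulVec_of_dependsOff ι (gatesMatrix l) (fun z =>
    (typeIso N t *ᵥ c) (fun p => z (Sum.inl p)) *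
      ket (zeros R) (fun r => z (Sum.inr r))) hΓ).trans ?_
  have h1 : (fun z : (Fin t × Fin N) ⊕ R → Bool =>
      (typeIso N t *ᵥ c) (fun p => z (Sum.inl p)) *
        ket (zeros R) (fun r => z (Sum.inr r))) =
      ∑ T, c T • ket (Sum.elim (typeAssign T) (zeros R)) := by
    funext z
    rw [Finset.sum_apply]
    refine (Finset.sum_mul _ _ _).trans ?_
    refine Finset.sum_congr rfl fun T _ => ?_
    rw [← addZeros_ket, Pi.smul_apply, addZeros_mulVec, smul_eq_mul]
    refine (congrArg (fun z => z * c T * _) (typeIso_apply _ _)).trans ?_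
    exact (congrArg (· * _) (mul_comm _ _)).trans (mul_assoc _ _ _)
  rw [h1, mulVec_sum_smul]
  funext w
  congr 1
  rw [Finset.sum_apply]
  refine Eq.trans ?_ (Finset.sum_mul _ _ _).symm
  refine Finset.sum_congr rfl fun T _ => ?_
  rw [hl, Pi.smul_apply, addZeros_mulVec, smul_eq_mul]
  change _ = schurSym (Qubits N) t _ T * c T * _
  rw [mul_comm (schurSym _ _ _ _), mul_assoc]
  rfl

end Registers

/-! ### Parallel copies of a keyed circuit -/

section Parallel

variable {κ a b t : ℕ} {W : Type} [Fintype W] [DecidableEq W]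

/-- The indicator function of a key `k` in the key wires and of zeros in the ancilla wires of a
circuit. -/
def QCircuit.keyKet (C : QCircuit (Fin κ ⊕ Fin a) (Fin b)) (k : Qubits κ) : (C.W → Bool) → ℂ :=
  offKet (Function.Embedding.inr.trans C.inp)
    (Function.extend C.inp (Sum.elim k (zeros (Fin a))) (zeros C.W))

theorem QCircuit.extend_inp (C : QCircuit (Fin κ ⊕ Fin a) (Fin b)) (k : Qubits κ) (x : Qubits a) :
    Function.extend C.inp (Sum.elim k x) (zeros C.W) =
      Function.extend (Function.Embedding.inr.trans C.inp) x
        (Function.extend C.inp (Sum.elim k (zeros (Fin a))) (zeros C.W)) := by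
  rw [extend_eq_iff]
  constructor
  · intro w hw
    rw [extend_apply_off _ _ _ fun ⟨i, hi⟩ => hw ⟨Sum.inr i, hi⟩, extend_apply_off _ _ _ hw]
  · funext i
    rcases i with i | i
    · rw [extend_apply_off, extend_apply_emb]
      · rfl
      · rintro ⟨j, hj⟩
        cases C.inp.injective hj
    · exact (extend_apply_emb (Function.Embedding.inr.trans C.inp) x _ i).symm

theorem QCircuit.ket_extend_inp (C : QCircuit (Fin κ ⊕ Fin a) (Fin b)) (k : Qubits κ)
    (x : Qubits a) (w : C.W → Bool) :
    ket (Function.extend C.inp (Sum.elim k x) (zeros C.W)) w =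
      ket x (fun i => w (C.inp (Sum.inr i))) * C.keyKet k w := by
  rw [C.extend_inp, ket_extend]
  rfl

/-- The gates of a circuit for the isometry `F` on each of `t` blocks of wires implement
`F^{⊗t}`. -/
theorem QCircuit.gatesMatrix_parallel (C : QCircuit (Fin κ ⊕ Fin a) (Fin b)) (k : Qubits κ)
    (F : Matrix (Qubits b) (Qubits a) ℂ) (γ : (C.W → Bool) → ℂ)
    (hγ : ∀ x, gatesMatrix C.gates *ᵥ ket (Function.extend C.inp (Sum.elim k x) (zeros C.W)) =
        fun w => F (fun i => w (C.out i)) x * γ w)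
    (β : Fin t × C.W ↪ W) (c : (Fin t → Qubits a) → ℂ) (Γ : (W → Bool) → ℂ)
    (hΓ : DependsOff β Γ) :
    gatesMatrix (allGates fun j => C.gates.map (QGate.map (blockEmb β j))) *ᵥ
        (fun w => c (fun i j => w (β (i, C.inp (Sum.inr j)))) *
          (∏ i, C.keyKet k fun v => w (β (i, v))) * Γ w) =
      fun w => (tensorPow t F *ᵥ c) (fun i j => w (β (i, C.out j))) *
          (∏ i, γ fun v => w (β (i, v))) * Γ w := by
  -- Expansion into basis tuples: each of them is a product over the blocks, to which
  -- `gatesMatrix_blocks` applies.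
  have h1 : (fun w : W → Bool => c (fun i j => w (β (i, C.inp (Sum.inr j)))) *
      (∏ i, C.keyKet k fun v => w (β (i, v))) * Γ w) =
      ∑ v : Fin t → Qubits a, c v • fun w : W → Bool => (∏ i,
        ket (Function.extend C.inp (Sum.elim k (v i)) (zeros C.W)) fun u => w (β (i, u))) * Γ w := by
    funext w
    rw [Finset.sum_apply]
    simp only [C.ket_extend_inp, Finset.prod_mul_distrib, Pi.smul_apply, smul_eq_mul]
    rw [Finset.sum_eq_single fun i j => w (β (i, C.inp (Sum.inr j)))]
    · simp [ket_apply, mul_assoc]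
    · intro v _ hv
      obtain ⟨i, hi⟩ := Function.ne_iff.1 hv
      rw [Finset.prod_eq_zero (Finset.mem_univ i)]
      · simp
      · rw [ket_apply, if_neg fun h => hi h.symm]
    · simp
  rw [h1, mulVec_sum_smul]
  funext w
  rw [Finset.sum_apply, Matrix.mulVec, dotProduct, mul_assoc, Finset.sum_mul]
  refine Finset.sum_congr rfl fun v _ => ?_
  rw [Pi.smul_apply, smul_eq_mul,
    gatesMatrix_blocks β C.gates _ (fun i w => F (fun i => w (C.out i)) (v i) * γ w)
      (fun j => hγ (v j)) Γ hΓ, tensorPow, Matrix.of_apply]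
  refine (congrArg (fun z => c v * (z * Γ w)) Finset.prod_mul_distrib).trans ?_
  ring

/-- Loading an input and copying some of its bits, a key, to further wires. -/
theorem exists_load_gates {A J : Type} [Fintype A] [DecidableEq A] [Fintype J] [DecidableEq J]
    (inp : Fin κ ⊕ A ↪ W) (s : J → Fin κ) (d : J ↪ W) (hd : ∀ i j, inp i ≠ d j) :
    ∃ l : List (QGate W), l.length = Fintype.card J ∧ ∀ (k : Qubits κ) (φ : (A → Bool) → ℂ),
      gatesMatrix l *ᵥ (∑ x, φ x • ket (Function.extend inp (Sum.elim k x) (zeros W))) =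
        fun w => φ (fun i => w (inp (Sum.inr i))) *
          offKet (Function.Embedding.inr.trans inp) (Function.extend d (fun j => k (s j))
            (Function.extend inp (Sum.elim k (zeros A)) (zeros W))) w := by
  obtain ⟨l, hl, hl'⟩ := exists_copy_gates (fun j => inp (Sum.inl (s j))) d
    (by rintro j ⟨i, hi⟩; exact hd _ _ hi.symm)
  refine ⟨l, hl, fun k φ => ?_⟩
  have h : ∀ x : A → Bool, gatesMatrix l *ᵥ ket (Function.extend inp (Sum.elim k x) (zeros W)) =
      ket (Function.extend (Function.Embedding.inr.trans inp) x
        (Function.extend d (fun j => k (s j))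
            (Function.extend inp (Sum.elim k (zeros A)) (zeros W)))) := fun x => by
    rw [hl' _ fun j => extend_apply_off _ _ _ (by rintro ⟨i, hi⟩; exact hd _ _ hi)]
    congr 1
    rw [extend_eq_iff]
    have hoff : ∀ j, d j ∉ Set.range (Function.Embedding.inr.trans inp) := by
      rintro j ⟨i, hi⟩
      exact hd _ _ hi
    constructor
    · intro w hw
      by_cases hw' : w ∈ Set.range inp
      · obtain ⟨i | i, rfl⟩ := hw'
        · rw [extend_apply_emb, extend_apply_off _ _ _, extend_apply_off _ _ _ hw,
            extend_apply_emb]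
          · rfl
          · rintro ⟨j, hj⟩
            cases inp.injective hj
        · rw [extend_apply_emb]
          exact (extend_apply_emb (Function.Embedding.inr.trans inp) x _ i).symm
      · rw [extend_apply_off inp _ _ hw',
          extend_apply_off (Function.Embedding.inr.trans inp) _ _ fun ⟨i, hi⟩ => hw' ⟨_, hi⟩,
          extend_apply_off d _ _ hw, extend_apply_off inp _ _ hw']
    · funext j
      rw [extend_apply_off _ _ _ (hoff j), extend_apply_emb, extend_apply_emb]
      rfl
  rw [mulVec_sum_smul]
  funext w
  rw [Finset.sum_apply, Finset.sum_eq_single fun i => w (inp (Sum.inr i))]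
  · rw [h, Pi.smul_apply, smul_eq_mul, ket_extend, ket_apply]
    refine congrArg _ ((congrArg (· * _) (if_pos rfl)).trans (one_mul _))
  · intro x _ hx
    rw [h, Pi.smul_apply, smul_eq_mul, ket_extend, ket_apply, if_neg fun h => hx h.symm]
    simp
  · simp

end Parallel

/-! ### Embeddings of wires and factorisation of indicator vectors -/

section Emb

/-- Two disjoint sets of wires. -/
def sumEmb {A B W : Type} (f : A ↪ W) (g : B ↪ W) (h : ∀ a b, f a ≠ g b) : A ⊕ B ↪ W :=
  ⟨Sum.elim f g, f.injective.sumElim g.injective h⟩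

/-- The input wires of `t` copies of a circuit that takes a key as a part of its input. -/
def QCircuit.dataEmb {κ a b : ℕ} (C : QCircuit (Fin κ ⊕ Fin a) (Fin b)) (t : ℕ) :
    Fin t × Fin a ↪ Fin t × C.W :=
  (Function.Embedding.refl _).prodMap (Function.Embedding.inr.trans C.inp)

/-- The key wires of `t` copies of a circuit. -/
def QCircuit.keyEmb {κ a b : ℕ} (C : QCircuit (Fin κ ⊕ Fin a) (Fin b)) (t : ℕ) :
    Fin t × Fin κ ↪ Fin t × C.W :=
  (Function.Embedding.refl _).prodMap (Function.Embedding.inl.trans C.inp)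

/-- The output wires of `t` copies of a circuit. -/
def QCircuit.outEmb {A B : Type} (C : QCircuit A B) (t : ℕ) : Fin t × B ↪ Fin t × C.W :=
  (Function.Embedding.refl _).prodMap C.out

theorem extend_key_zeros {K A W : Type} (inp : K ⊕ A ↪ W) (k : K → Bool) :
    Function.extend inp (Sum.elim k (zeros A)) (zeros W) =
      Function.extend (Function.Embedding.inl.trans inp) k (zeros W) := by
  rw [extend_eq_iff]
  constructor
  · intro w hw
    rw [extend_apply_off _ _ _ fun ⟨i, hi⟩ => hw ⟨Sum.inl i, hi⟩]
  · funext i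
    rcases i with i | i
    · exact (extend_apply_emb (Function.Embedding.inl.trans inp) k _ i).symm
    · rw [extend_apply_off]
      · rfl
      · rintro ⟨j, hj⟩
        cases inp.injective hj

theorem boole_eq_mul {P Q R : Prop} {_ : Decidable P} {_ : Decidable Q} {_ : Decidable R}
    (h : P ↔ Q ∧ R) : (if P then (1 : ℂ) else 0) = (if Q then 1 else 0) * if R then 1 else 0 := by
  by_cases hQ : Q <;> by_cases hR : R
  · rw [if_pos (h.2 ⟨hQ, hR⟩), if_pos hQ, if_pos hR, one_mul]
  · rw [if_neg fun hP => hR (h.1 hP).2, if_neg hR, mul_zero]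
  · rw [if_neg fun hP => hQ (h.1 hP).1, if_neg hQ, zero_mul]
  · rw [if_neg fun hP => hQ (h.1 hP).1, if_neg hQ, zero_mul]

theorem boole_eq_prod {J : Type} [Fintype J] {P : Prop} {Q : J → Prop} {_ : Decidable P}
    {_ : ∀ j, Decidable (Q j)} (h : P ↔ ∀ j, Q j) :
    (if P then (1 : ℂ) else 0) = ∏ j, if Q j then 1 else 0 := by
  by_cases hP : P
  · rw [if_pos hP, Finset.prod_eq_one fun j _ => if_pos (h.1 hP j)]
  · rw [if_neg hP]
    rw [h, not_forall] at hP
    obtain ⟨j, hj⟩ := hP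
    exact (Finset.prod_eq_zero (Finset.mem_univ j) (if_neg hj)).symm

section OffKet

variable {A V W J : Type} [Fintype A] [DecidableEq A] [Fintype V] [DecidableEq V] [Fintype W]
  [DecidableEq W] [Fintype J] [DecidableEq J]

theorem ket_sum (x : V → Bool) (y : W → Bool) (w : V ⊕ W → Bool) :
    ket (Sum.elim x y) w = ket x (fun v => w (Sum.inl v)) * ket y (fun v => w (Sum.inr v)) := by
  rw [ket_apply, ket_apply, ket_apply]
  exact boole_eq_mul (sum_elim_eq_iff x y w)

theorem ket_prod (x : J → W → Bool) (w : J × W → Bool) :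
    ket (fun p => x p.1 p.2) w = ∏ j, ket (x j) fun v => w (j, v) := by
  simp only [ket_apply]
  refine boole_eq_prod ⟨fun h j => funext fun v => congrFun h (j, v), fun h => ?_⟩
  funext ⟨j, v⟩
  exact congrFun (h j) v

omit [Fintype A] [DecidableEq A] [Fintype V] [DecidableEq V] in
theorem offKet_inl (f : A ↪ V) (x : V → Bool) (y : W → Bool) (w : V ⊕ W → Bool) :
    offKet (f.trans Function.Embedding.inl) (Sum.elim x y) w =
      offKet f x (fun v => w (Sum.inl v)) * ket y (fun v => w (Sum.inr v)) := by
  rw [offKet, offKet, ket_apply]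
  refine boole_eq_mul ⟨fun h => ⟨fun v hv => h (Sum.inl v) ?_, funext fun v =>
    (h (Sum.inr v) ?_).symm⟩, fun h => ?_⟩
  · rintro ⟨a, ha⟩
    exact hv ⟨a, Sum.inl_injective ha⟩
  · rintro ⟨a, ⟨⟩⟩
  · rintro (v | v) hv
    · exact h.1 v fun ⟨a, ha⟩ => hv ⟨a, congrArg Sum.inl ha⟩
    · exact (congrFun h.2 v).symm

omit [Fintype A] [DecidableEq A] [Fintype W] [DecidableEq W] in
theorem offKet_inr (f : A ↪ W) (x : V → Bool) (y : W → Bool) (w : V ⊕ W → Bool) :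
    offKet (f.trans Function.Embedding.inr) (Sum.elim x y) w =
      ket x (fun v => w (Sum.inl v)) * offKet f y (fun v => w (Sum.inr v)) := by
  rw [offKet, offKet, ket_apply]
  refine boole_eq_mul ⟨fun h => ⟨funext fun v => (h (Sum.inl v) ?_).symm, fun v hv =>
    h (Sum.inr v) ?_⟩, fun h => ?_⟩
  · rintro ⟨a, ⟨⟩⟩
  · rintro ⟨a, ha⟩
    exact hv ⟨a, Sum.inr_injective ha⟩
  · rintro (v | v) hv
    · exact (congrFun h.1 v).symm
    · exact h.2 v fun ⟨a, ha⟩ => hv ⟨a, congrArg Sum.inr ha⟩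

omit [Fintype V] [DecidableEq V] in
theorem offKet_refl (x w : V → Bool) : offKet (Function.Embedding.refl V) x w = 1 := by
  rw [offKet, if_pos]
  exact fun v hv => (hv ⟨v, rfl⟩).elim

omit [Fintype A] [DecidableEq A] [Fintype W] [DecidableEq W] [DecidableEq J] in
theorem offKet_prodMap (f : A ↪ W) (x : J → W → Bool) (w : J × W → Bool) :
    offKet ((Function.Embedding.refl J).prodMap f) (fun p => x p.1 p.2) w =
      ∏ j, offKet f (x j) fun v => w (j, v) := by
  simp only [offKet]
  refine boole_eq_prod ⟨fun h j v hv => h (j, v) ?_, fun h p hp => h p.1 p.2 ?_⟩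
  · rintro ⟨⟨j', a⟩, ha⟩
    exact hv ⟨a, (Prod.ext_iff.1 ha).2⟩
  · rintro ⟨a, ha⟩
    exact hp ⟨(p.1, a), Prod.ext rfl ha⟩

end OffKet

theorem DependsOff.comp {A B V W M : Type} {f : A ↪ V} {γ : (V → Bool) → M}
    (h : DependsOff f γ) {ι : B ↪ W} (g : V → W)
    (hg : ∀ v, v ∉ Set.range f → g v ∉ Set.range ι) : DependsOff ι fun w => γ fun v => w (g v) :=
  fun _ _ hxy => h _ _ fun v hv => hxy _ (hg v hv)

/-- A keyed circuit whose unitary part is known on the kets of the input. -/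
theorem QCircuit.run_withKey {K A B W I : Type} [Fintype K] [DecidableEq K] [Fintype A]
    [DecidableEq A] [Fintype B] [DecidableEq B] [Fintype W] [DecidableEq W] [Fintype I]
    [DecidableEq I] (inp : K ⊕ A ↪ W) (out : B ↪ W) (l : List (QGate W)) (k : K → Bool)
    {X : Matrix (A → Bool) I ℂ} {Y : Matrix (B → Bool) I ℂ} (hX : Xᴴ * X = 1) (hY : Yᴴ * Y = 1)
    (Γ : (W → Bool) → ℂ) (hΓ : DependsOff out Γ)
    (h : ∀ c, gatesMatrix l *ᵥ
      (∑ x, (X *ᵥ c) x • ket (Function.extend inp (Sum.elim k x) (zeros W))) =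
        fun w => (Y *ᵥ c) (fun b => w (out b)) * Γ w) (ρ : Matrix I I ℂ) :
    (⟨W, inp, out, l⟩ : QCircuit (K ⊕ A) B).run (withKey k (X * ρ * Xᴴ)) = Y * ρ * Yᴴ := by
  have e : withKey k (X * ρ * Xᴴ) = (keyIso A k * X) * ρ * (keyIso A k * X)ᴴ := by
    rw [withKey_eq, Matrix.conjTranspose_mul]
    simp only [Matrix.mul_assoc]
  rw [e]
  refine QCircuit.run_of_outVec_eq_mul _ (mul_isometry (keyIso_isometry k) hX) hY Γ hΓ
    (fun w i => ?_) ρ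
  have h1 := congrFun (h (Pi.single i 1)) w
  have h2 : (Y *ᵥ Pi.single i 1) (fun b => w (out b)) = Y (fun b => w (out b)) i := by simp
  rw [h2] at h1
  refine Eq.trans ?_ h1
  have h3 : (QCircuit.outVec ⟨W, inp, out, l⟩ (keyIso A k * X)) w i =
      (QCircuit.outVec ⟨W, inp, out, l⟩ (keyIso A k * X) *ᵥ Pi.single i 1) w := by simp
  rw [h3, outVec, ← Matrix.mulVec_mulVec, ← Matrix.mulVec_mulVec, ← Matrix.mulVec_mulVec,
    unitary_eq]
  refine congrFun (congrArg (gatesMatrix l *ᵥ ·) ?_) w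
  conv_lhs => rw [vec_eq_sum_ket (X *ᵥ Pi.single i 1), mulVec_sum_smul, mulVec_sum_smul]
  simp only [keyIso_ket]
  exact Finset.sum_congr rfl fun x _ => congrArg _ (QCircuit.initIso_ket _ _)

end Emb

/-! ### The encryption circuit -/

section Encryption

variable {κ a b : ℕ} (C : QCircuit (Fin κ ⊕ Fin a) (Fin b)) (t : ℕ) (R₁ R₂ : Type)

/-- The wires of the encryption circuit: `t` copies of the wires of `C`, the key, ancillas. -/
abbrev EncWires : Type := (Fin t × C.W) ⊕ (Fin κ ⊕ (R₁ ⊕ R₂))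

/-- The input wires of the encryption circuit. -/
def encInp : Fin κ ⊕ Fin t × Fin a ↪ EncWires C t R₁ R₂ :=
  sumEmb (Function.Embedding.inl.trans Function.Embedding.inr)
    ((C.dataEmb t).trans Function.Embedding.inl) (by rintro a b ⟨⟩)

/-- The data wires and the ancillas of the first type state preparation. -/
def encData : (Fin t × Fin a) ⊕ R₁ ↪ EncWires C t R₁ R₂ :=
  sumEmb ((C.dataEmb t).trans Function.Embedding.inl)
    ((Function.Embedding.inl.trans Function.Embedding.inr).trans Function.Embedding.inr)
    (by rintro a b ⟨⟩)

/-- The output wires and the ancillas of the second type state preparation. -/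
def encOut : (Fin t × Fin b) ⊕ R₂ ↪ EncWires C t R₁ R₂ :=
  sumEmb ((C.outEmb t).trans Function.Embedding.inl)
    ((Function.Embedding.inr.trans Function.Embedding.inr).trans Function.Embedding.inr)
    (by rintro a b ⟨⟩)

variable {R₁ R₂} {t} [Fintype R₁] [DecidableEq R₁] [Fintype R₂] [DecidableEq R₂]

/-- After the key has been copied into each block, everything outside the message wires is a
product: key and zeros in the blocks, the original key, and zeros in both sets of ancillas. -/
theorem offKet_encInp (k : Qubits κ) (w : EncWires C t R₁ R₂ → Bool) :
    offKet (Function.Embedding.inr.trans (encInp C t R₁ R₂))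
      (Function.extend ((C.keyEmb t).trans Function.Embedding.inl) (fun j => k j.2)
        (Function.extend (encInp C t R₁ R₂) (Sum.elim k (zeros _)) (zeros _))) w =
      (∏ i, C.keyKet k fun v => w (Sum.inl (i, v))) * (ket k (fun j => w (Sum.inr (Sum.inl j))) *
        (ket (zeros R₁) (fun r => w (Sum.inr (Sum.inr (Sum.inl r)))) *
        ket (zeros R₂) (fun r => w (Sum.inr (Sum.inr (Sum.inr r)))))) := by
  have hx1 : (Function.extend ((C.keyEmb t).trans Function.Embedding.inl) (fun j => k j.2)
        (Function.extend (encInp C t R₁ R₂) (Sum.elim k (zeros _)) (zeros _))) =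
      Sum.elim (fun p => Function.extend C.inp (Sum.elim k (zeros _)) (zeros _) p.2)
        (Sum.elim k (Sum.elim (zeros R₁) (zeros R₂))) := by
    rw [extend_key_zeros, extend_key_zeros, extend_eq_iff]
    constructor
    · rintro (⟨i, u⟩ | j | r | r) hw
      · rw [extend_apply_off _ _ _ (by rintro ⟨i, ⟨⟩⟩)]
        refine (extend_apply_off (Function.Embedding.inl.trans C.inp) k (zeros _) ?_).symm
        rintro ⟨j, rfl⟩
        exact hw ⟨(i, j), rfl⟩
      · exact extend_apply_emb (Function.Embedding.inl.trans (encInp C t R₁ R₂)) k _ j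
      · exact extend_apply_off _ _ _ (by rintro ⟨i, ⟨⟩⟩)
      · exact extend_apply_off _ _ _ (by rintro ⟨i, ⟨⟩⟩)
    · funext p
      exact (extend_apply_emb (Function.Embedding.inl.trans C.inp) k _ p.2).symm
  rw [hx1]
  refine (offKet_inl (C.dataEmb t) _ _ w).trans (congrArg₂ (· * ·) ?_ ?_)
  · exact offKet_prodMap (Function.Embedding.inr.trans C.inp)
      (fun _ : Fin t => Function.extend C.inp (Sum.elim k (zeros _)) (zeros _)) _
  · rw [ket_sum, ket_sum]

/-- The gates of the encryption circuit, given the gates that copy the key and those for the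
type states. -/
def encGates (l₀ : List (QGate (EncWires C t R₁ R₂)))
    (l₁ : List (QGate ((Fin t × Fin a) ⊕ R₁))) (l₂ : List (QGate ((Fin t × Fin b) ⊕ R₂))) :
    List (QGate (EncWires C t R₁ R₂)) :=
  l₀ ++ (l₁.map (QGate.map (encData C t R₁ R₂)) ++
    (allGates (fun j => C.gates.map (QGate.map (blockEmb (J := Fin t) Function.Embedding.inl j))) ++
      inverseGates (l₂.map (QGate.map (encOut C t R₁ R₂)))))

/-- The encryption circuit maps stored superpositions of types to stored superpositions of
types, up to a vector of the discarded wires. -/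
theorem encGates_mulVec {l₀ : List (QGate (EncWires C t R₁ R₂))}
    {l₁ : List (QGate ((Fin t × Fin a) ⊕ R₁))} {l₂ : List (QGate ((Fin t × Fin b) ⊕ R₂))}
    (k : Qubits κ) (hl₀ : ∀ φ : (Fin t × Fin a → Bool) → ℂ,
      gatesMatrix l₀ *ᵥ
          (∑ x, φ x • ket (Function.extend (encInp C t R₁ R₂) (Sum.elim k x) (zeros _))) =
        fun w => φ (fun i => w (encInp C t R₁ R₂ (Sum.inr i))) *
          offKet (Function.Embedding.inr.trans (encInp C t R₁ R₂))
            (Function.extend ((C.keyEmb t).trans Function.Embedding.inl) (fun j => k j.2)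
              (Function.extend (encInp C t R₁ R₂) (Sum.elim k (zeros _)) (zeros _))) w)
    (hl₁ : ∀ T, gatesMatrix l₁ *ᵥ ket (Sum.elim (typeAssign T) (zeros R₁)) =
      addZeros (Fin t × Fin a) R₁ *ᵥ typeVec T)
    (hl₂ : ∀ T, gatesMatrix l₂ *ᵥ ket (Sum.elim (typeAssign T) (zeros R₂)) =
      addZeros (Fin t × Fin b) R₂ *ᵥ typeVec T)
    (F : Matrix (Qubits b) (Qubits a) ℂ) (γ : (C.W → Bool) → ℂ) (hγo : DependsOff C.out γ)
    (hγ : ∀ x, gatesMatrix C.gates *ᵥ ket (Function.extend C.inp (Sum.elim k x) (zeros C.W)) =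
        fun w => F (fun i => w (C.out i)) x * γ w) :
    ∃ Γ, DependsOff ((C.outEmb t).trans Function.Embedding.inl) Γ ∧
      ∀ c : Sym (Qubits a) t → ℂ,
      gatesMatrix (encGates C l₀ l₁ l₂) *ᵥ (∑ x, (typeIso a t *ᵥ c) x •
          ket (Function.extend (encInp C t R₁ R₂) (Sum.elim k x) (zeros _))) =
      fun w => (typeIso b t *ᵥ (symPow t F *ᵥ c))
        (fun p => w (Sum.inl (C.outEmb t p))) * Γ w := by
  let Γ₀ : (EncWires C t R₁ R₂ → Bool) → ℂ := fun w => ket k (fun j => w (Sum.inr (Sum.inl j)))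
  let Γ₁ : (EncWires C t R₁ R₂ → Bool) → ℂ :=
    fun w => ket (zeros R₁) (fun r => w (Sum.inr (Sum.inr (Sum.inl r))))
  let Γ₂ : (EncWires C t R₁ R₂ → Bool) → ℂ :=
    fun w => ket (zeros R₂) (fun r => w (Sum.inr (Sum.inr (Sum.inr r))))
  let Γk : (EncWires C t R₁ R₂ → Bool) → ℂ := fun w => ∏ i, C.keyKet k fun v => w (Sum.inl (i, v))
  let Γγ : (EncWires C t R₁ R₂ → Bool) → ℂ := fun w => ∏ i, γ fun v => w (Sum.inl (i, v))
  have d₀ : ∀ {V : Type} (ι : V ↪ EncWires C t R₁ R₂),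
      (∀ j, Sum.inr (Sum.inl j) ∉ Set.range ι) → DependsOff ι Γ₀ :=
    fun ι h => dependsOff_comp _ h (ket k)
  have d₁ : ∀ {V : Type} (ι : V ↪ EncWires C t R₁ R₂),
      (∀ j, Sum.inr (Sum.inr (Sum.inl j)) ∉ Set.range ι) → DependsOff ι Γ₁ :=
    fun ι h => dependsOff_comp _ h (ket _)
  have d₂ : ∀ {V : Type} (ι : V ↪ EncWires C t R₁ R₂),
      (∀ j, Sum.inr (Sum.inr (Sum.inr j)) ∉ Set.range ι) → DependsOff ι Γ₂ :=
    fun ι h => dependsOff_comp _ h (ket _)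
  have dk : DependsOff (encData C t R₁ R₂) Γk := by
    refine DependsOff.prod _ fun i _ => DependsOff.comp (dependsOff_offKet _ _) _ fun v hv => ?_
    rintro ⟨⟨i', j⟩ | r, hj⟩
    · exact hv ⟨j, (Prod.ext_iff.1 (Sum.inl_injective hj)).2⟩
    · cases hj
  have dγ : DependsOff (encOut C t R₁ R₂) Γγ := by
    refine DependsOff.prod _ fun i _ => DependsOff.comp hγo _ fun v hv => ?_
    rintro ⟨⟨i', j⟩ | r, hj⟩
    · exact hv ⟨j, (Prod.ext_iff.1 (Sum.inl_injective hj)).2⟩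
    · cases hj
  have dγ' : DependsOff ((C.outEmb t).trans Function.Embedding.inl) Γγ := fun x y h =>
    dγ x y fun w hw => h w fun ⟨p, hp⟩ => hw ⟨Sum.inl p, hp⟩
  refine ⟨fun w => Γγ w * (Γ₀ w * (Γ₁ w * Γ₂ w)), dγ'.mul ((d₀ _ ?_).mul ((d₁ _ ?_).mul (d₂ _ ?_))),
    fun c => ?_⟩
  · rintro j ⟨p, ⟨⟩⟩
  · rintro j ⟨p, ⟨⟩⟩
  · rintro j ⟨p, ⟨⟩⟩
  have s1 : gatesMatrix l₀ *ᵥ (∑ x, (typeIso a t *ᵥ c) x •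
          ket (Function.extend (encInp C t R₁ R₂) (Sum.elim k x) (zeros _))) = fun w =>
        (typeIso a t *ᵥ c) (fun p => w (encData C t R₁ R₂ (Sum.inl p))) *
          ket (zeros R₁) (fun r => w (encData C t R₁ R₂ (Sum.inr r))) *
          (Γk w * (Γ₀ w * Γ₂ w)) := by
    refine (hl₀ _).trans (funext fun w => ?_)
    refine (congrArg _ (offKet_encInp C k w)).trans ?_
    have alg : ∀ x k y₀ y₁ y₂ : ℂ, x * (k * (y₀ * (y₁ * y₂))) = x * y₁ * (k * (y₀ * y₂)) := by
      intros; ring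
    exact alg _ (Γk w) (Γ₀ w) (Γ₁ w) (Γ₂ w)
  have s2 := gatesMatrix_schur l₁ hl₁ (encData C t R₁ R₂) c (fun w => Γk w * (Γ₀ w * Γ₂ w))
    (dk.mul ((d₀ _ (by rintro j ⟨p | p, ⟨⟩⟩)).mul (d₂ _ (by rintro j ⟨p | p, ⟨⟩⟩))))
  have e2 : (fun w => (schurSym (Qubits a) t *ᵥ c)
        (fun i j => w (encData C t R₁ R₂ (Sum.inl (i, j)))) *
          ket (zeros R₁) (fun r => w (encData C t R₁ R₂ (Sum.inr r))) *
          (Γk w * (Γ₀ w * Γ₂ w))) = fun w => (schurSym (Qubits a) t *ᵥ c)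
        (fun i j => w (Sum.inl (i, C.inp (Sum.inr j)))) *
          (∏ i, C.keyKet k fun v => w (Sum.inl (i, v))) * (Γ₀ w * (Γ₁ w * Γ₂ w)) := by
    funext w
    have alg : ∀ x k y₀ y₁ y₂ : ℂ, x * y₁ * (k * (y₀ * y₂)) = x * k * (y₀ * (y₁ * y₂)) := by
      intros; ring
    exact alg _ (Γk w) (Γ₀ w) (Γ₁ w) (Γ₂ w)
  -- The garbage of each block factors out, so the state of the output wires stays pure.
  have s3 := C.gatesMatrix_parallel k F γ hγ
    (Function.Embedding.inl : Fin t × C.W ↪ EncWires C t R₁ R₂) (schurSym (Qubits a) t *ᵥ c)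
    (fun w => Γ₀ w * (Γ₁ w * Γ₂ w)) ((d₀ _ (by rintro j ⟨p, ⟨⟩⟩)).mul
      ((d₁ _ (by rintro j ⟨p, ⟨⟩⟩)).mul (d₂ _ (by rintro j ⟨p, ⟨⟩⟩))))
  have e3 : (fun w => (tensorPow t F *ᵥ (schurSym (Qubits a) t *ᵥ c))
        (fun i j => w (Sum.inl (i, C.out j))) *
          (∏ i, γ fun v => w (Sum.inl (i, v))) * (Γ₀ w * (Γ₁ w * Γ₂ w))) = fun w =>
        (schurSym (Qubits b) t *ᵥ (symPow t F *ᵥ c))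
          (fun i j => w (encOut C t R₁ R₂ (Sum.inl (i, j)))) *
          ket (zeros R₂) (fun r => w (encOut C t R₁ R₂ (Sum.inr r))) *
          (Γγ w * (Γ₀ w * Γ₁ w)) := by
    funext w
    rw [Matrix.mulVec_mulVec, Matrix.mulVec_mulVec, schurSym_mul_symPow]
    have alg : ∀ x k y₀ y₁ y₂ : ℂ, x * k * (y₀ * (y₁ * y₂)) = x * y₂ * (k * (y₀ * y₁)) := by
      intros; ring
    exact alg _ (Γγ w) (Γ₀ w) (Γ₁ w) (Γ₂ w)
  -- By `schurSym_mul_symPow` the output registers hold a superposition of type states, so the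
  -- preparation can be undone.
  have s4 := gatesMatrix_inverse_mulVec _ (gatesMatrix_schur l₂ hl₂ (encOut C t R₁ R₂)
    (symPow t F *ᵥ c) (fun w => Γγ w * (Γ₀ w * Γ₁ w))
    (dγ.mul ((d₀ _ (by rintro j ⟨p | p, ⟨⟩⟩)).mul (d₁ _ (by rintro j ⟨p | p, ⟨⟩⟩)))))
  rw [encGates, gatesMatrix_append, gatesMatrix_append, gatesMatrix_append,
    ← Matrix.mulVec_mulVec, ← Matrix.mulVec_mulVec, ← Matrix.mulVec_mulVec]
  rw [s1, s2, e2]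
  refine (congrArg (gatesMatrix (inverseGates (l₂.map (QGate.map (encOut C t R₁ R₂)))) *ᵥ ·)
    (s3.trans e3)).trans (s4.trans (funext fun w => ?_))
  have alg : ∀ x k y₀ y₁ y₂ : ℂ, x * y₂ * (k * (y₀ * y₁)) = x * (k * (y₀ * (y₁ * y₂))) := by
    intros; ring
  exact alg _ (Γγ w) (Γ₀ w) (Γ₁ w) (Γ₂ w)

end Encryption

/-! ### Size and correctness of the encryption circuit -/

section Size

variable {κ a b : ℕ} (C : QCircuit (Fin κ ⊕ Fin a) (Fin b)) (t : ℕ)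

/-- There is an encryption circuit of polynomial size. -/
theorem exists_encCircuit : ∃ E : QCircuit (Fin κ ⊕ Fin t × Fin a) (Fin t × Fin b),
    E.size ≤ t * C.size + κ + t * κ + (t + typeStateSize t a) + (t + typeStateSize t b) ∧
    ∀ (k : Qubits κ) (F : Matrix (Qubits b) (Qubits a) ℂ), Fᴴ * F = 1 →
      (∀ ρ : Matrix (Qubits a) (Qubits a) ℂ, C.run (withKey k ρ) = conjBy F ρ) →
      ∀ {d : ℕ} (e : Fin d ↪ Sym (Qubits a) t) (ρ : Matrix (Fin d) (Fin d) ℂ),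
        E.run (withKey k (((typeSystem a t).coordSubspace e).store ρ)) =
          (typeSystem b t).store (conjBy (symPow t F * selectIso e) ρ) := by
  obtain ⟨R₁, _, _, l₁, hs₁, hl₁⟩ := exists_typeState_gates t a
  obtain ⟨R₂, _, _, l₂, hs₂, hl₂⟩ := exists_typeState_gates t b
  obtain ⟨l₀, hs₀, hl₀⟩ := exists_load_gates (encInp C t R₁ R₂) (fun j : Fin t × Fin κ => j.2)
    ((C.keyEmb t).trans Function.Embedding.inl) (by
      rintro (i | ⟨i, j⟩) ⟨i', j'⟩ h
      · cases h
      · cases C.inp.injective (Prod.ext_iff.1 (Sum.inl_injective h)).2)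
  refine ⟨⟨EncWires C t R₁ R₂, encInp C t R₁ R₂, (C.outEmb t).trans Function.Embedding.inl,
    encGates C l₀ l₁ l₂⟩, ?_, fun k F hF hC d e ρ => ?_⟩
  · have h1 : Fintype.card (EncWires C t R₁ R₂) =
        t * Fintype.card C.W + (κ + (Fintype.card R₁ + Fintype.card R₂)) := by simp
    have h2 : (encGates C l₀ l₁ l₂).length =
        t * κ + (l₁.length + (t * C.gates.length + l₂.length)) := by
      simp only [encGates, List.length_append, hs₀, List.length_map, length_inverseGates,
        Fintype.card_prod, Fintype.card_fin]
      rw [length_allGates _ C.gates.length fun j => by simp, Fintype.card_fin]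
    change Fintype.card (EncWires C t R₁ R₂) + (encGates C l₀ l₁ l₂).length ≤ _
    rw [h1, h2, QCircuit.size, mul_add]
    omega
  · obtain ⟨γ, hγo, hγ⟩ := C.exists_garbage k F hF hC
    obtain ⟨Γ, hΓ, h⟩ := encGates_mulVec C k (hl₀ k) hl₁ hl₂ F γ hγo hγ
    have hX := mul_isometry (typeIso_isometry a t) (selectIso_isometry e)
    have hY := mul_isometry (typeIso_isometry b t)
      (mul_isometry (symPow_isometry (t := t) F hF) (selectIso_isometry e))
    have := QCircuit.run_withKey (encInp C t R₁ R₂) ((C.outEmb t).trans Function.Embedding.inl)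
      (encGates C l₀ l₁ l₂) k hX hY Γ hΓ (fun c => by
        have := h (selectIso e *ᵥ c)
        simp only [Matrix.mulVec_mulVec] at this
        exact this) ρ
    rw [store_coordSubspace]
    exact this.trans (store_typeSystem_conjBy _ _).symm

end Size

/-! ### The decryption circuit -/

section Decryption

variable {κ a b : ℕ} (C : QCircuit (Fin κ ⊕ Fin a) (Fin b)) (t : ℕ) (R₁ R₂ : Type)

/-- The wires of the decryption circuit: `t` copies of the wires of `C`, the ciphertext, the key,
ancillas. -/
abbrev DecWires : Type := (Fin t × C.W) ⊕ ((Fin t × Fin b) ⊕ (Fin κ ⊕ (R₁ ⊕ R₂)))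

/-- The input wires of the decryption circuit. -/
def decInp : Fin κ ⊕ Fin t × Fin b ↪ DecWires C t R₁ R₂ :=
  sumEmb ((Function.Embedding.inl.trans Function.Embedding.inr).trans Function.Embedding.inr)
    (Function.Embedding.inl.trans Function.Embedding.inr) (by rintro a b ⟨⟩)

/-- The ciphertext wires and the ancillas of the second type state preparation. -/
def decCtx : (Fin t × Fin b) ⊕ R₂ ↪ DecWires C t R₁ R₂ :=
  sumEmb (Function.Embedding.inl.trans Function.Embedding.inr)
    (((Function.Embedding.inr.trans Function.Embedding.inr).trans Function.Embedding.inr).trans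
      Function.Embedding.inr) (by rintro a b ⟨⟩)

open Classical in
/-- The wires of `t` copies of `C`, with the output wires replaced by the ciphertext. -/
def decBlock : Fin t × C.W ↪ DecWires C t R₁ R₂ where
  toFun p := if h : ∃ j, C.out j = p.2 then Sum.inr (Sum.inl (p.1, h.choose)) else Sum.inl p
  inj' p q hpq := by
    dsimp only at hpq
    split_ifs at hpq with h h'
    · have h1 := Prod.ext_iff.1 (Sum.inl_injective (Sum.inr_injective hpq))
      refine Prod.ext h1.1 ?_
      rw [← h.choose_spec, ← h'.choose_spec]
      exact congrArg _ h1.2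
    · exact Sum.inl_injective hpq

theorem decBlock_out (i : Fin t) (j : Fin b) :
    decBlock C t R₁ R₂ (i, C.out j) = Sum.inr (Sum.inl (i, j)) := by
  have h : ∃ j', C.out j' = C.out j := ⟨j, rfl⟩
  refine (dif_pos h).trans ?_
  rw [C.out.injective h.choose_spec]

theorem decBlock_off (i : Fin t) {v : C.W} (hv : v ∉ Set.range C.out) :
    decBlock C t R₁ R₂ (i, v) = Sum.inl (i, v) :=
  dif_neg hv

theorem inr_notMem_range_decBlock (r : Fin κ ⊕ (R₁ ⊕ R₂)) :
    Sum.inr (Sum.inr r) ∉ Set.range (decBlock C t R₁ R₂) := by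
  rintro ⟨⟨i, v⟩, h⟩
  by_cases hv : v ∈ Set.range C.out
  · obtain ⟨j, rfl⟩ := hv
    rw [decBlock_out] at h
    cases h
  · rw [decBlock_off C t R₁ R₂ i hv] at h
    cases h

/-- The original output wires hold the unwanted F|0⟩ of the fresh runs; the backward run must not
touch them. -/
theorem inl_out_notMem_range_decBlock (i : Fin t) (j : Fin b) :
    Sum.inl (i, C.out j) ∉ Set.range (decBlock C t R₁ R₂) := by
  rintro ⟨⟨i', v⟩, h⟩
  by_cases hv : v ∈ Set.range C.out
  · obtain ⟨j', rfl⟩ := hv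
    rw [decBlock_out] at h
    cases h
  · rw [decBlock_off C t R₁ R₂ i' hv] at h
    exact hv ⟨j, (Prod.ext_iff.1 (Sum.inl_injective h)).2.symm⟩

/-- The wires of the decrypted message. -/
def decOut : Fin t × Fin a ↪ DecWires C t R₁ R₂ := (C.dataEmb t).trans (decBlock C t R₁ R₂)

/-- The wires of the decrypted message and the ancillas of the first type state preparation. -/
def decData : (Fin t × Fin a) ⊕ R₁ ↪ DecWires C t R₁ R₂ :=
  sumEmb (decOut C t R₁ R₂)
    (((Function.Embedding.inl.trans Function.Embedding.inr).trans Function.Embedding.inr).trans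
      Function.Embedding.inr) (fun _ _ h => inr_notMem_range_decBlock C t R₁ R₂ _ ⟨_, h⟩)

variable {R₁ R₂} {t} [Fintype R₁] [DecidableEq R₁] [Fintype R₂] [DecidableEq R₂]

/-- Unlike in the encryption, the ciphertext lies outside the blocks, so each block starts as a full
ket: the key with input zero. -/
theorem offKet_decInp (k : Qubits κ) (w : DecWires C t R₁ R₂ → Bool) :
    offKet (Function.Embedding.inr.trans (decInp C t R₁ R₂))
      (Function.extend ((C.keyEmb t).trans Function.Embedding.inl) (fun j => k j.2)
        (Function.extend (decInp C t R₁ R₂) (Sum.elim k (zeros _)) (zeros _))) w =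
      (∏ i, ket (Function.extend C.inp (Sum.elim k (zeros (Fin a))) (zeros C.W))
          fun v => w (Sum.inl (i, v))) *
        (ket k (fun j => w (Sum.inr (Sum.inr (Sum.inl j)))) *
        (ket (zeros R₁) (fun r => w (Sum.inr (Sum.inr (Sum.inr (Sum.inl r))))) *
        ket (zeros R₂) (fun r => w (Sum.inr (Sum.inr (Sum.inr (Sum.inr r))))))) := by
  have hx1 : (Function.extend ((C.keyEmb t).trans Function.Embedding.inl) (fun j => k j.2)
        (Function.extend (decInp C t R₁ R₂) (Sum.elim k (zeros _)) (zeros _))) =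
      Sum.elim (fun p => Function.extend C.inp (Sum.elim k (zeros _)) (zeros _) p.2)
        (Sum.elim (zeros _) (Sum.elim k (Sum.elim (zeros R₁) (zeros R₂)))) := by
    rw [extend_key_zeros, extend_key_zeros, extend_eq_iff]
    constructor
    · rintro (⟨i, u⟩ | p | j | r | r) hw
      · rw [extend_apply_off _ _ _ (by rintro ⟨i, ⟨⟩⟩)]
        refine (extend_apply_off (Function.Embedding.inl.trans C.inp) k (zeros _) ?_).symm
        rintro ⟨j, rfl⟩
        exact hw ⟨(i, j), rfl⟩
      · exact extend_apply_off _ _ _ (by rintro ⟨i, ⟨⟩⟩)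
      · exact extend_apply_emb (Function.Embedding.inl.trans (decInp C t R₁ R₂)) k _ j
      · exact extend_apply_off _ _ _ (by rintro ⟨i, ⟨⟩⟩)
      · exact extend_apply_off _ _ _ (by rintro ⟨i, ⟨⟩⟩)
    · funext p
      exact (extend_apply_emb (Function.Embedding.inl.trans C.inp) k _ p.2).symm
  rw [hx1]
  refine (offKet_inr Function.Embedding.inl _ _ w).trans (congrArg₂ (· * ·) ?_ ?_)
  · exact ket_prod (fun _ : Fin t => Function.extend C.inp (Sum.elim k (zeros _)) (zeros _)) _
  · refine (offKet_inl (Function.Embedding.refl _) _ _ _).trans ?_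
    rw [offKet_refl, one_mul, ket_sum, ket_sum]

/-- The gates of the decryption circuit, given the gates that copy the key and those for the
type states. -/
def decGates (l₀ : List (QGate (DecWires C t R₁ R₂)))
    (l₁ : List (QGate ((Fin t × Fin a) ⊕ R₁))) (l₂ : List (QGate ((Fin t × Fin b) ⊕ R₂))) :
    List (QGate (DecWires C t R₁ R₂)) :=
  l₀ ++
    (allGates (fun j => C.gates.map (QGate.map (blockEmb (J := Fin t) Function.Embedding.inl j))) ++
    (l₂.map (QGate.map (decCtx C t R₁ R₂)) ++
    (inverseGates
      (allGates fun j => C.gates.map (QGate.map (blockEmb (decBlock C t R₁ R₂) j))) ++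
      inverseGates (l₁.map (QGate.map (decData C t R₁ R₂))))))

/-- The decryption circuit inverts the encryption of stored superpositions of types, up to a
vector of the discarded wires. -/
theorem decGates_mulVec {l₀ : List (QGate (DecWires C t R₁ R₂))}
    {l₁ : List (QGate ((Fin t × Fin a) ⊕ R₁))} {l₂ : List (QGate ((Fin t × Fin b) ⊕ R₂))}
    (k : Qubits κ) (hl₀ : ∀ φ : (Fin t × Fin b → Bool) → ℂ,
      gatesMatrix l₀ *ᵥ
          (∑ x, φ x • ket (Function.extend (decInp C t R₁ R₂) (Sum.elim k x) (zeros _))) =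
        fun w => φ (fun i => w (decInp C t R₁ R₂ (Sum.inr i))) *
          offKet (Function.Embedding.inr.trans (decInp C t R₁ R₂))
            (Function.extend ((C.keyEmb t).trans Function.Embedding.inl) (fun j => k j.2)
              (Function.extend (decInp C t R₁ R₂) (Sum.elim k (zeros _)) (zeros _))) w)
    (hl₁ : ∀ T, gatesMatrix l₁ *ᵥ ket (Sum.elim (typeAssign T) (zeros R₁)) =
      addZeros (Fin t × Fin a) R₁ *ᵥ typeVec T)
    (hl₂ : ∀ T, gatesMatrix l₂ *ᵥ ket (Sum.elim (typeAssign T) (zeros R₂)) =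
      addZeros (Fin t × Fin b) R₂ *ᵥ typeVec T)
    (F : Matrix (Qubits b) (Qubits a) ℂ) (γ : (C.W → Bool) → ℂ) (hγo : DependsOff C.out γ)
    (hγ : ∀ x, gatesMatrix C.gates *ᵥ ket (Function.extend C.inp (Sum.elim k x) (zeros C.W)) =
        fun w => F (fun i => w (C.out i)) x * γ w) :
    ∃ Γ, DependsOff (decOut C t R₁ R₂) Γ ∧ ∀ c : Sym (Qubits a) t → ℂ,
      gatesMatrix (decGates C l₀ l₁ l₂) *ᵥ
        (∑ x, (typeIso b t *ᵥ (symPow t F *ᵥ c)) x •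
          ket (Function.extend (decInp C t R₁ R₂) (Sum.elim k x) (zeros _))) =
      fun w => (typeIso a t *ᵥ c) (fun p => w (decOut C t R₁ R₂ p)) * Γ w := by
  let Γ₀ : (DecWires C t R₁ R₂ → Bool) → ℂ :=
    fun w => ket k (fun j => w (Sum.inr (Sum.inr (Sum.inl j))))
  let Γ₁ : (DecWires C t R₁ R₂ → Bool) → ℂ :=
    fun w => ket (zeros R₁) (fun r => w (Sum.inr (Sum.inr (Sum.inr (Sum.inl r)))))
  let Γ₂ : (DecWires C t R₁ R₂ → Bool) → ℂ :=
    fun w => ket (zeros R₂) (fun r => w (Sum.inr (Sum.inr (Sum.inr (Sum.inr r)))))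
  let Γk : (DecWires C t R₁ R₂ → Bool) → ℂ :=
    fun w => ∏ i, C.keyKet k fun v => w (decBlock C t R₁ R₂ (i, v))
  let Γγ : (DecWires C t R₁ R₂ → Bool) → ℂ := fun w => ∏ i, γ fun v => w (Sum.inl (i, v))
  let ΓF : (DecWires C t R₁ R₂ → Bool) → ℂ :=
    fun w => ∏ i, F (fun j => w (Sum.inl (i, C.out j))) (zeros (Fin a))
  have d₀ : ∀ {V : Type} (ι : V ↪ DecWires C t R₁ R₂),
      (∀ r, Sum.inr (Sum.inr (Sum.inl r)) ∉ Set.range ι) → DependsOff ι Γ₀ :=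
    fun ι h => dependsOff_comp _ h (ket k)
  have d₁ : ∀ {V : Type} (ι : V ↪ DecWires C t R₁ R₂),
      (∀ r, Sum.inr (Sum.inr (Sum.inr (Sum.inl r))) ∉ Set.range ι) → DependsOff ι Γ₁ :=
    fun ι h => dependsOff_comp _ h (ket _)
  have d₂ : ∀ {V : Type} (ι : V ↪ DecWires C t R₁ R₂),
      (∀ r, Sum.inr (Sum.inr (Sum.inr (Sum.inr r))) ∉ Set.range ι) → DependsOff ι Γ₂ :=
    fun ι h => dependsOff_comp _ h (ket _)
  have dF : ∀ {V : Type} (ι : V ↪ DecWires C t R₁ R₂),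
      (∀ i j, Sum.inl (i, C.out j) ∉ Set.range ι) → DependsOff ι ΓF :=
    fun ι h => DependsOff.prod _ fun i _ => dependsOff_comp _ (h i) (fun x => F x (zeros (Fin a)))
  have dγ : DependsOff (decCtx C t R₁ R₂) Γγ := by
    refine DependsOff.prod _ fun i _ => dependsOff_comp _ (fun v => ?_) γ
    rintro ⟨p | r, ⟨⟩⟩
  -- The garbage ignores the output wires, so garbage made by the fresh runs is also garbage for the
  -- blocks with the ciphertext in place of the outputs.
  have hΓγ : ∀ w, Γγ w = ∏ i, γ fun v => w (decBlock C t R₁ R₂ (i, v)) := fun w =>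
    Finset.prod_congr rfl fun i _ => hγo _ _ fun v hv => by rw [decBlock_off C t R₁ R₂ i hv]
  have rout : ∀ i j, Sum.inl (i, C.out j) ∉ Set.range (decOut C t R₁ R₂) :=
    fun i j ⟨p, hp⟩ => inl_out_notMem_range_decBlock C t R₁ R₂ i j ⟨_, hp⟩
  have rinr : ∀ r, Sum.inr (Sum.inr r) ∉ Set.range (decOut C t R₁ R₂) :=
    fun r ⟨p, hp⟩ => inr_notMem_range_decBlock C t R₁ R₂ r ⟨_, hp⟩
  have rdat : ∀ x, x ∉ Set.range (decOut C t R₁ R₂) →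
      (∀ r, x ≠ Sum.inr (Sum.inr (Sum.inr (Sum.inl r)))) → x ∉ Set.range (decData C t R₁ R₂) := by
    rintro x h h' ⟨p | r, hp⟩
    · exact h ⟨p, hp⟩
    · exact h' r hp.symm
  have dk : DependsOff (decOut C t R₁ R₂) Γk := by
    refine DependsOff.prod _ fun i _ => DependsOff.comp (dependsOff_offKet _ _) _ fun v hv => ?_
    rintro ⟨⟨i', j⟩, hj⟩
    exact hv ⟨j, (Prod.ext_iff.1 ((decBlock C t R₁ R₂).injective hj)).2⟩
  have dk' : DependsOff (decData C t R₁ R₂) Γk := fun x y h => by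
    refine Finset.prod_congr rfl fun i _ => dependsOff_offKet _ _ _ _ fun v hv => h _ ?_
    refine rdat _ ?_ fun r hr => ?_
    · rintro ⟨⟨i', j⟩, hj⟩
      exact hv ⟨j, (Prod.ext_iff.1 ((decBlock C t R₁ R₂).injective hj)).2⟩
    · exact inr_notMem_range_decBlock C t R₁ R₂ _ ⟨_, hr⟩
  refine ⟨fun w => Γk w * (ΓF w * (Γ₀ w * (Γ₁ w * Γ₂ w))), dk.mul ((dF _ rout).mul
    ((d₀ _ fun _ => rinr _).mul ((d₁ _ fun r => rinr _).mul (d₂ _ fun r => rinr _)))), fun c => ?_⟩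
  have s1 : gatesMatrix l₀ *ᵥ (∑ x, (typeIso b t *ᵥ (symPow t F *ᵥ c)) x •
          ket (Function.extend (decInp C t R₁ R₂) (Sum.elim k x) (zeros _))) = fun w =>
        (∏ i : Fin t, ket (Function.extend C.inp (Sum.elim k (zeros (Fin a))) (zeros C.W))
          fun v => w (Sum.inl (i, v))) *
        ((typeIso b t *ᵥ (symPow t F *ᵥ c)) (fun p => w (Sum.inr (Sum.inl p))) *
          (Γ₀ w * (Γ₁ w * Γ₂ w))) := by
    refine (hl₀ _).trans (funext fun w => ?_)
    refine (congrArg _ (offKet_decInp C k w)).trans ?_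
    exact mul_left_comm _ _ _
  -- Fresh runs on input zero manufacture the garbage, together with copies of F|0⟩ that go into
  -- `ΓF`.
  have s2 := gatesMatrix_blocks (Function.Embedding.inl : Fin t × C.W ↪ DecWires C t R₁ R₂) C.gates
    (fun _ => ket (Function.extend C.inp (Sum.elim k (zeros (Fin a))) (zeros C.W)))
    (fun _ w => F (fun i => w (C.out i)) (zeros (Fin a)) * γ w) (fun _ => hγ _)
    (fun w => (typeIso b t *ᵥ (symPow t F *ᵥ c)) (fun p => w (Sum.inr (Sum.inl p))) *
          (Γ₀ w * (Γ₁ w * Γ₂ w))) (DependsOff.mul (dependsOff_comp _ (by rintro p ⟨q, ⟨⟩⟩) _)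
      ((d₀ _ (by rintro j ⟨p, ⟨⟩⟩)).mul ((d₁ _ (by rintro j ⟨p, ⟨⟩⟩)).mul
        (d₂ _ (by rintro j ⟨p, ⟨⟩⟩)))))
  have e2 : (fun w : DecWires C t R₁ R₂ → Bool =>
        (∏ i : Fin t, F (fun j => w (Sum.inl (i, C.out j))) (zeros (Fin a)) *
          γ fun v => w (Sum.inl (i, v))) *
        ((typeIso b t *ᵥ (symPow t F *ᵥ c)) (fun p => w (Sum.inr (Sum.inl p))) *
          (Γ₀ w * (Γ₁ w * Γ₂ w)))) = fun w =>
        (typeIso b t *ᵥ (symPow t F *ᵥ c))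
          (fun p => w (decCtx C t R₁ R₂ (Sum.inl p))) *
          ket (zeros R₂) (fun r => w (decCtx C t R₁ R₂ (Sum.inr r))) *
          (Γγ w * (ΓF w * (Γ₀ w * Γ₁ w))) := by
    funext w
    rw [Finset.prod_mul_distrib]
    have alg : ∀ x f g y₀ y₁ y₂ : ℂ,
        f * g * (x * (y₀ * (y₁ * y₂))) = x * y₂ * (g * (f * (y₀ * y₁))) := by intros; ring
    exact alg _ (ΓF w) (Γγ w) (Γ₀ w) (Γ₁ w) (Γ₂ w)
  have s3 := gatesMatrix_schur l₂ hl₂ (decCtx C t R₁ R₂) (symPow t F *ᵥ c)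
    (fun w => Γγ w * (ΓF w * (Γ₀ w * Γ₁ w))) (dγ.mul ((dF _ (by rintro i j ⟨p | p, ⟨⟩⟩)).mul
      ((d₀ _ (by rintro j ⟨p | p, ⟨⟩⟩)).mul (d₁ _ (by rintro j ⟨p | p, ⟨⟩⟩)))))
  have e3 : (fun w : DecWires C t R₁ R₂ → Bool => (schurSym (Qubits b) t *ᵥ (symPow t F *ᵥ c))
          (fun i j => w (decCtx C t R₁ R₂ (Sum.inl (i, j)))) *
          ket (zeros R₂) (fun r => w (decCtx C t R₁ R₂ (Sum.inr r))) *
          (Γγ w * (ΓF w * (Γ₀ w * Γ₁ w)))) = fun w =>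
        (tensorPow t F *ᵥ (schurSym (Qubits a) t *ᵥ c))
          (fun i j => w (decBlock C t R₁ R₂ (i, C.out j))) *
          (∏ i, γ fun v => w (decBlock C t R₁ R₂ (i, v))) *
          (ΓF w * (Γ₀ w * (Γ₁ w * Γ₂ w))) := by
    funext w
    rw [Matrix.mulVec_mulVec, Matrix.mulVec_mulVec, schurSym_mul_symPow, ← hΓγ]
    simp only [decBlock_out]
    have alg : ∀ x f g y₀ y₁ y₂ : ℂ,
        x * y₂ * (g * (f * (y₀ * y₁))) = x * g * (f * (y₀ * (y₁ * y₂))) := by intros; ring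
    exact alg _ (ΓF w) (Γγ w) (Γ₀ w) (Γ₁ w) (Γ₂ w)
  have rb := inr_notMem_range_decBlock C t R₁ R₂
  -- Ciphertext and garbage together are exactly what a forward run on the message would produce, so
  -- the inverse gates return the message.
  have s4 := gatesMatrix_inverse_mulVec _ (C.gatesMatrix_parallel k F γ hγ
    (decBlock C t R₁ R₂) (schurSym (Qubits a) t *ᵥ c) (fun w => ΓF w * (Γ₀ w * (Γ₁ w * Γ₂ w)))
    ((dF _ (inl_out_notMem_range_decBlock C t R₁ R₂)).mul ((d₀ _ fun _ => rb _).mul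
      ((d₁ _ fun _ => rb _).mul (d₂ _ fun _ => rb _)))))
  have e4 : (fun w : DecWires C t R₁ R₂ → Bool => (schurSym (Qubits a) t *ᵥ c)
        (fun i j => w (decBlock C t R₁ R₂ (i, C.inp (Sum.inr j)))) *
          (∏ i, C.keyKet k fun v => w (decBlock C t R₁ R₂ (i, v))) *
          (ΓF w * (Γ₀ w * (Γ₁ w * Γ₂ w)))) = fun w => (schurSym (Qubits a) t *ᵥ c)
        (fun i j => w (decData C t R₁ R₂ (Sum.inl (i, j)))) *
          ket (zeros R₁) (fun r => w (decData C t R₁ R₂ (Sum.inr r))) *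
          (Γk w * (ΓF w * (Γ₀ w * Γ₂ w))) := by
    funext w
    have alg : ∀ x f g y₀ y₁ y₂ : ℂ,
        x * g * (f * (y₀ * (y₁ * y₂))) = x * y₁ * (g * (f * (y₀ * y₂))) := by intros; ring
    exact alg _ (ΓF w) (Γk w) (Γ₀ w) (Γ₁ w) (Γ₂ w)
  have s5 := gatesMatrix_inverse_mulVec _ (gatesMatrix_schur l₁ hl₁ (decData C t R₁ R₂) c
    (fun w => Γk w * (ΓF w * (Γ₀ w * Γ₂ w))) (dk'.mul
      ((dF _ fun i j => rdat _ (rout i j) (by rintro r ⟨⟩)).mul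
        ((d₀ _ fun j => rdat _ (rinr _) (by rintro r ⟨⟩)).mul
          (d₂ _ fun j => rdat _ (rinr _) (by rintro r ⟨⟩))))))
  rw [decGates, gatesMatrix_append, gatesMatrix_append, gatesMatrix_append, gatesMatrix_append,
    ← Matrix.mulVec_mulVec, ← Matrix.mulVec_mulVec, ← Matrix.mulVec_mulVec,
    ← Matrix.mulVec_mulVec, s1]
  have s23 := (congrArg (gatesMatrix (l₂.map (QGate.map (decCtx C t R₁ R₂))) *ᵥ ·)
    (s2.trans e2)).trans (s3.trans e3)
  have s45 := (congrArg (gatesMatrix (inverseGates (l₁.map (QGate.map (decData C t R₁ R₂)))) *ᵥ ·)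
    (s4.trans e4)).trans s5
  refine (congrArg (fun z => gatesMatrix (inverseGates (l₁.map (QGate.map (decData C t R₁ R₂)))) *ᵥ
    (gatesMatrix (inverseGates (allGates fun j =>
      C.gates.map (QGate.map (blockEmb (decBlock C t R₁ R₂) j)))) *ᵥ z)) s23).trans
    (s45.trans (funext fun w => ?_))
  have alg : ∀ x f g y₀ y₁ y₂ : ℂ,
      x * y₁ * (g * (f * (y₀ * y₂))) = x * (g * (f * (y₀ * (y₁ * y₂)))) := by intros; ring
  exact alg _ (ΓF w) (Γk w) (Γ₀ w) (Γ₁ w) (Γ₂ w)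

/-- There is a decryption circuit of polynomial size. -/
theorem exists_decCircuit (t : ℕ) : ∃ E : QCircuit (Fin κ ⊕ Fin t × Fin b) (Fin t × Fin a),
    E.size ≤ 2 * (t * C.size) + t * b + κ + t * κ + (t + typeStateSize t a) +
      (t + typeStateSize t b) ∧
    ∀ (k : Qubits κ) (F : Matrix (Qubits b) (Qubits a) ℂ), Fᴴ * F = 1 →
      (∀ ρ : Matrix (Qubits a) (Qubits a) ℂ, C.run (withKey k ρ) = conjBy F ρ) →
      ∀ {d : ℕ} (e : Fin d ↪ Sym (Qubits a) t) (ρ : Matrix (Fin d) (Fin d) ℂ),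
        E.run (withKey k ((typeSystem b t).store (conjBy (symPow t F * selectIso e) ρ))) =
          ((typeSystem a t).coordSubspace e).store ρ := by
  obtain ⟨R₁, _, _, l₁, hs₁, hl₁⟩ := exists_typeState_gates t a
  obtain ⟨R₂, _, _, l₂, hs₂, hl₂⟩ := exists_typeState_gates t b
  obtain ⟨l₀, hs₀, hl₀⟩ := exists_load_gates (decInp C t R₁ R₂) (fun j : Fin t × Fin κ => j.2)
    ((C.keyEmb t).trans Function.Embedding.inl) (by rintro (i | ⟨i, j⟩) ⟨i', j'⟩ ⟨⟩)
  refine ⟨⟨DecWires C t R₁ R₂, decInp C t R₁ R₂, decOut C t R₁ R₂,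
    decGates C l₀ l₁ l₂⟩, ?_, fun k F hF hC d e ρ => ?_⟩
  · have h1 : Fintype.card (DecWires C t R₁ R₂) =
        t * Fintype.card C.W + (t * b + (κ + (Fintype.card R₁ + Fintype.card R₂))) := by simp
    have h2 : (decGates C l₀ l₁ l₂).length =
        t * κ + (t * C.gates.length + (l₂.length + (t * C.gates.length + l₁.length))) := by
      simp only [decGates, List.length_append, hs₀, List.length_map, length_inverseGates,
        Fintype.card_prod, Fintype.card_fin]
      rw [length_allGates _ C.gates.length fun j => by simp,
        length_allGates _ C.gates.length fun j => by simp, Fintype.card_fin]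
    change Fintype.card (DecWires C t R₁ R₂) + (decGates C l₀ l₁ l₂).length ≤ _
    rw [h1, h2, QCircuit.size, mul_add]
    omega
  · obtain ⟨γ, hγo, hγ⟩ := C.exists_garbage k F hF hC
    obtain ⟨Γ, hΓ, h⟩ := decGates_mulVec C k (hl₀ k) hl₁ hl₂ F γ hγo hγ
    have hY := mul_isometry (typeIso_isometry a t) (selectIso_isometry e)
    have hX := mul_isometry (typeIso_isometry b t)
      (mul_isometry (symPow_isometry (t := t) F hF) (selectIso_isometry e))
    have := QCircuit.run_withKey (decInp C t R₁ R₂) (decOut C t R₁ R₂)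
      (decGates C l₀ l₁ l₂) k hX hY Γ hΓ (fun c => by
        have := h (selectIso e *ᵥ c)
        simp only [Matrix.mulVec_mulVec] at this
        exact this) ρ
    rw [store_coordSubspace]
    exact (congrArg _ (congrArg _ (store_typeSystem_conjBy _ _))).trans this

end Decryption

/-! ### States entangled with reference qubits -/

section Reference

variable {R I J L : Type} [Fintype R] [DecidableEq R] [Fintype I] [Fintype J]

/-- The matrix `1 ⊗ M`. -/
def refKron (R : Type) [DecidableEq R] (M : Matrix J I ℂ) : Matrix (R × J) (R × I) ℂ :=
  Matrix.kroneckerMap (fun x y => x * y) (1 : Matrix R R ℂ) M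

omit [Fintype R] [Fintype I] [Fintype J] in
theorem refKron_apply (M : Matrix J I ℂ) (r r' : R) (j : J) (i : I) :
    refKron R M (r, j) (r', i) = if r = r' then M j i else 0 := by
  rw [refKron, Matrix.kroneckerMap_apply, Matrix.one_apply]
  split_ifs <;> simp

omit [Fintype I] in
theorem refKron_mul (A : Matrix L J ℂ) (B : Matrix J I ℂ) :
    refKron R (A * B) = refKron R A * refKron R B := by
  have := Matrix.mul_kronecker_mul (1 : Matrix R R ℂ) (1 : Matrix R R ℂ) A B
  rwa [Matrix.one_mul] at this

omit [Fintype J] in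
theorem ampliate_conjBy (M : Matrix J I ℂ) (ρ : Matrix (R × I) (R × I) ℂ) :
    ampliate (conjBy M) ρ = refKron R M * ρ * (refKron R M)ᴴ := by
  ext ⟨r, j⟩ ⟨r', j'⟩
  rw [ampliate, Matrix.of_apply, conjBy, conj_apply, conj_apply]
  simp only [Fintype.sum_prod_type, refKron_apply]
  rw [Finset.sum_eq_single r]
  · refine Finset.sum_congr rfl fun i _ => ?_
    rw [Finset.sum_eq_single r']
    · simp
    · intro s _ hs
      simp [hs.symm]
    · simp
  · intro s _ hs
    simp [hs.symm]
  · simp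

theorem ampliate_ampliate (A : Matrix L J ℂ) (B : Matrix J I ℂ)
    (ρ : Matrix (R × I) (R × I) ℂ) :
    ampliate (conjBy A) (ampliate (conjBy B) ρ) = ampliate (conjBy (A * B)) ρ := by
  rw [ampliate_conjBy, ampliate_conjBy, ampliate_conjBy, refKron_mul, Matrix.conjTranspose_mul]
  simp only [Matrix.mul_assoc]

omit [Fintype I] in
theorem refKron_isometry [DecidableEq I] {M : Matrix J I ℂ} (hM : Mᴴ * M = 1) :
    (refKron R M)ᴴ * refKron R M = 1 := by
  have h : (refKron R M)ᴴ = refKron R Mᴴ := by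
    ext ⟨r, i⟩ ⟨r', j⟩
    rw [Matrix.conjTranspose_apply, refKron_apply, refKron_apply]
    simp only [eq_comm (a := r')]
    split_ifs <;> simp
  rw [h, ← refKron_mul, hM]
  exact Matrix.one_kronecker_one

/-- Makes the message, once turned into type states, an admissible query in the pseudorandomness
game. -/
theorem IsDensity.ampliate [DecidableEq I] {M : Matrix J I ℂ} (hM : Mᴴ * M = 1)
    {ρ : Matrix (R × I) (R × I) ℂ} (hρ : IsDensity ρ) : IsDensity (ampliate (conjBy M) ρ) := by
  rw [ampliate_conjBy]
  refine ⟨hρ.1.mul_mul_conjTranspose_same _, ?_⟩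
  rw [Matrix.trace_mul_comm, ← Matrix.mul_assoc, refKron_isometry hM, Matrix.one_mul, hρ.2]

/-- The states of a stored system with reference qubits. -/
def refVecs {W : Type} [Fintype W] [DecidableEq W] (ℓ : ℕ) (Z : Matrix (W → Bool) I ℂ) :
    Matrix (Fin ℓ ⊕ W → Bool) (Qubits ℓ × I) ℂ :=
  Matrix.of fun x p => ket p.1 (fun i => x (Sum.inl i)) * Z (fun w => x (Sum.inr w)) p.2

theorem store_withRef (ℓ : ℕ) (X : QSystem) (M : Matrix X.Idx I ℂ)
    (ρ : Matrix (Qubits ℓ × I) (Qubits ℓ × I) ℂ) :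
    (X.withRef ℓ).store (ampliate (conjBy M) ρ) =
      refVecs ℓ (X.storeIso * M) * ρ * (refVecs ℓ (X.storeIso * M))ᴴ := by
  let S : Matrix (Fin ℓ ⊕ X.Wire → Bool) (Qubits ℓ × X.Idx) ℂ := (X.withRef ℓ).storeIso
  have hS : ∀ x r j, S x (r, j) = ket (Sum.elim r (X.code j)) x := fun x r j =>
    (X.withRef ℓ).storeIso_apply x (r, j)
  have h : S * refKron (Qubits ℓ) M = refVecs ℓ (X.storeIso * M) := by
    ext x ⟨r, i⟩
    rw [Matrix.mul_apply, refVecs, Matrix.of_apply, Matrix.mul_apply, Finset.mul_sum,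
      Fintype.sum_prod_type, Finset.sum_eq_single r]
    · refine Finset.sum_congr rfl fun j _ => ?_
      rw [hS, refKron_apply, if_pos rfl, QSystem.storeIso_apply, ← mul_assoc, ket_sum]
    · intro r' _ hr
      refine Finset.sum_eq_zero fun j _ => ?_
      rw [refKron_apply, if_neg hr, mul_zero]
    · simp
  have h' : (X.withRef ℓ).store (ampliate (conjBy M) ρ) = S * ampliate (conjBy M) ρ * Sᴴ := rfl
  rw [h', ampliate_conjBy, ← h, Matrix.conjTranspose_mul]
  simp only [Matrix.mul_assoc]
  rfl

theorem store_withRef_typeSystem {N t : ℕ} (ℓ : ℕ) (M : Matrix (Sym (Qubits N) t) I ℂ)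
    (ρ : Matrix (Qubits ℓ × I) (Qubits ℓ × I) ℂ) :
    ((typeSystem N t).withRef ℓ).store (ampliate (conjBy M) ρ) =
      refVecs ℓ (typeIso N t * M) * ρ * (refVecs ℓ (typeIso N t * M))ᴴ :=
  store_withRef ℓ (typeSystem N t) M ρ

theorem store_withRef_copies {N t : ℕ} (ℓ : ℕ) (M : Matrix (Fin t → Qubits N) I ℂ)
    (ρ : Matrix (Qubits ℓ × I) (Qubits ℓ × I) ℂ) :
    ((QSystem.copies t N).withRef ℓ).store (ampliate (conjBy M) ρ) =
      refVecs ℓ (M.submatrix (fun x i j => x (i, j)) id) * ρ *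
        (refVecs ℓ (M.submatrix (fun (x : Fin t × Fin N → Bool) i j => x (i, j)) id))ᴴ := by
  let S : Matrix (Fin t × Fin N → Bool) (Fin t → Qubits N) ℂ := (QSystem.copies t N).storeIso
  have h : S * M = M.submatrix (fun x i j => x (i, j)) id := by
    ext x i
    rw [Matrix.mul_apply, Finset.sum_eq_single fun i j => x (i, j)]
    · refine (congrArg (· * _) ((QSystem.copies t N).storeIso_apply x _)).trans ?_
      refine (congrArg (· * _) ((ket_apply _ _).trans (if_pos rfl))).trans (one_mul _)
    · intro v _ hv
      refine (congrArg (· * _) ((QSystem.copies t N).storeIso_apply x v)).trans ?_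
      refine (congrArg (· * _) ((ket_apply _ _).trans (if_neg ?_))).trans (zero_mul _)
      rintro rfl
      exact hv rfl
    · simp
  rw [← h]
  exact store_withRef ℓ (QSystem.copies t N) M ρ

end Reference

/-! ### Discarding clean ancillas -/

section Distinguisher

variable {A B I : Type} [Fintype A] [DecidableEq A] [Fintype B] [DecidableEq B]

theorem ite_zero_congr {P Q : Prop} {_ : Decidable P} {_ : Decidable Q} (h : P ↔ Q) (x : ℂ) :
    (if P then x else 0) = if Q then x else 0 := by
  by_cases hP : P
  · rw [if_pos hP, if_pos (h.1 hP)]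
  · rw [if_neg hP, if_neg fun hQ => hP (h.2 hQ)]

omit [Fintype B] [DecidableEq B] in
theorem QCircuit.initIso_mulVec (C : QCircuit A B) (φ : (A → Bool) → ℂ) :
    C.initIso *ᵥ φ = fun w => φ (fun a => w (C.inp a)) * offKet C.inp (zeros C.W) w := by
  conv_lhs => rw [vec_eq_sum_ket φ, mulVec_sum_smul]
  funext w
  rw [Finset.sum_apply, Finset.sum_eq_single fun a => w (C.inp a)]
  · rw [initIso_ket, Pi.smul_apply, smul_eq_mul, ket_extend, ket_apply, if_pos rfl, one_mul]
  · intro x _ hx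
    rw [initIso_ket, Pi.smul_apply, smul_eq_mul, ket_extend, ket_apply, if_neg fun h => hx h.symm]
    simp
  · simp

omit [Fintype A] [DecidableEq A] [DecidableEq B] in
/-- Discarding an additional register in the state `|0⟩`. -/
theorem QCircuit.traceOut_of_zeros {V R : Type} [Fintype V] [DecidableEq V] [Fintype R]
    [DecidableEq R] (inp : A ↪ V) (out : B ↪ V) (l : List (QGate V)) (inp' : A ↪ V ⊕ R)
    (l' : List (QGate (V ⊕ R))) (σ : Matrix (V → Bool) (V → Bool) ℂ)
    (σ' : Matrix (V ⊕ R → Bool) (V ⊕ R → Bool) ℂ)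
    (h : ∀ w w', σ' w w' = σ (fun v => w (Sum.inl v)) (fun v => w' (Sum.inl v)) *
      (ket (zeros R) (fun r => w (Sum.inr r)) * ket (zeros R) (fun r => w' (Sum.inr r)))) :
    (⟨V ⊕ R, inp', out.trans Function.Embedding.inl, l'⟩ : QCircuit A B).traceOut σ' =
      (⟨V, inp, out, l⟩ : QCircuit A B).traceOut σ := by
  classical
  ext y y'
  rw [traceOut, traceOut, Matrix.of_apply, Matrix.of_apply]
  have e : ∀ f : (V ⊕ R → Bool) → ℂ, (∀ x z, z ≠ zeros R → f (Sum.elim x z) = 0) →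
      ∑ w, f w = ∑ x : V → Bool, f (Sum.elim x (zeros R)) := fun f hf => by
    rw [← (Equiv.sumArrowEquivProdArrow V R Bool).symm.sum_comp, Fintype.sum_prod_type]
    refine Finset.sum_congr rfl fun x _ => ?_
    rw [Finset.sum_eq_single (zeros R)]
    · rfl
    · exact fun z _ hz => hf x z hz
    · simp
  have h0 : ∀ z : R → Bool, z ≠ zeros R → ket (zeros R) z = 0 := fun z hz => by
    rw [ket_apply, if_neg hz]
  have h1 : ket (zeros R) (zeros R) = 1 := by rw [ket_apply, if_pos rfl]
  refine (e _ ?_).trans (Finset.sum_congr rfl fun x _ => (e _ ?_).trans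
    (Finset.sum_congr rfl fun x' _ => ?_))
  · intro x z hz
    refine Finset.sum_eq_zero fun w' _ => ?_
    rw [h]
    simp only [Sum.elim_inr, h0 z hz, zero_mul, mul_zero, ite_self]
  · intro x z hz
    rw [h]
    simp only [Sum.elim_inr, h0 z hz, mul_zero, ite_self]
  · rw [h]
    simp only [Sum.elim_inr, Sum.elim_inl, h1, mul_one]
    refine ite_zero_congr (and_congr Iff.rfl (and_congr Iff.rfl ⟨fun hj j hj' =>
      hj (Sum.inl j) ?_, fun hj j hj' => ?_⟩)) _
    · rcases j with j | j
      · exact hj j fun ⟨b, hb⟩ => hj' ⟨b, congrArg Sum.inl hb⟩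
      · rfl
    · rintro ⟨b, hb⟩
      exact hj' ⟨b, Sum.inl_injective hb⟩

end Distinguisher

/-! ### From adversaries to distinguishers -/

section Attack

variable {ℓ t b : ℕ} {B : Type} [Fintype B] [DecidableEq B]

omit [DecidableEq B] in
/-- A distinguisher of stored superpositions of types gives a distinguisher of superpositions of
type states. -/
theorem exists_schurCircuit (D : QCircuit (Fin ℓ ⊕ Fin t × Fin b) B) :
    ∃ E : QCircuit (Fin ℓ ⊕ Fin t × Fin b) B, E.size ≤ D.size + (t + typeStateSize t b) ∧
      ∀ {I : Type} [Fintype I] (M : Matrix (Sym (Qubits b) t) I ℂ)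
        (ρ : Matrix (Qubits ℓ × I) (Qubits ℓ × I) ℂ),
        E.run (((QSystem.copies t b).withRef ℓ).store
            (ampliate (conjBy (schurSym (Qubits b) t * M)) ρ)) =
          D.run (((typeSystem b t).withRef ℓ).store (ampliate (conjBy M) ρ)) := by
  obtain ⟨R, _, _, l, hs, hl⟩ := exists_typeState_gates t b
  let ι : (Fin t × Fin b) ⊕ R ↪ D.W ⊕ R :=
    sumEmb ((Function.Embedding.inr.trans D.inp).trans Function.Embedding.inl)
      Function.Embedding.inr (by rintro a b ⟨⟩)
  let g : List (QGate (D.W ⊕ R)) :=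
    inverseGates (l.map (QGate.map ι)) ++ D.gates.map (QGate.map Function.Embedding.inl)
  let E : QCircuit (Fin ℓ ⊕ Fin t × Fin b) B := ⟨D.W ⊕ R, D.inp.trans Function.Embedding.inl,
    D.out.trans Function.Embedding.inl, g⟩
  refine ⟨E, ?_, fun {I} _ M ρ => ?_⟩
  · change Fintype.card (D.W ⊕ R) + g.length ≤ _
    simp only [g, List.length_append, List.length_map, length_inverseGates, Fintype.card_sum,
      QCircuit.size]
    omega
  · refine (congrArg E.run (store_withRef_copies ℓ _ ρ)).trans (Eq.trans ?_
      (congrArg D.run (store_withRef_typeSystem ℓ M ρ)).symm)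
    rw [QCircuit.run_conj, QCircuit.run_conj]
    -- The input lies in the range of `schurSym`, where the inverse preparation returns its ancillas
    -- to zero; what remains is a run of `D` next to an idle register.
    have key : ∀ w p, E.outVec (refVecs ℓ ((schurSym (Qubits b) t * M).submatrix
        (fun (x : Fin t × Fin b → Bool) i j => x (i, j)) id)) w p =
        D.outVec (refVecs ℓ (typeIso b t * M)) (fun v => w (Sum.inl v)) p *
          ket (zeros R) (fun r => w (Sum.inr r)) := by
      rintro w ⟨r, i⟩
      let c : Sym (Qubits b) t → ℂ := fun T => M T i
      let Γ : (D.W ⊕ R → Bool) → ℂ := fun w =>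
        ket r (fun i => w (Sum.inl (D.inp (Sum.inl i)))) *
          offKet D.inp (zeros D.W) (fun v => w (Sum.inl v))
      have hΓ : DependsOff ι Γ := by
        refine (dependsOff_comp _ (fun i => ?_) (ket r)).mul
          ((dependsOff_offKet _ _).comp _ fun v hv => ?_)
        · rintro ⟨p | p, hp⟩
          · cases D.inp.injective (Sum.inl_injective hp)
          · cases hp
        · rintro ⟨p | p, hp⟩
          · exact hv ⟨_, Sum.inl_injective hp⟩
          · cases hp
      let φ : (Fin ℓ ⊕ Fin t × Fin b → Bool) → ℂ := fun x =>
        ket r (fun i => x (Sum.inl i)) * (typeIso b t *ᵥ c) (fun p => x (Sum.inr p))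
      let φ' : (Fin ℓ ⊕ Fin t × Fin b → Bool) → ℂ := fun x =>
        ket r (fun i => x (Sum.inl i)) * (schurSym (Qubits b) t *ᵥ c) (fun j j' => x (Sum.inr (j, j')))
      have hD : D.outVec (refVecs ℓ (typeIso b t * M)) (fun v => w (Sum.inl v)) (r, i) =
        (gatesMatrix D.gates *ᵥ (D.initIso *ᵥ φ)) (fun v => w (Sum.inl v)) := by
        rw [Matrix.mulVec_mulVec]
        rfl
      have hE : E.outVec (refVecs ℓ ((schurSym (Qubits b) t * M).submatrix
        (fun (x : Fin t × Fin b → Bool) i j => x (i, j)) id)) w (r, i) =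
        (gatesMatrix g *ᵥ (E.initIso *ᵥ φ')) w := by
        rw [Matrix.mulVec_mulVec]
        rfl
      have h0 : E.initIso *ᵥ φ' = fun w =>
          (schurSym (Qubits b) t *ᵥ c) (fun j j' => w (ι (Sum.inl (j, j')))) *
            ket (zeros R) (fun r => w (ι (Sum.inr r))) * Γ w := by
        refine (QCircuit.initIso_mulVec E φ').trans (funext fun w => ?_)
        have hz : offKet E.inp (zeros E.W) w =
            offKet D.inp (zeros D.W) (fun v => w (Sum.inl v)) *
              ket (zeros R) (fun r => w (Sum.inr r)) := by
          have e : zeros (D.W ⊕ R) = Sum.elim (zeros D.W) (zeros R) := by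
            funext v
            rcases v with v | v <;> rfl
          exact (congrArg (fun z => offKet (D.inp.trans Function.Embedding.inl) z w) e).trans
            (offKet_inl D.inp _ _ w)
        rw [hz]
        have alg : ∀ x y z u : ℂ, x * y * (z * u) = y * u * (x * z) := by intros; ring
        exact alg _ _ _ _
      have h1 : (fun w => (typeIso b t *ᵥ c) (fun p => w (ι (Sum.inl p))) *
            ket (zeros R) (fun r => w (ι (Sum.inr r))) * Γ w) =
          fun w => (D.initIso *ᵥ φ) (fun v => w (Sum.inl v)) *
            ket (zeros R) (fun r => w (Sum.inr r)) := by
        rw [QCircuit.initIso_mulVec]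
        funext w
        have alg : ∀ x y z u : ℂ, y * u * (x * z) = x * y * z * u := by intros; ring
        exact alg _ _ _ _
      have h2 := gatesMatrix_inverse_mulVec _ (gatesMatrix_schur l hl ι c Γ hΓ)
      rw [hE, hD]
      simp only [g]
      rw [gatesMatrix_append, ← Matrix.mulVec_mulVec, gatesMatrix_map]
      refine (congrFun (congrArg (fun z => onWires Function.Embedding.inl (gatesMatrix D.gates) *ᵥ
        (gatesMatrix (inverseGates (l.map (QGate.map ι))) *ᵥ z)) h0) w).trans ?_
      refine (congrFun (congrArg (onWires Function.Embedding.inl (gatesMatrix D.gates) *ᵥ ·)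
        (h2.trans h1)) w).trans ?_
      exact congrFun (onWires_mulVec_of_dependsOff Function.Embedding.inl (gatesMatrix D.gates)
        (D.initIso *ᵥ φ) (dependsOff_comp Sum.inr (by rintro v ⟨p, ⟨⟩⟩) (ket (zeros R)))) w
    refine QCircuit.traceOut_of_zeros D.inp D.out D.gates _ g _ _ fun w w' => ?_
    rw [conj_apply, conj_apply, Finset.sum_mul]
    refine Finset.sum_congr rfl fun i _ => ?_
    rw [Finset.sum_mul]
    refine Finset.sum_congr rfl fun i' _ => ?_
    have hk : ∀ z : R → Bool, star (ket (zeros R) z) = ket (zeros R) z := fun z => by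
      rw [ket_apply]
      split_ifs <;> simp
    rw [key, key, star_mul', hk]
    ring

end Attack

/-! ### Schur's lemma for the symmetric subspace -/

section Commutant

variable {I : Type} [Fintype I] [DecidableEq I] {t : ℕ}

theorem schurSym_mul_apply {K : Type} (X : Matrix (Sym I t) K ℂ) (v : Fin t → I) (k : K) :
    (schurSym I t * X) v k = ((1 / √(typeCard (typeOf v) : ℝ) : ℝ) : ℂ) * X (typeOf v) k := by
  rw [Matrix.mul_apply, Finset.sum_eq_single (typeOf v)]
  · rw [schurSym_apply, if_pos rfl]
  · intro T _ hT
    rw [schurSym_apply, if_neg hT.symm, zero_mul]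
  · simp

theorem schurSym_coeff_ne_zero (T : Sym I t) : ((1 / √(typeCard T : ℝ) : ℝ) : ℂ) ≠ 0 := by
  have : (0 : ℝ) < typeCard T := Nat.cast_pos.2 (Nat.pos_of_ne_zero (typeCard_ne_zero T))
  exact Complex.ofReal_ne_zero.2 (by positivity)

/-- Type states are eigenvectors of diagonal tensor powers. The entry is read off the intertwining
relation after cancelling the nonzero normalisation. -/
theorem symPow_diagonal (f : I → ℂ) (v : Fin t → I) (T : Sym I t) :
    symPow t (Matrix.diagonal f) (typeOf v) T = if typeOf v = T then ∏ i, f (v i) else 0 := by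
  have h := congrFun (congrFun (schurSym_mul_symPow (t := t) (Matrix.diagonal f)) v) T
  rw [schurSym_mul_apply, Matrix.mul_apply, Finset.sum_eq_single v] at h
  · rw [schurSym_apply, tensorPow, Matrix.of_apply] at h
    simp only [Matrix.diagonal_apply_eq] at h
    split_ifs at h ⊢ with hT
    · rw [← hT, mul_comm (∏ i, f (v i))] at h
      rw [← hT]
      exact mul_left_cancel₀ (schurSym_coeff_ne_zero _) h
    · rw [mul_zero] at h
      exact (mul_eq_zero.1 h).resolve_left (schurSym_coeff_ne_zero _)
  · intro w _ hw
    obtain ⟨i, hi⟩ := Function.ne_iff.1 hw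
    have h0 : tensorPow t (Matrix.diagonal f) v w = 0 :=
      Finset.prod_eq_zero (Finset.mem_univ i) (Matrix.diagonal_apply_ne f (i := v i) hi.symm)
    rw [h0, zero_mul]
  · simp

omit [Fintype I] in
theorem typeOf_const_eq_iff (x : I) (v : Fin t → I) :
    typeOf v = typeOf (fun _ : Fin t => x) ↔ v = fun _ => x := by
  constructor
  · intro h
    obtain ⟨σ, hσ⟩ := exists_perm_of_typeOf_eq h
    rw [hσ]
    rfl
  · rintro rfl
    rfl

/-- The type state of a constant tuple is the single product vector |x…x⟩, so its image has the
products of entries of column `x` as coordinates and no cancellation can occur. -/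
theorem symPow_const_ne_zero (V : Matrix I I ℂ) (x : I) (hV : ∀ y, V y x ≠ 0) (T : Sym I t) :
    symPow t V T (typeOf fun _ => x) ≠ 0 := by
  obtain ⟨v, rfl⟩ := typeOf_surjective T
  have h := congrFun (congrFun (schurSym_mul_symPow (t := t) V) v) (typeOf fun _ => x)
  rw [schurSym_mul_apply, Matrix.mul_apply, Finset.sum_eq_single fun _ => x] at h
  · rw [schurSym_apply, if_pos rfl, tensorPow, Matrix.of_apply] at h
    intro h0
    rw [h0, mul_zero] at h
    exact mul_ne_zero (Finset.prod_ne_zero_iff.2 fun i _ => hV (v i)) (schurSym_coeff_ne_zero _)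
      h.symm
  · intro w _ hw
    rw [schurSym_apply, if_neg fun h => hw ((typeOf_const_eq_iff x w).1 h), mul_zero]
  · simp

/-- A unitary matrix with no zero entries. -/
theorem exists_unitary_ne_zero (I : Type) [Fintype I] [DecidableEq I] [Nonempty I] :
    ∃ V : Matrix.unitaryGroup I ℂ, ∀ y x, (V : Matrix I I ℂ) y x ≠ 0 := by
  have hN : (Fintype.card I : ℂ) ≠ 0 := Nat.cast_ne_zero.2 Fintype.card_ne_zero
  -- `V` multiplies the uniform vector by `1 + (i - 1) = i` and fixes its orthogonal complement. Off
  -- the diagonal the entries are `c`; on it the imaginary part is `1 / card I`.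
  let c : ℂ := (Complex.I - 1) / Fintype.card I
  let V : Matrix I I ℂ := 1 + Matrix.of fun _ _ => c
  have hc : star c = (-Complex.I - 1) / Fintype.card I := by
    simp [c]
  refine ⟨⟨V, Matrix.mem_unitaryGroup_iff.2 ?_⟩, fun y x => ?_⟩
  · have hV : star V = 1 + Matrix.of fun _ _ => star c := by
      ext y x
      simp [V, Matrix.star_apply, Matrix.one_apply, eq_comm]
    rw [hV, mul_add, add_mul, add_mul, Matrix.one_mul, Matrix.one_mul, Matrix.mul_one]
    ext y x
    simp only [Matrix.add_apply, Matrix.of_apply, Matrix.mul_apply, Finset.sum_const,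
      Finset.card_univ, nsmul_eq_mul]
    rw [add_assoc, hc]
    have : c + ((-Complex.I - 1) / Fintype.card I + Fintype.card I * (c * ((-Complex.I - 1) / Fintype.card I))) = 0 := by
      simp only [c]
      field_simp
      ring_nf
      simp
    rw [this, add_zero]
  · change (1 : Matrix I I ℂ) y x + c ≠ 0
    intro h
    have him := congrArg Complex.im h
    have h1 : ((1 : Matrix I I ℂ) y x).im = 0 := by
      rw [Matrix.one_apply]
      split_ifs <;> simp
    have h2 : c.im = 1 / Fintype.card I := by
      have : c = (((-1 / Fintype.card I : ℝ) : ℂ) + ((1 / Fintype.card I : ℝ) : ℂ) * Complex.I) := by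
        simp only [c]
        push_cast
        ring
      rw [this]
      simp
    rw [Complex.add_im, h1, h2, zero_add, Complex.zero_im] at him
    simp at him

/-- A matrix that commutes with the symmetric powers of all the unitary matrices is scalar. -/
theorem eq_smul_one_of_commute [Nonempty I] (A : Matrix (Sym I t) (Sym I t) ℂ)
    (hA : ∀ V : Matrix.unitaryGroup I ℂ, symPow t (V : Matrix I I ℂ) * A = A * symPow t (V : Matrix I I ℂ)) :
    ∃ c : ℂ, A = c • 1 := by
  have hoff : ∀ T T', T ≠ T' → A T T' = 0 := by
    intro T T' h
    obtain ⟨v, rfl⟩ := typeOf_surjective T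
    obtain ⟨v', rfl⟩ := typeOf_surjective T'
    -- Distinct types differ in the multiplicity of some symbol. A phase on that symbol gives them
    -- distinct eigenvalues, because multiplicities are at most `t` and the phase has order `t + 1`.
    obtain ⟨x, hx⟩ : ∃ x, (Finset.univ.filter fun l => v l = x).card ≠
        (Finset.univ.filter fun l => v' l = x).card := by
      by_contra! hx
      refine h (Subtype.ext (Multiset.ext.2 fun x => ?_))
      have := hx x
      rwa [← count_typeOf, ← count_typeOf] at this
    have hω := Complex.isPrimitiveRoot_exp (t + 1) (Nat.succ_ne_zero t)
    set ω := Complex.exp (2 * Real.pi * Complex.I / ((t + 1 : ℕ) : ℂ)) with hωdef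
    have hω1 : ω * star ω = 1 := by
      have hn : ‖ω‖ = 1 := hω.norm'_eq_one (Nat.succ_ne_zero t)
      rw [Complex.star_def, Complex.mul_conj, Complex.normSq_eq_norm_sq, hn]
      simp
    let f : I → ℂ := fun y => if y = x then ω else 1
    have hf : Matrix.diagonal f ∈ Matrix.unitaryGroup I ℂ := by
      rw [Matrix.mem_unitaryGroup_iff, Matrix.star_eq_conjTranspose, Matrix.diagonal_conjTranspose,
        Matrix.diagonal_mul_diagonal, ← Matrix.diagonal_one]
      congr 1
      funext y
      by_cases hy : y = x
      · simpa [f, hy] using hω1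
      · simp [f, hy]
    have hp : ∀ v : Fin t → I, ∏ i, f (v i) = ω ^ (Finset.univ.filter fun l => v l = x).card :=
      fun v => by
        simp only [f]
        rw [Finset.prod_ite, Finset.prod_const, Finset.prod_const_one, mul_one]
    have h1 := congrFun (congrFun (hA ⟨_, hf⟩) (typeOf v)) (typeOf v')
    rw [Matrix.mul_apply, Matrix.mul_apply, Finset.sum_eq_single (typeOf v),
      Finset.sum_eq_single (typeOf v')] at h1
    · rw [symPow_diagonal, symPow_diagonal, if_pos rfl, if_pos rfl, hp, hp, mul_comm] at h1
      by_contra h0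
      refine hx (hω.pow_inj ?_ ?_ (mul_left_cancel₀ h0 h1))
      · exact Nat.lt_succ_of_le ((Finset.card_le_univ _).trans (Fintype.card_fin t).le)
      · exact Nat.lt_succ_of_le ((Finset.card_le_univ _).trans (Fintype.card_fin t).le)
    · intro T _ hT
      obtain ⟨w, rfl⟩ := typeOf_surjective T
      rw [symPow_diagonal, if_neg hT, mul_zero]
    · simp
    · intro T _ hT
      rw [symPow_diagonal, if_neg hT.symm, zero_mul]
    · simp
  -- With `A` diagonal, commutation at the entry `(T, constant type)` compares two diagonal entries
  -- of `A` through a nonzero factor.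
  obtain ⟨V, hV⟩ := exists_unitary_ne_zero I
  obtain ⟨x⟩ := ‹Nonempty I›
  refine ⟨A (typeOf fun _ => x) (typeOf fun _ => x), ?_⟩
  ext T T'
  rw [Matrix.smul_apply, Matrix.one_apply, smul_eq_mul]
  split_ifs with h
  · subst h
    have h1 := congrFun (congrFun (hA V) T) (typeOf fun _ => x)
    rw [Matrix.mul_apply, Matrix.mul_apply, Finset.sum_eq_single (typeOf fun _ => x),
      Finset.sum_eq_single T, mul_comm] at h1
    · rw [mul_one]
      exact (mul_right_cancel₀ (symPow_const_ne_zero _ x (fun y => hV y x) T) h1).symm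
    · intro S _ hS
      rw [hoff _ _ hS.symm, zero_mul]
    · simp
    · intro S _ hS
      rw [hoff _ _ hS, mul_zero]
    · simp
  · rw [hoff _ _ h, mul_zero]

end Commutant

/-! ### Averaging over the Haar measure -/

section Haar

open MeasureTheory

variable {I : Type} [Fintype I] [DecidableEq I] {t : ℕ}

instance : IsProbabilityMeasure (haarUnitary I) :=
  ⟨by rw [haarUnitary]; exact Measure.haarMeasure_self⟩

instance : (haarUnitary I).IsMulLeftInvariant := by
  rw [haarUnitary]
  infer_instance

theorem integrable_haarUnitary {f : Matrix.unitaryGroup I ℂ → ℂ} (hf : Continuous f) :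
    Integrable f (haarUnitary I) :=
  hf.integrable_of_hasCompactSupport (HasCompactSupport.of_compactSpace f)

theorem continuous_symPow : Continuous fun U : Matrix.unitaryGroup I ℂ =>
    symPow t (U : Matrix I I ℂ) := by
  refine Continuous.matrix_mul (Continuous.matrix_mul continuous_const ?_) continuous_const
  refine continuous_matrix fun y x => ?_
  have h : Continuous fun U : Matrix.unitaryGroup I ℂ => ∏ i, (U : Matrix I I ℂ) (y i) (x i) :=
    continuous_finsetProd _ fun i _ => continuous_subtype_val.matrix_elem _ _
  exact h

/-- The average of `X` over the conjugations with the symmetric powers of unitary matrices. -/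
def twirl (X : Matrix (Sym I t) (Sym I t) ℂ) : Matrix (Sym I t) (Sym I t) ℂ :=
  Matrix.of fun T T' => ∫ U, (symPow t (U : Matrix I I ℂ) * X * (symPow t (U : Matrix I I ℂ))ᴴ) T T'
    ∂haarUnitary I

theorem continuous_twirl_integrand (X : Matrix (Sym I t) (Sym I t) ℂ) (T T' : Sym I t) :
    Continuous fun U : Matrix.unitaryGroup I ℂ =>
      (symPow t (U : Matrix I I ℂ) * X * (symPow t (U : Matrix I I ℂ))ᴴ) T T' :=
  ((continuous_symPow.matrix_mul continuous_const).matrix_mul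
    continuous_symPow.matrix_conjTranspose).matrix_elem T T'

/-- Left invariance of the measure, combined with multiplicativity of `symPow`. -/
theorem symPow_mul_twirl (X : Matrix (Sym I t) (Sym I t) ℂ) (V : Matrix.unitaryGroup I ℂ) :
    symPow t (V : Matrix I I ℂ) * twirl X * (symPow t (V : Matrix I I ℂ))ᴴ = twirl X := by
  ext T T'
  rw [conj_apply, twirl, Matrix.of_apply, ← integral_mul_left_eq_self _ V]
  have h : ∀ U : Matrix.unitaryGroup I ℂ, (symPow t ((V * U : Matrix.unitaryGroup I ℂ) : Matrix I I ℂ) * X *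
      (symPow t ((V * U : Matrix.unitaryGroup I ℂ) : Matrix I I ℂ))ᴴ) T T' =
      ∑ S, ∑ S', symPow t (V : Matrix I I ℂ) T S *
        (symPow t (U : Matrix I I ℂ) * X * (symPow t (U : Matrix I I ℂ))ᴴ) S S' *
          star (symPow t (V : Matrix I I ℂ) T' S') := fun U => by
    rw [← conj_apply, Matrix.UnitaryGroup.mul_val, symPow_mul, Matrix.conjTranspose_mul]
    simp only [Matrix.mul_assoc]
  simp only [h]
  have hi : ∀ S S', Integrable (fun U : Matrix.unitaryGroup I ℂ => symPow t (V : Matrix I I ℂ) T S *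
        (symPow t (U : Matrix I I ℂ) * X * (symPow t (U : Matrix I I ℂ))ᴴ) S S' *
          star (symPow t (V : Matrix I I ℂ) T' S')) (haarUnitary I) := fun S S' =>
    integrable_haarUnitary ((continuous_const.mul (continuous_twirl_integrand X S S')).mul
      continuous_const)
  rw [integral_finsetSum _ fun S _ => integrable_finsetSum _ fun S' _ => hi S S']
  refine Finset.sum_congr rfl fun S _ => ?_
  rw [integral_finsetSum _ fun S' _ => hi S S']
  refine Finset.sum_congr rfl fun S' _ => ?_
  rw [integral_mul_const, integral_const_mul]
  rfl

theorem unitaryGroup_isometry (U : Matrix.unitaryGroup I ℂ) :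
    (U : Matrix I I ℂ)ᴴ * (U : Matrix I I ℂ) = 1 :=
  Matrix.mem_unitaryGroup_iff'.1 U.2

/-- The average commutes with all symmetric powers, hence is scalar; conjugation preserves the
trace, which fixes the scalar. -/
theorem twirl_eq [Nonempty I] (X : Matrix (Sym I t) (Sym I t) ℂ) :
    twirl X = (X.trace / Fintype.card (Sym I t)) • 1 := by
  obtain ⟨c, hc⟩ := eq_smul_one_of_commute (twirl X) fun V => by
    conv_rhs => rw [← symPow_mul_twirl X V, Matrix.mul_assoc, symPow_isometry _ (unitaryGroup_isometry V),
      Matrix.mul_one]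
  have htr : (twirl X).trace = X.trace := by
    rw [Matrix.trace]
    simp only [Matrix.diag_apply, twirl, Matrix.of_apply]
    rw [← integral_finsetSum _ fun T _ => integrable_haarUnitary (continuous_twirl_integrand X T T)]
    have h : ∀ U : Matrix.unitaryGroup I ℂ, ∑ T, (symPow t (U : Matrix I I ℂ) * X *
        (symPow t (U : Matrix I I ℂ))ᴴ) T T = X.trace := fun U => by
      change Matrix.trace _ = _
      rw [Matrix.trace_mul_comm, ← Matrix.mul_assoc, symPow_isometry _ (unitaryGroup_isometry U), Matrix.one_mul]
    simp only [h]
    simp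
  rw [hc, Matrix.trace_smul, Matrix.trace_one, smul_eq_mul] at htr
  obtain ⟨x⟩ := ‹Nonempty I›
  have : Nonempty (Sym I t) := ⟨typeOf fun _ => x⟩
  have h0 : (Fintype.card (Sym I t) : ℂ) ≠ 0 := Nat.cast_ne_zero.2 Fintype.card_ne_zero
  rw [hc, ← htr, mul_div_cancel_right₀ _ h0]

/-- After a Haar random unitary, a state with reference qubits only depends on the state of the
reference qubits. -/
theorem integral_ampliate [Nonempty I] {R K : Type} [Fintype K] [DecidableEq K]
    (G : Matrix (Sym I t) K ℂ) (hG : Gᴴ * G = 1) (ρ : Matrix (R × K) (R × K) ℂ) (r r' : R)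
    (T T' : Sym I t) :
    ∫ U, ampliate (conjBy (symPow t ((U : Matrix.unitaryGroup I ℂ) : Matrix I I ℂ) * G)) ρ (r, T) (r', T')
        ∂haarUnitary I =
      if T = T' then reducedRef ρ r r' / Fintype.card (Sym I t) else 0 := by
  let X : Matrix (Sym I t) (Sym I t) ℂ := G * (Matrix.of fun i i' => ρ (r, i) (r', i')) * Gᴴ
  have h : ∀ U : Matrix.unitaryGroup I ℂ,
      ampliate (conjBy (symPow t (U : Matrix I I ℂ) * G)) ρ (r, T) (r', T') =
        (symPow t (U : Matrix I I ℂ) * X * (symPow t (U : Matrix I I ℂ))ᴴ) T T' := fun U => by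
    rw [ampliate, Matrix.of_apply, conjBy, Matrix.conjTranspose_mul]
    simp only [X, Matrix.mul_assoc]
  simp only [h]
  have hX : X.trace = reducedRef ρ r r' := by
    rw [Matrix.trace_mul_comm, ← Matrix.mul_assoc, hG, Matrix.one_mul]
    rfl
  refine (congrFun (congrFun (twirl_eq X) T) T').trans ?_
  rw [Matrix.smul_apply, Matrix.one_apply, hX, smul_eq_mul]
  split_ifs <;> simp

end Haar

/-! ### Perfect security against the Haar isometry -/

section HaarAttack

open MeasureTheory

/-- Output entries are linear in the input state with explicit coefficients, so that integrals over
unitaries can be moved from probabilities to states. -/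
theorem QCircuit.run_conj_apply {A B J : Type} [Fintype A] [DecidableEq A] [Fintype B]
    [DecidableEq B] [Fintype J] (C : QCircuit A B) (Z : Matrix (A → Bool) J ℂ) (b b' : B → Bool) :
    ∃ L : J → J → ℂ, ∀ σ : Matrix J J ℂ, C.run (Z * σ * Zᴴ) b b' = ∑ x, ∑ y, σ x y * L x y := by
  refine ⟨fun x y => ∑ g : RestWires C.out → Bool,
    C.outVec Z (glue C.out b g) x * star (C.outVec Z (glue C.out b' g) y), fun σ => ?_⟩
  rw [run_conj, traceOut_apply]
  simp only [conj_apply, Finset.mul_sum]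
  rw [Finset.sum_comm]
  refine Finset.sum_congr rfl fun x _ => ?_
  rw [Finset.sum_comm]
  refine Finset.sum_congr rfl fun y _ => Finset.sum_congr rfl fun g _ => ?_
  ring

theorem run_store_withRef_apply {ℓ : ℕ} {B : Type} [Fintype B] [DecidableEq B] (X : QSystem)
    (C : QCircuit (Fin ℓ ⊕ X.Wire) B) (b b' : B → Bool) :
    ∃ L : Qubits ℓ × X.Idx → Qubits ℓ × X.Idx → ℂ,
      ∀ σ : Matrix (Qubits ℓ × X.Idx) (Qubits ℓ × X.Idx) ℂ,
        C.run ((X.withRef ℓ).store σ) b b' = ∑ x, ∑ y, σ x y * L x y :=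
  C.run_conj_apply (X.withRef ℓ).storeIso b b'

theorem run_store_typeSystem_apply {ℓ t N : ℕ} {B : Type} [Fintype B] [DecidableEq B]
    (C : QCircuit (Fin ℓ ⊕ Fin t × Fin N) B) (b b' : B → Bool) :
    ∃ L : Qubits ℓ × Sym (Qubits N) t → Qubits ℓ × Sym (Qubits N) t → ℂ,
      ∀ σ : Matrix (Qubits ℓ × Sym (Qubits N) t) (Qubits ℓ × Sym (Qubits N) t) ℂ,
        C.run (((typeSystem N t).withRef ℓ).store σ) b b' = ∑ x, ∑ y, σ x y * L x y :=
  run_store_withRef_apply (typeSystem N t) C b b'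

variable {I : Type} [Fintype I] [DecidableEq I] {t : ℕ}

theorem continuous_ampliate {R K : Type} [Fintype K] (G : Matrix (Sym I t) K ℂ)
    (ρ : Matrix (R × K) (R × K) ℂ) (x y : R × Sym I t) :
    Continuous fun U : Matrix.unitaryGroup I ℂ =>
      ampliate (conjBy (symPow t (U : Matrix I I ℂ) * G)) ρ x y :=
  (((continuous_symPow.matrix_mul continuous_const).matrix_mul continuous_const).matrix_mul
    (continuous_symPow.matrix_mul continuous_const).matrix_conjTranspose).matrix_elem _ _

/-- Encryption with a Haar random unitary is perfectly secure. -/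
theorem integral_acceptProb_eq {N ℓ : ℕ} {K : Type} [Fintype K] [DecidableEq K]
    (D : QCircuit (Fin ℓ ⊕ Fin t × Fin N) Unit) (G : Matrix (Sym (Qubits N) t) K ℂ)
    (hG : Gᴴ * G = 1) (ρ₀ ρ₁ : Matrix (Qubits ℓ × K) (Qubits ℓ × K) ℂ)
    (h : reducedRef ρ₀ = reducedRef ρ₁) :
    ∫ U, D.acceptProb (((typeSystem N t).withRef ℓ).store (ampliate (conjBy
        (symPow t ((U : Matrix.unitaryGroup (Qubits N) ℂ) : Matrix (Qubits N) (Qubits N) ℂ) * G)) ρ₀))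
        ∂haarUnitary (Qubits N) =
      ∫ U, D.acceptProb (((typeSystem N t).withRef ℓ).store (ampliate (conjBy
        (symPow t ((U : Matrix.unitaryGroup (Qubits N) ℂ) : Matrix (Qubits N) (Qubits N) ℂ) * G)) ρ₁))
        ∂haarUnitary (Qubits N) := by
  obtain ⟨L, hL⟩ := run_store_typeSystem_apply D (fun _ => true) (fun _ => true)
  have key : ∀ ρ : Matrix (Qubits ℓ × K) (Qubits ℓ × K) ℂ,
      ∫ U, D.acceptProb (((typeSystem N t).withRef ℓ).store (ampliate (conjBy
        (symPow t ((U : Matrix.unitaryGroup (Qubits N) ℂ) : Matrix (Qubits N) (Qubits N) ℂ) * G)) ρ))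
        ∂haarUnitary (Qubits N) = (∑ x, ∑ y, (if x.2 = y.2 then
          reducedRef ρ x.1 y.1 / Fintype.card (Sym (Qubits N) t) else 0) * L x y).re := by
    intro ρ
    let f : Matrix.unitaryGroup (Qubits N) ℂ → Matrix (Qubits ℓ × Sym (Qubits N) t)
        (Qubits ℓ × Sym (Qubits N) t) ℂ := fun U =>
      ampliate (conjBy (symPow t (U : Matrix (Qubits N) (Qubits N) ℂ) * G)) ρ
    have h1 : ∀ U : Matrix.unitaryGroup (Qubits N) ℂ,
        D.acceptProb (((typeSystem N t).withRef ℓ).store (ampliate (conjBy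
        (symPow t (U : Matrix (Qubits N) (Qubits N) ℂ) * G)) ρ)) =
          Complex.reCLM (∑ x, ∑ y, f U x y * L x y) := fun U => congrArg Complex.re (hL (f U))
    have hi : ∀ x y, Integrable (fun U => f U x y * L x y) (haarUnitary (Qubits N)) := fun x y =>
      integrable_haarUnitary ((continuous_ampliate G ρ x y).mul continuous_const)
    have hi' : ∀ x, Integrable (fun U => ∑ y, f U x y * L x y) (haarUnitary (Qubits N)) :=
      fun x => integrable_finsetSum _ fun y _ => hi x y
    simp only [h1]
    rw [Complex.reCLM.integral_comp_comm (integrable_finsetSum _ fun x _ => hi' x)]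
    refine congrArg Complex.re ?_
    rw [integral_finsetSum _ fun x _ => hi' x]
    refine Finset.sum_congr rfl fun x _ => ?_
    rw [integral_finsetSum _ fun y _ => hi x y]
    refine Finset.sum_congr rfl fun y _ => ?_
    rw [integral_mul_const]
    congr 1
    exact integral_ampliate G hG ρ x.1 y.1 x.2 y.2
  rw [key, key, h]

/-- The isometry that appends zeros. -/
def appendIso (n m : ℕ) : Matrix (Qubits (n + m)) (Qubits n) ℂ :=
  Matrix.of fun y x => if y = Fin.append x fun _ => false then 1 else 0

/-- Separates the Haar unitary from the fixed isometry, so that after `symPow` the latter is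
absorbed into the message. -/
theorem truncate_eq {n m : ℕ} (U : Matrix.unitaryGroup (Qubits (n + m)) ℂ) :
    truncate U = (U : Matrix (Qubits (n + m)) (Qubits (n + m)) ℂ) * appendIso n m := by
  ext y x
  simp [truncate, appendIso, Matrix.mul_apply]

theorem appendIso_isometry (n m : ℕ) : (appendIso n m)ᴴ * appendIso n m = 1 := by
  ext x x'
  have hinj : ∀ x x' : Qubits n, Fin.append x (fun _ : Fin m => false) = Fin.append x' (fun _ => false) ↔ x = x' :=
    fun x x' => ⟨fun h => funext fun i => by simpa using congrFun h (Fin.castAdd m i), fun h => h ▸ rfl⟩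
  simp [appendIso, Matrix.mul_apply, Matrix.one_apply, hinj, eq_comm (a := x')]

/-- The states of the distinguisher built from an adversary against the encryption. -/
theorem run_queryState {n N ℓ d : ℕ} {B : Type} [Fintype B]
    {D E : QCircuit (Fin ℓ ⊕ Fin t × Fin N) B}
    (hE : ∀ {J : Type} [Fintype J] (M : Matrix (Sym (Qubits N) t) J ℂ)
        (ρ : Matrix (Qubits ℓ × J) (Qubits ℓ × J) ℂ),
        E.run (((QSystem.copies t N).withRef ℓ).store
            (ampliate (conjBy (schurSym (Qubits N) t * M)) ρ)) =
          D.run (((typeSystem N t).withRef ℓ).store (ampliate (conjBy M) ρ)))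
    (V : Matrix (Qubits N) (Qubits n) ℂ) (e : Fin d ↪ Sym (Qubits n) t)
    (ρ : Matrix (Qubits ℓ × Fin d) (Qubits ℓ × Fin d) ℂ) :
    E.run (queryState ℓ t V (ampliate (conjBy (schurSym (Qubits n) t * selectIso e)) ρ)) =
      D.run (((typeSystem N t).withRef ℓ).store (ampliate (conjBy (symPow t V * selectIso e)) ρ)) := by
  rw [← hE, queryState, ← Matrix.mul_assoc, schurSym_mul_symPow, Matrix.mul_assoc]
  exact congrArg (fun z => E.run (((QSystem.copies t N).withRef ℓ).store z)) (ampliate_ampliate _ _ ρ)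

end HaarAttack

/-! ### Polynomial bounds and the triangle inequality -/

section Asymptotics

theorem PolyBounded.mono {f g : ℕ → ℕ} (hg : PolyBounded g) (h : ∀ κ, f κ ≤ g κ) :
    PolyBounded f := by
  obtain ⟨p, hp⟩ := hg
  exact ⟨p, fun κ => (h κ).trans (hp κ)⟩

theorem polyBounded_const (c : ℕ) : PolyBounded fun _ => c :=
  ⟨Polynomial.C c, fun κ => by simp⟩

theorem polyBounded_id : PolyBounded fun κ => κ :=
  ⟨Polynomial.X, fun κ => by simp⟩

theorem PolyBounded.add {f g : ℕ → ℕ} (hf : PolyBounded f) (hg : PolyBounded g) :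
    PolyBounded fun κ => f κ + g κ := by
  obtain ⟨p, hp⟩ := hf
  obtain ⟨q, hq⟩ := hg
  exact ⟨p + q, fun κ => by rw [Polynomial.eval_add]; exact add_le_add (hp κ) (hq κ)⟩

theorem PolyBounded.mul {f g : ℕ → ℕ} (hf : PolyBounded f) (hg : PolyBounded g) :
    PolyBounded fun κ => f κ * g κ := by
  obtain ⟨p, hp⟩ := hf
  obtain ⟨q, hq⟩ := hg
  exact ⟨p * q, fun κ => by rw [Polynomial.eval_mul]; exact Nat.mul_le_mul (hp κ) (hq κ)⟩

theorem PolyBounded.pow {f : ℕ → ℕ} (hf : PolyBounded f) (r : ℕ) :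
    PolyBounded fun κ => f κ ^ r := by
  obtain ⟨p, hp⟩ := hf
  exact ⟨p ^ r, fun κ => by rw [Polynomial.eval_pow]; exact Nat.pow_le_pow_left (hp κ) r⟩

theorem PolyBounded.typeStateSize {t N : ℕ → ℕ} (ht : PolyBounded t) (hN : PolyBounded N) :
    PolyBounded fun κ => t κ + typeStateSize (t κ) (N κ) :=
  ht.add (ht.mul (((polyBounded_const 1000).mul ((ht.add (polyBounded_const 1)).pow 3)).mul
    ((hN.add (polyBounded_const 1)).pow 2)))

theorem abs_keyAvg_sub_le {κ : ℕ} {x y : Qubits κ → ℝ} {a b ε : ℝ} (hx : |keyAvg κ x - a| ≤ ε)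
    (hy : |keyAvg κ y - b| ≤ ε) (hab : a = b) : |keyAvg κ x - keyAvg κ y| ≤ ε + ε := by
  rw [← hab, abs_sub_comm] at hy
  exact (abs_sub_le _ a _).trans (add_le_add hx hy)

end Asymptotics

/-! ### Dimensions of the symmetric subspaces -/

section Dimension

theorem card_sym_qubits (N t : ℕ) :
    Fintype.card (Sym (Qubits N) t) = (2 ^ N + t - 1).choose t := by
  rw [Sym.card_sym_eq_choose, Fintype.card_fun, Fintype.card_bool, Fintype.card_fin]

/-- After multiplication by `t!` both sides are products of `t` factors, and `2^(n+m) + i ≤ (2^n +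
i) * 2^m` for each of them. -/
theorem choose_le_mul_choose (n m t : ℕ) :
    (2 ^ (n + m) + t - 1).choose t ≤ (2 ^ n + t - 1).choose t * 2 ^ (m * t) := by
  have h : (2 ^ (n + m)).ascFactorial t ≤ (2 ^ n).ascFactorial t * 2 ^ (m * t) := by
    rw [Nat.ascFactorial_eq_prod_range, Nat.ascFactorial_eq_prod_range, pow_mul]
    refine (Finset.prod_le_prod' (g := fun i => (2 ^ n + i) * 2 ^ m) fun i _ => ?_).trans ?_
    · rw [pow_add, add_mul]
      exact Nat.add_le_add_left (Nat.le_mul_of_pos_right i (by positivity)) _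
    · rw [Finset.prod_mul_distrib, Finset.prod_const, Finset.card_range]
  rw [Nat.ascFactorial_eq_factorial_mul_choose', Nat.ascFactorial_eq_factorial_mul_choose',
    mul_assoc] at h
  exact Nat.le_of_mul_le_mul_left h t.factorial_pos

end Dimension

/-! ### Assembling the security proof -/

section Scheme

variable {n m t : ℕ → ℕ} {F : ∀ κ, Qubits κ → Matrix (Qubits (n κ + m κ)) (Qubits (n κ)) ℂ}
  {d : ℕ → ℕ} (e : ∀ κ, Fin (d κ) ↪ Sym (Qubits (n κ)) (t κ))

theorem expand_enc (κ : ℕ) (k : Qubits κ) :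
    (expand n m t F d e).enc κ k = conjBy (symPow (t κ) (F κ k) * selectIso (e κ)) := by
  rw [symPow, Matrix.mul_assoc, mul_selectIso]
  rfl

/-- The scheme obtained from a pseudorandom isometry is a secure one-time encryption scheme. -/
theorem expand_isSecureOneTime (hn : PolyBounded n) (hm : PolyBounded m) (ht : PolyBounded t)
    (hF : IsSecurePRI n m F) : (expand n m t F d e).IsSecureOneTime := by
  have hs₁ := PolyBounded.typeStateSize ht hn
  have hs₂ := PolyBounded.typeStateSize ht (hn.add hm)
  obtain ⟨C, hC, hrun⟩ := hF.efficient
  refine ⟨?_, ?_, fun ℓ hℓ D hD => ?_⟩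
  · choose E hE hE' using fun κ => exists_encCircuit (C κ) (t κ)
    refine ⟨E, PolyBounded.mono ((((ht.mul hC).add polyBounded_id).add
      (ht.mul polyBounded_id)).add hs₁ |>.add hs₂) hE, fun κ k ρ => ?_⟩
    rw [expand_enc]
    exact hE' κ k (F κ k) (hF.isometry κ k) (hrun κ k) (e κ) ρ
  · choose E hE hE' using fun κ => exists_decCircuit (C κ) (t κ)
    refine ⟨E, PolyBounded.mono ((((((polyBounded_const 2).mul (ht.mul hC)).add
      (ht.mul (hn.add hm))).add polyBounded_id).add (ht.mul polyBounded_id)).add hs₁ |>.add hs₂) hE,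
      fun κ k ρ => ?_⟩
    rw [expand_enc]
    exact hE' κ k (F κ k) (hF.isometry κ k) (hrun κ k) (e κ) ρ
  · have hD' : ∀ κ, ∃ E : QCircuit (Fin (ℓ κ) ⊕ Fin (t κ) × Fin (n κ + m κ)) Unit,
        E.size ≤ (D κ).size + (t κ + typeStateSize (t κ) (n κ + m κ)) ∧
        ∀ (V : Matrix (Qubits (n κ + m κ)) (Qubits (n κ)) ℂ)
          (ρ : Matrix (Qubits (ℓ κ) × Fin (d κ)) (Qubits (ℓ κ) × Fin (d κ)) ℂ),
          E.acceptProb (queryState (ℓ κ) (t κ) V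
            (ampliate (conjBy (schurSym (Qubits (n κ)) (t κ) * selectIso (e κ))) ρ)) =
          (D κ).acceptProb (((typeSystem (n κ + m κ) (t κ)).withRef (ℓ κ)).store
            (ampliate (conjBy (symPow (t κ) V * selectIso (e κ))) ρ)) := fun κ => by
      obtain ⟨E, hE, hE'⟩ := exists_schurCircuit
        (D κ : QCircuit (Fin (ℓ κ) ⊕ Fin (t κ) × Fin (n κ + m κ)) Unit)
      exact ⟨E, hE, fun V ρ => congrArg (fun σ : Matrix (Unit → Bool) (Unit → Bool) ℂ =>
        (σ (fun _ => true) (fun _ => true)).re) (run_queryState hE' V (e κ) ρ)⟩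
    choose E hE hE' using hD'
    -- The distinguisher makes one query per tensor factor, so the number of queries is `t`.
    obtain ⟨ε, hε, hpr⟩ := hF.pseudorandom t ℓ ht hℓ E (PolyBounded.mono (hD.add hs₂) hE)
    have main : ∀ κ (ρ₀ ρ₁ : Matrix (Qubits (ℓ κ) × Fin (d κ)) (Qubits (ℓ κ) × Fin (d κ)) ℂ),
        IsDensity ρ₀ → IsDensity ρ₁ → reducedRef ρ₀ = reducedRef ρ₁ →
        |keyAvg κ (fun k => (D κ).acceptProb (((typeSystem (n κ + m κ) (t κ)).withRef (ℓ κ)).store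
            (ampliate (conjBy (symPow (t κ) (F κ k) * selectIso (e κ))) ρ₀))) -
          keyAvg κ (fun k => (D κ).acceptProb (((typeSystem (n κ + m κ) (t κ)).withRef (ℓ κ)).store
            (ampliate (conjBy (symPow (t κ) (F κ k) * selectIso (e κ))) ρ₁)))| ≤ ε κ + ε κ := by
      intro κ ρ₀ ρ₁ h₀ h₁ h
      have hS : ((schurSym (Qubits (n κ)) (t κ)) * selectIso (e κ))ᴴ *
          (schurSym (Qubits (n κ)) (t κ) * selectIso (e κ)) = 1 :=
        mul_isometry schurSym_isometry (selectIso_isometry (e κ))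
      have hG : (symPow (t κ) (appendIso (n κ) (m κ)) * selectIso (e κ))ᴴ *
          (symPow (t κ) (appendIso (n κ) (m κ)) * selectIso (e κ)) = 1 :=
        mul_isometry (symPow_isometry _ (appendIso_isometry _ _)) (selectIso_isometry (e κ))
      have g₀ := hpr κ _ (IsDensity.ampliate hS h₀)
      have g₁ := hpr κ _ (IsDensity.ampliate hS h₁)
      have hint := integral_acceptProb_eq
        (D κ : QCircuit (Fin (ℓ κ) ⊕ Fin (t κ) × Fin (n κ + m κ)) Unit) _ hG ρ₀ ρ₁ h
      -- Each message is within `ε` of the Haar experiment, and the two Haar experiments agree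
      -- exactly by `hint`; hence the loss `ε + ε`.
      simp only [hE', truncate_eq, symPow_mul, Matrix.mul_assoc] at g₀ g₁
      exact abs_keyAvg_sub_le g₀ g₁ hint
    refine ⟨fun κ => ε κ + ε κ, Asymptotics.SuperpolynomialDecay.add hε hε,
      fun κ ρ₀ ρ₁ h₀ h₁ h => ?_⟩
    have henc : (expand n m t F d e).enc κ = fun k =>
        conjBy (symPow (t κ) (F κ k) * selectIso (e κ)) := funext (expand_enc e κ)
    rw [henc]
    exact main κ ρ₀ ρ₁ h₀ h₁ h

end Scheme

end

theorem mainTheorem8 (n m t : ℕ → ℕ) (hn : PolyBounded n) (hm : PolyBounded m)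
    (ht : PolyBounded t)
    (F : ∀ κ, Qubits κ → Matrix (Qubits (n κ + m κ)) (Qubits (n κ)) ℂ)
    (hF : IsSecurePRI n m F) :
    (∀ (d : ℕ → ℕ) (e : ∀ κ, Fin (d κ) ↪ Sym (Qubits (n κ)) (t κ)),
      (expand n m t F d e).IsSecureOneTime ∧
      ∀ κ, ((expand n m t F d e).Msg κ).dim = d κ ∧
        ((expand n m t F d e).Ctx κ).dim = (2 ^ (n κ + m κ) + t κ - 1).choose (t κ)) ∧
    (∀ κ, Fintype.card (Sym (Qubits (n κ)) (t κ)) = (2 ^ n κ + t κ - 1).choose (t κ) ∧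
      ((2 ^ (n κ + m κ) + t κ - 1).choose (t κ) : ℚ) / 2 ^ (m κ * t κ) ≤
        ((2 ^ n κ + t κ - 1).choose (t κ) : ℚ)) := by
  refine ⟨fun d e => ⟨expand_isSecureOneTime e hn hm ht hF, fun κ => ⟨?_, ?_⟩⟩,
    fun κ => ⟨card_sym_qubits (n κ) (t κ), ?_⟩⟩
  · exact Fintype.card_fin (d κ)
  · exact card_sym_qubits (n κ + m κ) (t κ)
  · rw [div_le_iff₀ (by positivity)]
    exact_mod_cast choose_le_mul_choose (n κ) (m κ) (t κ)
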